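/- Let $\Sigma$ be a compact Riemannian 2-manifold without boundary, with Laplace--Beltrami operator $\Delta$, let $n\ge 0$ be an integer, $p_1,\dots,p_n\in\Sigma$ (not necessarily distinct), and $q>0$. Let $f:[0,\infty)\to\mathbb R$ be smooth and strictly increasing, and let $s\in\mathbb R$ satisfy $f(0)<s<\sup_{t>0}f(t)$. Let $(u,v)$ be a distributional solution on $\Sigma$ of the system $$-\Delta u=q\,(v-f(e^{u}))-4\pi\sum_{j=1}^n\delta_{p_j},\qquad -\Delta v=q\left[f'(e^{u})e^{u}(s-v)-q\,(v-f(e^{u}))\right],$$ that is, $u$, $v$, $f(e^u)$ and $f'(e^u)e^u(s-v)$ are integrable on $\Sigma$ and both equations hold in the sense of distributions. Then the following hold. 1. If $v$ is (almost everywhere) constant, then $n=0$; if moreover $f'(t)>0$ for all $t>0$, then $(e^{u},v)=(f^{-1}(s),s)$ almost everywhere. 2. If $n>0$, then $v$ is not (almost everywhere) constant. 3. $v$ is almost everywhere equal to a continuous function on $\Sigma$, and if $n>0$, then this function attains its maximum at a point of $\Sigma\setminus\{p_1,\dots,p_n\}$, and at none of the points $p_1,\dots,p_n$. -/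

import Mathlib

open Set MeasureTheory Bundle
open scoped Manifold ContDiff

noncomputable section

namespace VortexSystem

/-- The coordinate plane of a surface. -/
abbrev Plane : Type := EuclideanSpace ℝ (Fin 2)

/-- The partial derivative `∂ h / ∂ yᵢ` on the coordinate plane. -/
def partialDeriv (i : Fin 2) (h : Plane → ℝ) (y : Plane) : ℝ :=
  fderiv ℝ h y (EuclideanSpace.single i 1)

section Surface

variable {M : Type*} [TopologicalSpace M] [ChartedSpace Plane M] [IsManifold (𝓡 2) ∞ M]

/-- A smooth Riemannian metric on the surface `M`. -/
abbrev SurfaceMetric (M : Type*) [TopologicalSpace M] [ChartedSpace Plane M]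
    [IsManifold (𝓡 2) ∞ M] : Type _ :=
  ContMDiffRiemannianMetric (𝓡 2) ∞ Plane (fun x : M => TangentSpace (𝓡 2) x)

/-- The coordinate vector field `∂ / ∂ yᵢ` of the chart `e`, at the point with coordinates `y`. -/
def coordVector (e : OpenPartialHomeomorph M Plane) (i : Fin 2) (y : Plane) :
    TangentSpace (𝓡 2) (e.symm y) :=
  mfderiv 𝓘(ℝ, Plane) (𝓡 2) e.symm y (EuclideanSpace.single i (1 : ℝ) : Plane)

/-- The matrix `(g_{ij})` of the metric in the chart `e`. -/
def metricMatrix (g : SurfaceMetric M) (e : OpenPartialHomeomorph M Plane) (y : Plane) :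
    Matrix (Fin 2) (Fin 2) ℝ :=
  Matrix.of fun i j => g.inner (e.symm y) (coordVector e i y) (coordVector e j y)

/-- The density `√(det g_{ij})` of the Riemannian area in the chart `e`. -/
def areaDensity (g : SurfaceMetric M) (e : OpenPartialHomeomorph M Plane) (y : Plane) : ℝ :=
  Real.sqrt (metricMatrix g e y).det

/-- The Laplace-Beltrami operator in the chart `e`:
`Δ φ = (√det g)⁻¹ ∑ᵢ ∂ᵢ (√det g ∑ⱼ g^{ij} ∂ⱼ φ)`. -/
def laplaceBeltrami (g : SurfaceMetric M) (e : OpenPartialHomeomorph M Plane)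
    (φ : Plane → ℝ) (y : Plane) : ℝ :=
  (areaDensity g e y)⁻¹ * ∑ i : Fin 2,
    partialDeriv i
      (fun z => areaDensity g e z * ∑ j : Fin 2, (metricMatrix g e z)⁻¹ i j * partialDeriv j φ z) y

/-- `∫ h dA` over the domain of the chart `e`, for a function `h` of the coordinates;
`dA` is the Riemannian area. -/
def chartIntegral (g : SurfaceMetric M) (e : OpenPartialHomeomorph M Plane)
    (h : Plane → ℝ) : ℝ :=
  ∫ y in e.target, h y * areaDensity g e y

/-- `φ` is (the coordinate expression of) a test function supported in the domain of `e`. -/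
structure IsTestFunction (e : OpenPartialHomeomorph M Plane) (φ : Plane → ℝ) : Prop where
  smooth : ContDiff ℝ ∞ φ
  compact : HasCompactSupport φ
  support : tsupport φ ⊆ e.target

/-- `⟨w, φ⟩ = ∫ w φ dA`, the distribution defined by a locally integrable function `w`. -/
def funPairing (g : SurfaceMetric M) (w : M → ℝ) (e : OpenPartialHomeomorph M Plane)
    (φ : Plane → ℝ) : ℝ :=
  chartIntegral g e fun y => w (e.symm y) * φ y

/-- `⟨Δ w, φ⟩ = ∫ w Δφ dA`, the distributional Laplacian of a locally integrable function `w`. -/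
def laplacianPairing (g : SurfaceMetric M) (w : M → ℝ) (e : OpenPartialHomeomorph M Plane)
    (φ : Plane → ℝ) : ℝ :=
  chartIntegral g e fun y => w (e.symm y) * laplaceBeltrami g e φ y

open Classical in
/-- `⟨δ_x, φ⟩ = φ(x)`, the Dirac mass at `x ∈ M` (it vanishes off the domain of the chart). -/
def diracPairing (x : M) (e : OpenPartialHomeomorph M Plane) (φ : Plane → ℝ) : ℝ :=
  if x ∈ e.source then φ (e x) else 0

/-- `w` is locally integrable on `M` (on a compact `M`: integrable for the Riemannian area). -/
def LocIntegrable (w : M → ℝ) : Prop :=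
  ∀ e ∈ atlas Plane M, LocallyIntegrableOn (fun y => w (e.symm y)) e.target volume

/-- `P` holds almost everywhere on `M`: the exceptional set is Lebesgue-null in every chart,
that is, null for the Riemannian area. -/
def AlmostEverywhere (P : M → Prop) : Prop :=
  ∀ e ∈ atlas Plane M, ∀ᵐ y ∂(volume.restrict e.target), P (e.symm y)

/-- The derivative of a function of `t ≥ 0` (one-sided at `t = 0`). -/
def halfLineDeriv (f : ℝ → ℝ) (t : ℝ) : ℝ := derivWithin f (Ici 0) t

/-- `(u, v)` is a distributional solution on `M` of the system
`-Δu = q (v - f(eᵘ)) - 4π ∑ⱼ δ_{pⱼ}`,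
`-Δv = q [f'(eᵘ) eᵘ (s - v) - q (v - f(eᵘ))]`.
All the functions that occur are required to be locally integrable, so that they are
distributions; the equations are tested in every chart of the atlas.
The value of the function `u` at a single point, such as `pⱼ`, plays no role. -/
structure IsSolution (g : SurfaceMetric M) (f : ℝ → ℝ) (s q : ℝ) {n : ℕ} (p : Fin n → M)
    (u v : M → ℝ) : Prop where
  integrable_u : LocIntegrable u
  integrable_v : LocIntegrable v
  integrable_f : LocIntegrable fun x => f (Real.exp (u x))
  integrable_f' : LocIntegrable fun x =>
    halfLineDeriv f (Real.exp (u x)) * Real.exp (u x) * (s - v x)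
  eq_u : ∀ e ∈ atlas Plane M, ∀ φ : Plane → ℝ, IsTestFunction e φ →
    -laplacianPairing g u e φ =
      funPairing g (fun x => q * (v x - f (Real.exp (u x)))) e φ
        - 4 * Real.pi * ∑ j : Fin n, diracPairing (p j) e φ
  eq_v : ∀ e ∈ atlas Plane M, ∀ φ : Plane → ℝ, IsTestFunction e φ →
    -laplacianPairing g v e φ =
      funPairing g (fun x => q * (halfLineDeriv f (Real.exp (u x)) * Real.exp (u x) * (s - v x)
        - q * (v x - f (Real.exp (u x))))) e φ

end Surface

end VortexSystem

end

/-!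
All estimates are local. In a chart, `√(det g) Δ` is the operator `L φ = div (A ∇ φ)`, where
`A = √(det g) g⁻¹` is a symmetric positive matrix of determinant one; near a given point it extends
to coefficients on the whole plane (`Coeff`, `exists_coeff_of_chart`). The functions at hand are
only integrable and `L` acts on them as a distribution, so everything is derived from test functions
built on the quadratic form `ρ(x, y) = A⁻¹(m) (x - y) · (x - y)`, with coefficients frozen at the
midpoint `m` of `x` and `y` (`Coeff.rho`). This form is symmetric in `x` and `y`, and because of
`det A = 1` the quantities `A ∇ρ · ∇ρ` and `L ρ` are symmetric as well, up to errors two orders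
smaller than expected (`Coeff.ord_energy_rho_swap`, `Coeff.ord_op_rho_swap`).

Two families of functions of `ρ` are used. The kernels `ε⁻² η(ρ / ε²)` define a mollification whose
commutator with `L` is of order `ε` on `L¹`; passing to the limit in `L β(w_ε) ≥ β'(w_ε) L w_ε` for
convex increasing `β` gives Kato's inequality `Coeff.WeakGE.pos_part`. The truncated logarithms of
`ρ` (`Coeff.green`) satisfy `L G = 4 N_R - 4 N_ε`, with `N` the mollifying kernels, up to an error
bounded by the average of the kernels of the scales between `ε` and `R`. Hence, for `w ≥ 0`, the
quantity `4 w_R - 4 w_ε` equals `⟨w, L G⟩` up to `C R` times the largest mean of `w` at an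
intermediate scale (`Coeff.exists_integral_mul_op_green_le`), and for small `R` that error can be
absorbed. The results on distributional inequalities that are needed all follow:
* nonnegative functions with `L w ≥ -H` are locally bounded (`Coeff.WeakGE.exists_ae_le`);
* bounded functions with bounded `L w` are continuous (`Coeff.WeakGE.exists_continuousOn`);
* at a positive point mass of `L w` a solution `w` tends to `-∞` (`Coeff.exists_ae_ge_of_dirac`,
  applied to `-w`);
* a continuous function with `L w ≥ δ > 0` has no local maximum (`Coeff.not_weakGE_of_eq_zero`,
  applied to the difference from the maximum).

For the system, choose `t₁ = exp U` with `f t₁ > s`. By Kato's inequality and the monotonicity of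
`f`, the function `(v - f t₁)⁺ + q (u - U)⁺` is subharmonic, and so is `(f 0 - v)⁺`; thus `u` is
bounded above, `v` is bounded, both right-hand sides are bounded, and `v` is continuous. At a vortex
`exp u` tends to zero, and therefore `Δ v` tends to `q² (v - f 0)` there.

If `v` is constant, then `Δ v = 0`. A vortex would force `v = f 0`, by the limit of `Δ v`; but for
`v = f 0` the second equation gives `Δ v < 0`. So there is no vortex, and `u` is continuous. If
`v ≠ s` and `f' > 0`, then `Δ u` has the sign of `v - s` and the maximum principle fails at an
extremum of `u`; hence `v = s`, and the second equation gives `f (exp u) = s`.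

Suppose that the maximum of `v` is attained at a vortex. If its value exceeds `f 0`, then `Δ v > 0`
near the vortex, contrary to the maximum principle. Otherwise `v ≤ f 0` everywhere. At a point where
the minimum is less than `f 0`, the function `v` would be strictly superharmonic, which is
impossible; so `v = f 0` is constant, and there is no vortex.
-/

noncomputable section

namespace VortexSystem

/-! ### Divergence-form operators on the plane -/

section PartialDeriv

variable {i : Fin 2} {φ ψ : Plane → ℝ} {y : Plane}

lemma partialDeriv_add (hφ : DifferentiableAt ℝ φ y) (hψ : DifferentiableAt ℝ ψ y) :
    partialDeriv i (fun z => φ z + ψ z) y = partialDeriv i φ y + partialDeriv i ψ y := by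
  simp only [partialDeriv]
  rw [fderiv_fun_add hφ hψ]; rfl

lemma partialDeriv_sub (hφ : DifferentiableAt ℝ φ y) (hψ : DifferentiableAt ℝ ψ y) :
    partialDeriv i (fun z => φ z - ψ z) y = partialDeriv i φ y - partialDeriv i ψ y := by
  simp only [partialDeriv]
  rw [fderiv_fun_sub hφ hψ]; rfl

lemma partialDeriv_mul (hφ : DifferentiableAt ℝ φ y) (hψ : DifferentiableAt ℝ ψ y) :
    partialDeriv i (fun z => φ z * ψ z) y
      = partialDeriv i φ y * ψ y + φ y * partialDeriv i ψ y := by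
  simp only [partialDeriv]
  rw [fderiv_fun_mul hφ hψ]
  simp only [_root_.add_apply, _root_.smul_apply, smul_eq_mul]
  ring

lemma partialDeriv_const (k : ℝ) : partialDeriv i (fun _ => k) y = 0 := by
  simp [partialDeriv]

lemma partialDeriv_const_mul (k : ℝ) (hφ : DifferentiableAt ℝ φ y) :
    partialDeriv i (fun z => k * φ z) y = k * partialDeriv i φ y := by
  rw [partialDeriv_mul (differentiableAt_const k) hφ, partialDeriv_const]; ring

lemma partialDeriv_comp {F : ℝ → ℝ} (hF : DifferentiableAt ℝ F (φ y))
    (hφ : DifferentiableAt ℝ φ y) :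
    partialDeriv i (fun z => F (φ z)) y = deriv F (φ y) * partialDeriv i φ y := by
  simp only [partialDeriv]
  have := (hF.hasDerivAt.comp_hasFDerivAt y hφ.hasFDerivAt).fderiv
  rw [show (fun z => F (φ z)) = F ∘ φ from rfl, this]; rfl

lemma partialDeriv_congr (h : φ =ᶠ[nhds y] ψ) : partialDeriv i φ y = partialDeriv i ψ y := by
  simp only [partialDeriv, h.fderiv_eq]

lemma eventuallyEq_partialDeriv (h : φ =ᶠ[nhds y] ψ) :
    partialDeriv i φ =ᶠ[nhds y] partialDeriv i ψ := by
  filter_upwards [h.eventuallyEq_nhds] with z hz using partialDeriv_congr hz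

lemma contDiff_partialDeriv (hφ : ContDiff ℝ ∞ φ) : ContDiff ℝ ∞ (partialDeriv i φ) := by
  unfold partialDeriv
  exact (hφ.fderiv_right (m := ∞) (by norm_cast)).clm_apply contDiff_const

lemma tsupport_partialDeriv : tsupport (partialDeriv i φ) ⊆ tsupport φ := by
  refine closure_minimal ?_ (isClosed_tsupport φ)
  intro z hz
  by_contra h
  rw [notMem_tsupport_iff_eventuallyEq] at h
  exact hz (by rw [partialDeriv_congr h]; exact partialDeriv_const 0)

lemma hasCompactSupport_partialDeriv (hφ : HasCompactSupport φ) :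
    HasCompactSupport (partialDeriv i φ) :=
  hφ.mono' (subset_closure.trans tsupport_partialDeriv)

lemma integral_partialDeriv_eq_zero (hφ : ContDiff ℝ ∞ φ) (hc : HasCompactSupport φ) :
    ∫ y, partialDeriv i φ y = 0 := by
  have h := integral_mul_fderiv_eq_neg_fderiv_mul_of_integrable (μ := (volume : Measure Plane))
    (f := fun _ : Plane => (1 : ℝ)) (g := φ) (v := EuclideanSpace.single i (1 : ℝ)) ?_ ?_ ?_
    (by fun_prop) (fun z _ => hφ.differentiable (by simp) z)
  · simpa [partialDeriv] using h
  · simp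
  · simp only [one_mul]
    exact (contDiff_partialDeriv (i := i) hφ).continuous.integrable_of_hasCompactSupport
      (hasCompactSupport_partialDeriv hc)
  · simpa using hφ.continuous.integrable_of_hasCompactSupport hc

end PartialDeriv

/-- The coefficients of a second-order operator `div (A ∇ ·)` on the plane, with
`A = [[a, b], [b, c]]` smooth, symmetric, positive definite, of determinant one, and equal to the
identity outside a compact set. In a chart of a Riemannian surface, `A = √(det g) g⁻¹` has these
properties, up to a modification far away. -/
structure Coeff where
  /-- the upper left entry of the matrix -/
  a : Plane → ℝ
  /-- the off-diagonal entry of the matrix -/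
  b : Plane → ℝ
  /-- the lower right entry of the matrix -/
  c : Plane → ℝ
  smooth_a : ContDiff ℝ ∞ a
  smooth_b : ContDiff ℝ ∞ b
  smooth_c : ContDiff ℝ ∞ c
  pos_a : ∀ y, 0 < a y
  det_eq_one : ∀ y, a y * c y - b y ^ 2 = 1
  compact_a : HasCompactSupport fun y => a y - 1
  compact_b : HasCompactSupport b
  compact_c : HasCompactSupport fun y => c y - 1

namespace Coeff

variable (A : Coeff)

/-- The first component of `A ∇ φ`. -/
def flux₀ (φ : Plane → ℝ) (y : Plane) : ℝ :=
  A.a y * partialDeriv 0 φ y + A.b y * partialDeriv 1 φ y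

/-- The second component of `A ∇ φ`. -/
def flux₁ (φ : Plane → ℝ) (y : Plane) : ℝ :=
  A.b y * partialDeriv 0 φ y + A.c y * partialDeriv 1 φ y

/-- The operator `L φ = div (A ∇ φ)`. -/
def op (φ : Plane → ℝ) (y : Plane) : ℝ :=
  partialDeriv 0 (A.flux₀ φ) y + partialDeriv 1 (A.flux₁ φ) y

/-- The quadratic form `A ∇φ · ∇φ`. -/
def energy (φ : Plane → ℝ) (y : Plane) : ℝ :=
  A.a y * partialDeriv 0 φ y ^ 2 + 2 * A.b y * (partialDeriv 0 φ y * partialDeriv 1 φ y)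
    + A.c y * partialDeriv 1 φ y ^ 2

variable {A} {φ ψ : Plane → ℝ} {y : Plane}

lemma pos_c (A : Coeff) (y : Plane) : 0 < A.c y := by
  have h1 := A.det_eq_one y
  have h2 := A.pos_a y
  by_contra h
  nlinarith [sq_nonneg (A.b y), mul_nonneg h2.le (not_lt.1 h |> sub_nonneg.2)]

lemma energy_nonneg : 0 ≤ A.energy φ y := by
  have h1 := A.det_eq_one y
  have h2 := A.pos_a y
  have : A.a y * A.energy φ y = (A.a y * partialDeriv 0 φ y + A.b y * partialDeriv 1 φ y) ^ 2
      + partialDeriv 1 φ y ^ 2 := by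
    unfold energy
    linear_combination (partialDeriv 1 φ y ^ 2) * h1
  by_contra h
  nlinarith [sq_nonneg (A.a y * partialDeriv 0 φ y + A.b y * partialDeriv 1 φ y),
    sq_nonneg (partialDeriv 1 φ y), mul_pos h2 (neg_pos.2 (not_le.1 h))]

lemma contDiff_flux₀ (hφ : ContDiff ℝ ∞ φ) : ContDiff ℝ ∞ (A.flux₀ φ) :=
  (A.smooth_a.mul (contDiff_partialDeriv hφ)).add (A.smooth_b.mul (contDiff_partialDeriv hφ))

lemma contDiff_flux₁ (hφ : ContDiff ℝ ∞ φ) : ContDiff ℝ ∞ (A.flux₁ φ) :=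
  (A.smooth_b.mul (contDiff_partialDeriv hφ)).add (A.smooth_c.mul (contDiff_partialDeriv hφ))

lemma contDiff_op (hφ : ContDiff ℝ ∞ φ) : ContDiff ℝ ∞ (A.op φ) :=
  (contDiff_partialDeriv (contDiff_flux₀ hφ)).add (contDiff_partialDeriv (contDiff_flux₁ hφ))

lemma op_congr (h : φ =ᶠ[nhds y] ψ) : A.op φ y = A.op ψ y := by
  have h0 := eventuallyEq_partialDeriv (i := 0) h
  have h1 := eventuallyEq_partialDeriv (i := 1) h
  unfold op
  congr 1
  · apply partialDeriv_congr
    filter_upwards [h0, h1] with z hz0 hz1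
    simp only [flux₀, hz0, hz1]
  · apply partialDeriv_congr
    filter_upwards [h0, h1] with z hz0 hz1
    simp only [flux₁, hz0, hz1]

lemma op_const (k : ℝ) : A.op (fun _ => k) y = 0 := by
  have h0 : A.flux₀ (fun _ => k) = fun _ => 0 := by
    funext z; simp [flux₀, partialDeriv_const]
  have h1 : A.flux₁ (fun _ => k) = fun _ => 0 := by
    funext z; simp [flux₁, partialDeriv_const]
  simp [op, h0, h1, partialDeriv_const]

lemma tsupport_op : tsupport (A.op φ) ⊆ tsupport φ := by
  refine closure_minimal ?_ (isClosed_tsupport φ)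
  intro z hz
  by_contra h
  rw [notMem_tsupport_iff_eventuallyEq] at h
  exact hz (by rw [op_congr h]; exact op_const 0)

lemma op_eq_zero_of_notMem (h : y ∉ tsupport φ) : A.op φ y = 0 := by
  by_contra h'
  exact h (tsupport_op (subset_closure h'))

lemma hasCompactSupport_op (hφ : HasCompactSupport φ) : HasCompactSupport (A.op φ) :=
  hφ.mono' (subset_closure.trans tsupport_op)

lemma op_expand (hφ : ContDiff ℝ ∞ φ) :
    A.op φ y = A.a y * partialDeriv 0 (partialDeriv 0 φ) y
      + A.b y * partialDeriv 0 (partialDeriv 1 φ) y + A.b y * partialDeriv 1 (partialDeriv 0 φ) y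
      + A.c y * partialDeriv 1 (partialDeriv 1 φ) y
      + (partialDeriv 0 A.a y + partialDeriv 1 A.b y) * partialDeriv 0 φ y
      + (partialDeriv 0 A.b y + partialDeriv 1 A.c y) * partialDeriv 1 φ y := by
  have ha : DifferentiableAt ℝ A.a y := A.smooth_a.differentiable (by simp) y
  have hb : DifferentiableAt ℝ A.b y := A.smooth_b.differentiable (by simp) y
  have hc : DifferentiableAt ℝ A.c y := A.smooth_c.differentiable (by simp) y
  have h (i) : DifferentiableAt ℝ (partialDeriv i φ) y :=
    (contDiff_partialDeriv hφ).differentiable (by simp) y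
  unfold op flux₀ flux₁
  rw [partialDeriv_add (ha.fun_mul (h 0)) (hb.fun_mul (h 1)),
    partialDeriv_add (hb.fun_mul (h 0)) (hc.fun_mul (h 1)),
    partialDeriv_mul ha (h 0), partialDeriv_mul hb (h 1), partialDeriv_mul hb (h 0),
    partialDeriv_mul hc (h 1)]
  ring

/-- The chain rule `L (F ∘ φ) = F''(φ) A∇φ · ∇φ + F'(φ) L φ`. -/
lemma op_comp {F : ℝ → ℝ} (hF : ContDiff ℝ ∞ F) (hφ : ContDiff ℝ ∞ φ) :
    A.op (fun z => F (φ z)) y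
      = deriv (deriv F) (φ y) * A.energy φ y + deriv F (φ y) * A.op φ y := by
  have hF1 : ContDiff ℝ ∞ (deriv F) := (contDiff_infty_iff_deriv.1 hF).2
  have hd (i) : partialDeriv i (fun z => F (φ z)) = fun z => deriv F (φ z) * partialDeriv i φ z := by
    funext z
    exact partialDeriv_comp (hF.differentiable (by simp) _) (hφ.differentiable (by simp) _)
  have hdd (i j) : partialDeriv i (fun z => deriv F (φ z) * partialDeriv j φ z) y
      = deriv (deriv F) (φ y) * partialDeriv i φ y * partialDeriv j φ y
        + deriv F (φ y) * partialDeriv i (partialDeriv j φ) y := by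
    rw [partialDeriv_mul, partialDeriv_comp (hF1.differentiable (by simp) _)
      (hφ.differentiable (by simp) _)]
    · exact (hF1.comp hφ).differentiable (by simp) y
    · exact (contDiff_partialDeriv hφ).differentiable (by simp) y
  rw [op_expand (φ := fun z => F (φ z)) (hF.comp hφ), op_expand hφ]
  simp only [hd, hdd, energy]
  ring

/-- `L` is symmetric: `φ L ψ - ψ L φ` is the divergence of `φ A∇ψ - ψ A∇φ`. -/
lemma integral_mul_op (hφ : ContDiff ℝ ∞ φ) (hψ : ContDiff ℝ ∞ ψ) (hc : HasCompactSupport ψ) :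
    ∫ y, φ y * A.op ψ y = ∫ y, ψ y * A.op φ y := by
  have hX₀ : ContDiff ℝ ∞ fun z => φ z * A.flux₀ ψ z - ψ z * A.flux₀ φ z :=
    (hφ.mul (contDiff_flux₀ hψ)).sub (hψ.mul (contDiff_flux₀ hφ))
  have hX₁ : ContDiff ℝ ∞ fun z => φ z * A.flux₁ ψ z - ψ z * A.flux₁ φ z :=
    (hφ.mul (contDiff_flux₁ hψ)).sub (hψ.mul (contDiff_flux₁ hφ))
  have hz (z) (h : z ∉ tsupport ψ) : ψ z = 0 ∧ ∀ i, partialDeriv i ψ z = 0 :=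
    ⟨image_eq_zero_of_notMem_tsupport h, fun i =>
      image_eq_zero_of_notMem_tsupport fun h' => h (tsupport_partialDeriv h')⟩
  have hc₀ : HasCompactSupport fun z => φ z * A.flux₀ ψ z - ψ z * A.flux₀ φ z :=
    HasCompactSupport.intro hc fun z h => by simp [flux₀, hz z h]
  have hc₁ : HasCompactSupport fun z => φ z * A.flux₁ ψ z - ψ z * A.flux₁ φ z :=
    HasCompactSupport.intro hc fun z h => by simp [flux₁, hz z h]
  have key (z) : φ z * A.op ψ z - ψ z * A.op φ z
      = partialDeriv 0 (fun z => φ z * A.flux₀ ψ z - ψ z * A.flux₀ φ z) z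
        + partialDeriv 1 (fun z => φ z * A.flux₁ ψ z - ψ z * A.flux₁ φ z) z := by
    have d {χ : Plane → ℝ} (h : ContDiff ℝ ∞ χ) : DifferentiableAt ℝ χ z :=
      h.differentiable (by simp) z
    rw [partialDeriv_sub (d (hφ.mul (contDiff_flux₀ hψ))) (d (hψ.mul (contDiff_flux₀ hφ))),
      partialDeriv_sub (d (hφ.mul (contDiff_flux₁ hψ))) (d (hψ.mul (contDiff_flux₁ hφ))),
      partialDeriv_mul (d hφ) (d (contDiff_flux₀ hψ)), partialDeriv_mul (d hψ) (d (contDiff_flux₀ hφ)),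
      partialDeriv_mul (d hφ) (d (contDiff_flux₁ hψ)), partialDeriv_mul (d hψ) (d (contDiff_flux₁ hφ))]
    simp only [op]
    simp only [flux₀, flux₁]
    ring
  have hi₀ := (contDiff_partialDeriv (i := 0) hX₀).continuous.integrable_of_hasCompactSupport
    (μ := volume) (hasCompactSupport_partialDeriv hc₀)
  have hi₁ := (contDiff_partialDeriv (i := 1) hX₁).continuous.integrable_of_hasCompactSupport
    (μ := volume) (hasCompactSupport_partialDeriv hc₁)
  rw [← sub_eq_zero, ← integral_sub]
  · simp_rw [key]
    rw [integral_add hi₀ hi₁, integral_partialDeriv_eq_zero hX₀ hc₀,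
      integral_partialDeriv_eq_zero hX₁ hc₁, add_zero]
  · exact (hφ.continuous.mul (contDiff_op hψ).continuous).integrable_of_hasCompactSupport
      (hasCompactSupport_op hc).mul_left
  · exact (hψ.continuous.mul (contDiff_op hφ).continuous).integrable_of_hasCompactSupport
      hc.mul_right

end Coeff

end VortexSystem

namespace VortexSystem

/-! ### The squared quasi-distance attached to the coefficients -/

/-- A smooth function that is constant outside a compact set. -/
def IsTame (α : Plane → ℝ) : Prop :=
  ContDiff ℝ ∞ α ∧ ∃ k : ℝ, HasCompactSupport fun y => α y - k

namespace IsTame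

variable {α : Plane → ℝ}

lemma partialDeriv (h : IsTame α) (i : Fin 2) : IsTame (partialDeriv i α) := by
  obtain ⟨hs, k, hk⟩ := h
  refine ⟨contDiff_partialDeriv hs, 0, ?_⟩
  have : VortexSystem.partialDeriv i (fun y => α y - k) = VortexSystem.partialDeriv i α := by
    funext y
    rw [partialDeriv_sub (hs.differentiable (by simp) y) (by fun_prop), partialDeriv_const,
      sub_zero]
  simpa [this] using hasCompactSupport_partialDeriv (i := i) hk

lemma bounded (h : IsTame α) : ∃ C : ℝ, 0 ≤ C ∧ ∀ y, |α y| ≤ C := by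
  obtain ⟨hs, k, hk⟩ := h
  obtain ⟨C, hC⟩ := hk.exists_bound_of_continuous (hs.continuous.sub continuous_const)
  refine ⟨|C| + |k|, by positivity, fun y => ?_⟩
  have h1 := hC y
  rw [Real.norm_eq_abs] at h1
  calc |α y| = |(α y - k) + k| := by ring_nf
    _ ≤ |α y - k| + |k| := abs_add_le _ _
    _ ≤ |C| + |k| := add_le_add (h1.trans (le_abs_self C)) le_rfl

lemma fderiv_apply (α : Plane → ℝ) (y h : Plane) :
    fderiv ℝ α y h
      = h 0 * VortexSystem.partialDeriv 0 α y + h 1 * VortexSystem.partialDeriv 1 α y := by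
  have : h = h 0 • EuclideanSpace.single 0 (1 : ℝ) + h 1 • EuclideanSpace.single 1 (1 : ℝ) := by
    ext i; fin_cases i <;> simp
  conv_lhs => rw [this]
  rw [map_add, map_smul, map_smul]; rfl

lemma hasDerivAt_line (h : IsTame α) (m k : Plane) (t : ℝ) :
    HasDerivAt (fun t : ℝ => α (m + t • k))
      (k 0 * VortexSystem.partialDeriv 0 α (m + t • k)
        + k 1 * VortexSystem.partialDeriv 1 α (m + t • k)) t := by
  have h1 : HasDerivAt (fun t : ℝ => m + t • k) k t := by
    simpa using ((hasDerivAt_id t).smul_const k).const_add m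
  have h2 := (h.1.differentiable (by simp) (m + t • k)).hasFDerivAt.comp_hasDerivAt t h1
  rw [fderiv_apply] at h2
  exact h2

lemma abs_coord_le (k : Plane) (i : Fin 2) : |k i| ≤ ‖k‖ := by
  simpa using PiLp.norm_apply_le k i

lemma abs_lin_le {k : Plane} {u v B : ℝ} (hu : |u| ≤ B) (hv : |v| ≤ B) :
    |k 0 * u + k 1 * v| ≤ 2 * ‖k‖ * B := by
  have h0 := abs_coord_le k 0
  have h1 := abs_coord_le k 1
  calc |k 0 * u + k 1 * v| ≤ |k 0| * |u| + |k 1| * |v| := by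
        rw [← abs_mul, ← abs_mul]; exact abs_add_le _ _
    _ ≤ ‖k‖ * B + ‖k‖ * B := by gcongr
    _ = _ := by ring

lemma diff_one (h : IsTame α) : ∃ C : ℝ, 0 ≤ C ∧ ∀ m k : Plane, |α (m + k) - α m| ≤ C * ‖k‖ := by
  obtain ⟨C0, hC0, h0⟩ := (h.partialDeriv 0).bounded
  obtain ⟨C1, hC1, h1⟩ := (h.partialDeriv 1).bounded
  refine ⟨2 * (C0 + C1), by positivity, fun m k => ?_⟩
  have := norm_image_sub_le_of_norm_deriv_le_segment_01' (f := fun t : ℝ => α (m + t • k))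
    (C := 2 * (C0 + C1) * ‖k‖)
    (fun t _ => (h.hasDerivAt_line m k t).hasDerivWithinAt) (fun t _ => by
      rw [Real.norm_eq_abs]
      refine (abs_lin_le (B := C0 + C1) ((h0 _).trans (by linarith))
        ((h1 _).trans (by linarith))).trans (le_of_eq (by ring)))
  simpa using this

/-- The mean value inequality along the segment reduces this to first differences of the
derivatives. -/
lemma diff_two (h : IsTame α) :
    ∃ C : ℝ, 0 ≤ C ∧ ∀ m k : Plane, |α (m + k) + α (m - k) - 2 * α m| ≤ C * ‖k‖ ^ 2 := by
  obtain ⟨C0, hC0, h0⟩ := (h.partialDeriv 0).diff_one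
  obtain ⟨C1, hC1, h1⟩ := (h.partialDeriv 1).diff_one
  refine ⟨4 * (C0 + C1), by positivity, fun m k => ?_⟩
  have key {β : Plane → ℝ} {C : ℝ} (hC : 0 ≤ C) (hβ : ∀ m k : Plane, |β (m + k) - β m| ≤ C * ‖k‖)
      {t : ℝ} (ht : t ∈ Ico (0 : ℝ) 1) : |β (m + t • k) - β (m + t • (-k))| ≤ 2 * C * ‖k‖ := by
    have e1 := hβ m (t • k)
    have e2 := hβ m (t • (-k))
    rw [norm_smul, Real.norm_eq_abs, abs_of_nonneg ht.1] at e1 e2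
    rw [norm_neg] at e2
    have : t * ‖k‖ ≤ ‖k‖ := mul_le_of_le_one_left (norm_nonneg k) ht.2.le
    have : C * (t * ‖k‖) ≤ C * ‖k‖ := by gcongr
    calc |β (m + t • k) - β (m + t • (-k))|
        = |(β (m + t • k) - β m) - (β (m + t • (-k)) - β m)| := by ring_nf
      _ ≤ _ := abs_sub _ _
      _ ≤ _ := by linarith
  have := norm_image_sub_le_of_norm_deriv_le_segment_01'
    (f := fun t : ℝ => α (m + t • k) + α (m + t • (-k)))
    (C := 4 * (C0 + C1) * ‖k‖ ^ 2)
    (fun t _ => ((h.hasDerivAt_line m k t).add (h.hasDerivAt_line m (-k) t)).hasDerivWithinAt)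
    (fun t ht => by
      rw [Real.norm_eq_abs]
      have e := abs_lin_le (k := k) (B := 2 * (C0 + C1) * ‖k‖)
        ((key hC0 h0 ht).trans (by nlinarith [norm_nonneg k]))
        ((key hC1 h1 ht).trans (by nlinarith [norm_nonneg k]))
      refine le_trans (le_of_eq ?_) (e.trans (le_of_eq (by ring)))
      congr 1
      simp only [PiLp.neg_apply]
      ring)
  simp only [one_smul, zero_smul, add_zero, Real.norm_eq_abs, ← sub_eq_add_neg] at this
  rwa [two_mul (α m)]

/-- The central difference approximates the derivative to third order, one more than a one-sided
difference does. -/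
lemma diff_three (h : IsTame α) :
    ∃ C : ℝ, 0 ≤ C ∧ ∀ m k : Plane, |α (m + k) - α (m - k)
      - 2 * (k 0 * VortexSystem.partialDeriv 0 α m + k 1 * VortexSystem.partialDeriv 1 α m)|
        ≤ C * ‖k‖ ^ 3 := by
  obtain ⟨C0, hC0, h0⟩ := (h.partialDeriv 0).diff_two
  obtain ⟨C1, hC1, h1⟩ := (h.partialDeriv 1).diff_two
  refine ⟨2 * (C0 + C1), by positivity, fun m k => ?_⟩
  have key {β : Plane → ℝ} {C : ℝ} (hC : 0 ≤ C)
      (hβ : ∀ m k : Plane, |β (m + k) + β (m - k) - 2 * β m| ≤ C * ‖k‖ ^ 2)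
      {t : ℝ} (ht : t ∈ Ico (0 : ℝ) 1) :
      |β (m + t • k) + β (m + t • (-k)) - 2 * β m| ≤ C * ‖k‖ ^ 2 := by
    have e1 := hβ m (t • k)
    rw [norm_smul, Real.norm_eq_abs, abs_of_nonneg ht.1] at e1
    rw [smul_neg, ← sub_eq_add_neg]
    have : t * ‖k‖ ≤ ‖k‖ := mul_le_of_le_one_left (norm_nonneg k) ht.2.le
    have h0 : 0 ≤ t * ‖k‖ := mul_nonneg ht.1 (norm_nonneg k)
    exact e1.trans (by gcongr)
  set d := 2 * (k 0 * VortexSystem.partialDeriv 0 α m + k 1 * VortexSystem.partialDeriv 1 α m)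
    with hd
  have := norm_image_sub_le_of_norm_deriv_le_segment_01'
    (f := fun t : ℝ => (α (m + t • k) - α (m + t • (-k))) - t * d)
    (C := 2 * (C0 + C1) * ‖k‖ ^ 3)
    (fun t _ => (((h.hasDerivAt_line m k t).sub (h.hasDerivAt_line m (-k) t)).sub
      ((hasDerivAt_id t).mul_const d)).hasDerivWithinAt)
    (fun t ht => by
      rw [Real.norm_eq_abs]
      have e := abs_lin_le (k := k) (B := (C0 + C1) * ‖k‖ ^ 2)
        ((key hC0 h0 ht).trans (by nlinarith [sq_nonneg ‖k‖]))
        ((key hC1 h1 ht).trans (by nlinarith [sq_nonneg ‖k‖]))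
      refine le_trans (le_of_eq ?_) (e.trans (le_of_eq (by ring)))
      congr 1
      simp only [PiLp.neg_apply, hd]
      ring)
  simpa [← sub_eq_add_neg] using this

end IsTame

/-- `f x y = O(|x - y| ^ k)`, uniformly for `|x - y| ≤ 1`. -/
def OrderDiag (k : ℕ) (f : Plane → Plane → ℝ) : Prop :=
  ∃ C : ℝ, 0 ≤ C ∧ ∀ x y : Plane, ‖x - y‖ ≤ 1 → |f x y| ≤ C * ‖x - y‖ ^ k

namespace OrderDiag

variable {k l : ℕ} {f f' : Plane → Plane → ℝ}

lemma add (h : OrderDiag k f) (h' : OrderDiag k f') : OrderDiag k fun x y => f x y + f' x y := by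
  obtain ⟨C, hC, H⟩ := h
  obtain ⟨C', hC', H'⟩ := h'
  refine ⟨C + C', by positivity, fun x y hxy => ?_⟩
  have := H x y hxy
  have := H' x y hxy
  calc _ ≤ |f x y| + |f' x y| := abs_add_le _ _
    _ ≤ _ := by linarith

lemma mul (h : OrderDiag k f) (h' : OrderDiag l f') :
    OrderDiag (k + l) fun x y => f x y * f' x y := by
  obtain ⟨C, hC, H⟩ := h
  obtain ⟨C', hC', H'⟩ := h'
  refine ⟨C * C', by positivity, fun x y hxy => ?_⟩
  rw [abs_mul, pow_add]
  calc |f x y| * |f' x y| ≤ (C * ‖x - y‖ ^ k) * (C' * ‖x - y‖ ^ l) := by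
        gcongr
        exacts [H x y hxy, H' x y hxy]
    _ = _ := by ring

lemma const (c : ℝ) : OrderDiag 0 fun _ _ => c := ⟨|c|, abs_nonneg c, fun x y _ => by simp⟩

lemma neg (h : OrderDiag k f) : OrderDiag k fun x y => -f x y := by
  simpa using (const (-1)).mul h

lemma sub (h : OrderDiag k f) (h' : OrderDiag k f') : OrderDiag k fun x y => f x y - f' x y := by
  simpa [sub_eq_add_neg] using h.add h'.neg

lemma mono (h : OrderDiag k f) (hl : l ≤ k) : OrderDiag l f := by
  obtain ⟨C, hC, H⟩ := h
  refine ⟨C, hC, fun x y hxy => (H x y hxy).trans ?_⟩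
  gcongr C * ?_
  exact pow_le_pow_of_le_one (norm_nonneg _) hxy hl

lemma congr (h : OrderDiag k f) (e : ∀ x y, f' x y = f x y) : OrderDiag k f' := by
  rwa [show f' = f from funext fun x => funext fun y => e x y]

lemma coord (i : Fin 2) : OrderDiag 1 fun x y => x i - y i :=
  ⟨1, zero_le_one, fun x y _ => by simpa using IsTame.abs_coord_le (x - y) i⟩

end OrderDiag

/-- The midpoint of two points of the plane. -/
def mid (x y : Plane) : Plane := (1 / 2 : ℝ) • (x + y)

lemma mid_comm (x y : Plane) : mid x y = mid y x := by rw [mid, mid, add_comm]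

lemma mid_add (x y : Plane) : mid x y + (1 / 2 : ℝ) • (x - y) = x := by
  rw [mid, ← smul_add]; ext i; simp; ring

lemma mid_sub (x y : Plane) : mid x y - (1 / 2 : ℝ) • (x - y) = y := by
  rw [mid, ← smul_sub]; ext i; simp; ring

namespace IsTame

variable {α : Plane → ℝ}

lemma ord_mid (h : IsTame α) : OrderDiag 0 fun x y => α (mid x y) := by
  obtain ⟨C, hC, H⟩ := h.bounded
  exact ⟨C, hC, fun x y _ => by simpa using H _⟩

lemma ord_fst (h : IsTame α) : OrderDiag 0 fun x _ => α x := by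
  obtain ⟨C, hC, H⟩ := h.bounded
  exact ⟨C, hC, fun x y _ => by simpa using H _⟩

lemma norm_half (x y : Plane) : ‖(1 / 2 : ℝ) • (x - y)‖ ≤ ‖x - y‖ := by
  rw [norm_smul]; norm_num; linarith [norm_nonneg (x - y)]

lemma ord_fst_sub_mid (h : IsTame α) : OrderDiag 1 fun x y => α x - α (mid x y) := by
  obtain ⟨C, hC, H⟩ := h.diff_one
  refine ⟨C, hC, fun x y _ => ?_⟩
  have := H (mid x y) ((1 / 2 : ℝ) • (x - y))
  rw [mid_add] at this
  rw [pow_one]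
  exact this.trans (by gcongr; exact norm_half x y)

lemma ord_fst_sub_snd (h : IsTame α) : OrderDiag 1 fun x y => α x - α y := by
  obtain ⟨C, hC, H⟩ := h.diff_one
  refine ⟨C, hC, fun x y _ => ?_⟩
  have := H y (x - y)
  rwa [add_sub_cancel, ← pow_one ‖x - y‖] at this

lemma ord_two (h : IsTame α) : OrderDiag 2 fun x y => α x + α y - 2 * α (mid x y) := by
  obtain ⟨C, hC, H⟩ := h.diff_two
  refine ⟨C, hC, fun x y _ => ?_⟩
  have := H (mid x y) ((1 / 2 : ℝ) • (x - y))
  rw [mid_add, mid_sub] at this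
  exact this.trans (by gcongr; exact norm_half x y)

lemma ord_three (h : IsTame α) : OrderDiag 3 fun x y => α x - α y
    - ((x 0 - y 0) * VortexSystem.partialDeriv 0 α (mid x y)
      + (x 1 - y 1) * VortexSystem.partialDeriv 1 α (mid x y)) := by
  obtain ⟨C, hC, H⟩ := h.diff_three
  refine ⟨C, hC, fun x y _ => ?_⟩
  have := H (mid x y) ((1 / 2 : ℝ) • (x - y))
  rw [mid_add, mid_sub] at this
  refine le_trans (le_of_eq ?_) (this.trans (by gcongr; exact norm_half x y))
  congr 1
  simp
  ring

end IsTame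

/-- The linear form with coefficients frozen at the midpoint, in `h = x - y`. -/
def midLin (α β : Plane → ℝ) (y x : Plane) : ℝ :=
  α (mid x y) * (x 0 - y 0) + β (mid x y) * (x 1 - y 1)

/-- The quadratic form `α h₀² - 2 β h₀ h₁ + γ h₁²` with coefficients frozen at the midpoint,
in `h = x - y`. -/
def midQuad (α β γ : Plane → ℝ) (y x : Plane) : ℝ :=
  α (mid x y) * ((x 0 - y 0) * (x 0 - y 0)) - β (mid x y) * (2 * ((x 0 - y 0) * (x 1 - y 1)))
    + γ (mid x y) * ((x 1 - y 1) * (x 1 - y 1))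

section MidCalculus

variable {α β γ : Plane → ℝ} {x y : Plane}

lemma partialDeriv_coord (i j : Fin 2) :
    partialDeriv i (fun z : Plane => z j - y j) x = if i = j then 1 else 0 := by
  have h : HasFDerivAt (fun z : Plane => z j - y j) (EuclideanSpace.proj j : Plane →L[ℝ] ℝ) x :=
    (EuclideanSpace.proj j : Plane →L[ℝ] ℝ).hasFDerivAt.sub_const (y j)
  rw [partialDeriv, h.fderiv]
  simp [eq_comm]

lemma partialDeriv_mid (i : Fin 2) (hα : Differentiable ℝ α) :
    partialDeriv i (fun z => α (mid z y)) x = 1 / 2 * partialDeriv i α (mid x y) := by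
  have h : HasFDerivAt (fun z => mid z y) ((1 / 2 : ℝ) • ContinuousLinearMap.id ℝ Plane) x :=
    ((hasFDerivAt_id x).add_const y).const_smul (1 / 2 : ℝ)
  have := ((hα (mid x y)).hasFDerivAt.comp x h).fderiv
  rw [partialDeriv, show (fun z => α (mid z y)) = α ∘ fun z => mid z y from rfl, this, partialDeriv]
  simp

lemma differentiable_mid_left : Differentiable ℝ fun z => mid z y := by unfold mid; fun_prop

lemma partialDeriv_midLin (hα : Differentiable ℝ α) (hβ : Differentiable ℝ β) (i : Fin 2) :
    partialDeriv i (midLin α β y) x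
      = 1 / 2 * midLin (partialDeriv i α) (partialDeriv i β) y x
        + if i = 0 then α (mid x y) else β (mid x y) := by
  have dα : DifferentiableAt ℝ (fun z => α (mid z y)) x :=
    (hα.comp differentiable_mid_left) x
  have dβ : DifferentiableAt ℝ (fun z => β (mid z y)) x :=
    (hβ.comp differentiable_mid_left) x
  have dj (j : Fin 2) : DifferentiableAt ℝ (fun z : Plane => z j - y j) x := by fun_prop
  unfold midLin
  rw [partialDeriv_add (dα.fun_mul (dj 0)) (dβ.fun_mul (dj 1)), partialDeriv_mul dα (dj 0),
    partialDeriv_mul dβ (dj 1), partialDeriv_mid i hα, partialDeriv_mid i hβ,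
    partialDeriv_coord, partialDeriv_coord]
  fin_cases i <;> simp <;> ring

lemma partialDeriv_midQuad (hα : Differentiable ℝ α) (hβ : Differentiable ℝ β)
    (hγ : Differentiable ℝ γ) (i : Fin 2) :
    partialDeriv i (midQuad α β γ y) x
      = 1 / 2 * midQuad (partialDeriv i α) (partialDeriv i β) (partialDeriv i γ) y x
        + 2 * if i = 0 then midLin α (fun z => -β z) y x else midLin (fun z => -β z) γ y x := by
  have dα : DifferentiableAt ℝ (fun z => α (mid z y)) x :=
    (hα.comp differentiable_mid_left) x
  have dβ : DifferentiableAt ℝ (fun z => β (mid z y)) x :=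
    (hβ.comp differentiable_mid_left) x
  have dγ : DifferentiableAt ℝ (fun z => γ (mid z y)) x :=
    (hγ.comp differentiable_mid_left) x
  have dj (j : Fin 2) : DifferentiableAt ℝ (fun z : Plane => z j - y j) x := by fun_prop
  have djk (j k : Fin 2) : DifferentiableAt ℝ (fun z : Plane => (z j - y j) * (z k - y k)) x :=
    (dj j).fun_mul (dj k)
  unfold midQuad
  rw [partialDeriv_add ((dα.fun_mul (djk 0 0)).fun_sub (dβ.fun_mul ((djk 0 1).const_mul 2)))
      (dγ.fun_mul (djk 1 1)),
    partialDeriv_sub (dα.fun_mul (djk 0 0)) (dβ.fun_mul ((djk 0 1).const_mul 2)),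
    partialDeriv_mul dα (djk 0 0), partialDeriv_mul dβ ((djk 0 1).const_mul 2),
    partialDeriv_mul dγ (djk 1 1), partialDeriv_const_mul _ (djk 0 1),
    partialDeriv_mul (dj 0) (dj 0), partialDeriv_mul (dj 0) (dj 1), partialDeriv_mul (dj 1) (dj 1),
    partialDeriv_mid i hα, partialDeriv_mid i hβ, partialDeriv_mid i hγ,
    partialDeriv_coord, partialDeriv_coord]
  fin_cases i <;> simp [midLin] <;> ring

lemma OrderDiag.midLin (hα : IsTame α) (hβ : IsTame β) :
    OrderDiag 1 fun x y => midLin α β y x :=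
  (hα.ord_mid.mul (coord 0)).add (hβ.ord_mid.mul (coord 1))

lemma OrderDiag.midQuad (hα : IsTame α) (hβ : IsTame β) (hγ : IsTame γ) :
    OrderDiag 2 fun x y => midQuad α β γ y x :=
  ((hα.ord_mid.mul ((coord 0).mul (coord 0))).sub
    (hβ.ord_mid.mul ((const 2).mul ((coord 0).mul (coord 1))))).add
    (hγ.ord_mid.mul ((coord 1).mul (coord 1)))

end MidCalculus

end VortexSystem

namespace VortexSystem

namespace Coeff

variable (A : Coeff)

lemma tame_a : IsTame A.a := ⟨A.smooth_a, 1, A.compact_a⟩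
lemma tame_b : IsTame A.b := ⟨A.smooth_b, 0, by simpa using A.compact_b⟩
lemma tame_c : IsTame A.c := ⟨A.smooth_c, 1, A.compact_c⟩

/-- The quadratic form of the inverse matrix `A⁻¹`, frozen at the midpoint of `x` and `y`, at the
vector `x - y`. It is symmetric in `x` and `y` and agrees to fourth order with the squared
Riemannian distance of the metric `A⁻¹`. -/
def rho (y x : Plane) : ℝ := midQuad A.c A.b A.a y x

lemma rho_comm (x y : Plane) : A.rho y x = A.rho x y := by
  simp only [rho, midQuad, mid_comm y x]; ring

lemma contDiff_rho : ContDiff ℝ ∞ fun p : Plane × Plane => A.rho p.1 p.2 := by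
  have hm : ContDiff ℝ ∞ fun p : Plane × Plane => mid p.2 p.1 := by unfold mid; fun_prop
  have h1 := A.smooth_a.comp hm
  have h2 := A.smooth_b.comp hm
  have h3 := A.smooth_c.comp hm
  have e (i : Fin 2) : ContDiff ℝ ∞ fun p : Plane × Plane => p.2 i - p.1 i := by fun_prop
  exact ((h3.mul ((e 0).mul (e 0))).sub (h2.mul (contDiff_const.mul ((e 0).mul (e 1))))).add
    (h1.mul ((e 1).mul (e 1)))

lemma contDiff_rho_right (y : Plane) : ContDiff ℝ ∞ (A.rho y) :=
  A.contDiff_rho.comp (contDiff_const.prodMk contDiff_id)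

/-- Uniform ellipticity. -/
lemma exists_rho_bounds : ∃ T : ℝ, 1 ≤ T ∧ ∀ x y,
    ‖x - y‖ ^ 2 ≤ T * A.rho y x ∧ A.rho y x ≤ T * ‖x - y‖ ^ 2 := by
  obtain ⟨Ca, hCa, ha⟩ := A.tame_a.bounded
  obtain ⟨Cc, hCc, hc⟩ := A.tame_c.bounded
  refine ⟨1 + Ca + Cc, by linarith, fun x y => ?_⟩
  have hn : ‖x - y‖ ^ 2 = (x 0 - y 0) * (x 0 - y 0) + (x 1 - y 1) * (x 1 - y 1) := by
    rw [EuclideanSpace.norm_sq_eq, Fin.sum_univ_two]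
    simp [← sq]
  have h1 := (abs_le.1 (ha (mid x y))).2
  have h2 := (abs_le.1 (hc (mid x y))).2
  have hd := A.det_eq_one (mid x y)
  have pa := A.pos_a (mid x y)
  have pc := A.pos_c (mid x y)
  rw [hn]
  unfold rho midQuad
  generalize x 0 - y 0 = h₀
  generalize x 1 - y 1 = h₁
  generalize A.a (mid x y) = a at *
  generalize A.b (mid x y) = b at *
  generalize A.c (mid x y) = c at *
  have e1 : (a + c) * (c * (h₀ * h₀) - b * (2 * (h₀ * h₁)) + a * (h₁ * h₁))
      = h₀ * h₀ + h₁ * h₁ + (c * h₀ - b * h₁) ^ 2 + (b * h₀ - a * h₁) ^ 2 := by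
    linear_combination (h₀ * h₀ + h₁ * h₁) * hd
  have e2 : a * ((a + c) * (h₀ * h₀ + h₁ * h₁)
        - (c * (h₀ * h₀) - b * (2 * (h₀ * h₁)) + a * (h₁ * h₁)))
      = (a * h₀ + b * h₁) ^ 2 + h₁ * h₁ := by
    linear_combination (h₁ * h₁) * hd
  have p0 : 0 ≤ c * (h₀ * h₀) - b * (2 * (h₀ * h₁)) + a * (h₁ * h₁) := by
    by_contra h
    nlinarith [sq_nonneg (c * h₀ - b * h₁), sq_nonneg (b * h₀ - a * h₁), mul_self_nonneg h₀,
      mul_self_nonneg h₁, mul_pos (add_pos pa pc) (neg_pos.2 (not_le.1 h))]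
  have p1 : 0 ≤ (a + c) * (h₀ * h₀ + h₁ * h₁)
        - (c * (h₀ * h₀) - b * (2 * (h₀ * h₁)) + a * (h₁ * h₁)) := by
    by_contra h
    nlinarith [sq_nonneg (a * h₀ + b * h₁), mul_self_nonneg h₁,
      mul_pos pa (neg_pos.2 (not_le.1 h))]
  constructor
  · nlinarith [sq_nonneg (c * h₀ - b * h₁), sq_nonneg (b * h₀ - a * h₁)]
  · nlinarith [mul_self_nonneg h₀, mul_self_nonneg h₁]

/-- The quadratic part, in `x - y`, of the partial derivatives of `rho`. -/
def remQuad (i : Fin 2) (y x : Plane) : ℝ :=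
  1 / 2 * midQuad (partialDeriv i A.c) (partialDeriv i A.b) (partialDeriv i A.a) y x

/-- The quadratic part, in `x - y`, of the second partial derivatives of `rho`. -/
def remQuad₂ (i j : Fin 2) (y x : Plane) : ℝ :=
  1 / 4 * midQuad (partialDeriv i (partialDeriv j A.c)) (partialDeriv i (partialDeriv j A.b))
    (partialDeriv i (partialDeriv j A.a)) y x

lemma differentiable_a : Differentiable ℝ A.a := A.smooth_a.differentiable (by simp)
lemma differentiable_b : Differentiable ℝ A.b := A.smooth_b.differentiable (by simp)
lemma differentiable_c : Differentiable ℝ A.c := A.smooth_c.differentiable (by simp)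

lemma partialDeriv_zero_rho (y : Plane) : partialDeriv 0 (A.rho y)
    = fun x => 2 * midLin A.c (fun z => -A.b z) y x + A.remQuad 0 y x := by
  funext x
  change partialDeriv 0 (midQuad A.c A.b A.a y) x = _
  rw [partialDeriv_midQuad A.differentiable_c A.differentiable_b A.differentiable_a, remQuad]
  simp
  ring

lemma partialDeriv_one_rho (y : Plane) : partialDeriv 1 (A.rho y)
    = fun x => 2 * midLin (fun z => -A.b z) A.a y x + A.remQuad 1 y x := by
  funext x
  change partialDeriv 1 (midQuad A.c A.b A.a y) x = _
  rw [partialDeriv_midQuad A.differentiable_c A.differentiable_b A.differentiable_a, remQuad]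
  simp
  ring

lemma partialDeriv_neg' (i : Fin 2) (β : Plane → ℝ) :
    partialDeriv i (fun z => -β z) = fun z => -partialDeriv i β z := by
  funext z
  simp [partialDeriv, fderiv_fun_neg]

lemma contDiff_midLin {α β : Plane → ℝ} (hα : ContDiff ℝ ∞ α) (hβ : ContDiff ℝ ∞ β) (y : Plane) :
    ContDiff ℝ ∞ (midLin α β y) := by
  have hm : ContDiff ℝ ∞ fun z => mid z y := by unfold mid; fun_prop
  have e (i : Fin 2) : ContDiff ℝ ∞ fun p : Plane => p i - y i := by fun_prop
  exact ((hα.comp hm).mul (e 0)).add ((hβ.comp hm).mul (e 1))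

lemma contDiff_midQuad {α β γ : Plane → ℝ} (hα : ContDiff ℝ ∞ α) (hβ : ContDiff ℝ ∞ β)
    (hγ : ContDiff ℝ ∞ γ) (y : Plane) : ContDiff ℝ ∞ (midQuad α β γ y) := by
  have hm : ContDiff ℝ ∞ fun z => mid z y := by unfold mid; fun_prop
  have e (i : Fin 2) : ContDiff ℝ ∞ fun p : Plane => p i - y i := by fun_prop
  exact (((hα.comp hm).mul ((e 0).mul (e 0))).sub
    ((hβ.comp hm).mul (contDiff_const.mul ((e 0).mul (e 1))))).add
    ((hγ.comp hm).mul ((e 1).mul (e 1)))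

lemma partialDeriv_remQuad (i j : Fin 2) (x y : Plane) :
    partialDeriv i (A.remQuad j y) x = A.remQuad₂ i j y x
      + if i = 0 then midLin (partialDeriv j A.c) (fun z => -partialDeriv j A.b z) y x
        else midLin (fun z => -partialDeriv j A.b z) (partialDeriv j A.a) y x := by
  have h {α} (hα : ContDiff ℝ ∞ α) : Differentiable ℝ (partialDeriv j α) :=
    (contDiff_partialDeriv hα).differentiable (by simp)
  unfold remQuad
  rw [partialDeriv_const_mul, partialDeriv_midQuad (h A.smooth_c) (h A.smooth_b) (h A.smooth_a),
    remQuad₂]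
  · ring
  · exact (contDiff_midQuad (contDiff_partialDeriv A.smooth_c) (contDiff_partialDeriv A.smooth_b)
      (contDiff_partialDeriv A.smooth_a) y).differentiable (by simp) x

lemma contDiff_remQuad (i : Fin 2) (y : Plane) : ContDiff ℝ ∞ (A.remQuad i y) :=
  contDiff_const.mul (contDiff_midQuad (contDiff_partialDeriv A.smooth_c)
    (contDiff_partialDeriv A.smooth_b) (contDiff_partialDeriv A.smooth_a) y)

lemma partialDeriv_partialDeriv_zero_rho (i : Fin 2) (x y : Plane) :
    partialDeriv i (partialDeriv 0 (A.rho y)) x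
      = 2 * (if i = 0 then A.c (mid x y) else -A.b (mid x y))
        + midLin (partialDeriv i A.c) (fun z => -partialDeriv i A.b z) y x
        + (if i = 0 then midLin (partialDeriv 0 A.c) (fun z => -partialDeriv 0 A.b z) y x
          else midLin (fun z => -partialDeriv 0 A.b z) (partialDeriv 0 A.a) y x)
        + A.remQuad₂ i 0 y x := by
  have h1 := (contDiff_midLin A.smooth_c A.smooth_b.neg y).differentiable (by simp) x
  rw [partialDeriv_zero_rho, partialDeriv_add (h1.const_mul 2)
    ((A.contDiff_remQuad 0 y).differentiable (by simp) x), partialDeriv_const_mul _ h1,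
    partialDeriv_midLin A.differentiable_c A.differentiable_b.fun_neg, partialDeriv_remQuad,
    partialDeriv_neg']
  ring

lemma partialDeriv_partialDeriv_one_rho (i : Fin 2) (x y : Plane) :
    partialDeriv i (partialDeriv 1 (A.rho y)) x
      = 2 * (if i = 0 then -A.b (mid x y) else A.a (mid x y))
        + midLin (fun z => -partialDeriv i A.b z) (partialDeriv i A.a) y x
        + (if i = 0 then midLin (partialDeriv 1 A.c) (fun z => -partialDeriv 1 A.b z) y x
          else midLin (fun z => -partialDeriv 1 A.b z) (partialDeriv 1 A.a) y x)
        + A.remQuad₂ i 1 y x := by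
  have h1 := (contDiff_midLin A.smooth_b.neg A.smooth_a y).differentiable (by simp) x
  rw [partialDeriv_one_rho, partialDeriv_add (h1.const_mul 2)
    ((A.contDiff_remQuad 1 y).differentiable (by simp) x), partialDeriv_const_mul _ h1,
    partialDeriv_midLin A.differentiable_b.fun_neg A.differentiable_a, partialDeriv_remQuad,
    partialDeriv_neg']
  ring

/-- The derivative of `det A = 1`. -/
lemma partialDeriv_det (i : Fin 2) (z : Plane) :
    A.a z * partialDeriv i A.c z + A.c z * partialDeriv i A.a z
      - 2 * A.b z * partialDeriv i A.b z = 0 := by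
  have h : partialDeriv i (fun z => A.a z * A.c z - A.b z * A.b z) z = 0 := by
    rw [show (fun z => A.a z * A.c z - A.b z * A.b z) = fun _ => 1 from
      funext fun z => by rw [← sq]; exact A.det_eq_one z]
    exact partialDeriv_const 1
  have da := A.differentiable_a z
  have db := A.differentiable_b z
  have dc := A.differentiable_c z
  rw [partialDeriv_sub (da.fun_mul dc) (db.fun_mul db), partialDeriv_mul da dc,
    partialDeriv_mul db db] at h
  linarith

lemma ord_remQuad (i : Fin 2) : OrderDiag 2 fun x y => A.remQuad i y x :=
  (OrderDiag.const (1 / 2)).mul (OrderDiag.midQuad (A.tame_c.partialDeriv i)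
    (A.tame_b.partialDeriv i) (A.tame_a.partialDeriv i))

lemma ord_remQuad₂ (i j : Fin 2) : OrderDiag 2 fun x y => A.remQuad₂ i j y x :=
  (OrderDiag.const (1 / 4)).mul (OrderDiag.midQuad ((A.tame_c.partialDeriv j).partialDeriv i)
    ((A.tame_b.partialDeriv j).partialDeriv i) ((A.tame_a.partialDeriv j).partialDeriv i))

lemma _root_.VortexSystem.IsTame.neg {α : Plane → ℝ} (h : IsTame α) : IsTame fun z => -α z := by
  obtain ⟨hs, k, hk⟩ := h
  refine ⟨hs.neg, -k, ?_⟩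
  have : (fun y => -α y - -k) = fun y => -(α y - k) := by funext y; ring
  rw [this]
  exact hk.neg

lemma _root_.VortexSystem.IsTame.add {α β : Plane → ℝ} (h : IsTame α) (h' : IsTame β) :
    IsTame fun z => α z + β z := by
  obtain ⟨hs, k, hk⟩ := h
  obtain ⟨hs', k', hk'⟩ := h'
  refine ⟨hs.add hs', k + k', ?_⟩
  have : (fun y => α y + β y - (k + k')) = fun y => (α y - k) + (β y - k') := by funext y; ring
  rw [this]
  exact hk.add hk'

lemma ord_lin₀ : OrderDiag 1 fun x y => midLin A.c (fun z => -A.b z) y x :=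
  OrderDiag.midLin A.tame_c A.tame_b.neg

lemma ord_lin₁ : OrderDiag 1 fun x y => midLin (fun z => -A.b z) A.a y x :=
  OrderDiag.midLin A.tame_b.neg A.tame_a

lemma midLin_swap (α β : Plane → ℝ) (x y : Plane) : midLin α β x y = -midLin α β y x := by
  simp only [midLin, mid_comm y x]; ring

lemma remQuad_swap (i : Fin 2) (x y : Plane) : A.remQuad i x y = A.remQuad i y x := by
  simp only [remQuad, midQuad, mid_comm y x]; ring

lemma remQuad₂_swap (i j : Fin 2) (x y : Plane) : A.remQuad₂ i j x y = A.remQuad₂ i j y x := by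
  simp only [remQuad₂, midQuad, mid_comm y x]; ring

/-- As `∇ρ ≈ 2 A⁻¹ (x - y)`, the quantity `A ∇ρ · ∇ρ` equals `4 ρ` at leading order. -/
lemma ord_energy_rho : OrderDiag 3 fun x y => A.energy (A.rho y) x - 4 * A.rho y x := by
  have l0 := A.ord_lin₀
  have l1 := A.ord_lin₁
  have q0 := A.ord_remQuad 0
  have q1 := A.ord_remQuad 1
  have two := OrderDiag.const 2
  have p0 : OrderDiag 1 fun x y => 2 * midLin A.c (fun z => -A.b z) y x + A.remQuad 0 y x :=
    (two.mul l0).add (q0.mono (by norm_num))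
  have p1 : OrderDiag 1 fun x y => 2 * midLin (fun z => -A.b z) A.a y x + A.remQuad 1 y x :=
    (two.mul l1).add (q1.mono (by norm_num))
  have fa := A.tame_a.ord_fst_sub_mid
  have fb := A.tame_b.ord_fst_sub_mid
  have fc := A.tame_c.ord_fst_sub_mid
  have ma := A.tame_a.ord_mid
  have mb := A.tame_b.ord_mid
  have mc := A.tame_c.ord_mid
  have s0 : OrderDiag 1 fun x y => 4 * midLin A.c (fun z => -A.b z) y x + A.remQuad 0 y x :=
    ((OrderDiag.const 4).mul l0).add (q0.mono (by norm_num))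
  have s1 : OrderDiag 1 fun x y => 4 * midLin (fun z => -A.b z) A.a y x + A.remQuad 1 y x :=
    ((OrderDiag.const 4).mul l1).add (q1.mono (by norm_num))
  have H := ((((fa.mul (p0.mul p0)).add (fb.mul (two.mul (p0.mul p1)))).add (fc.mul (p1.mul p1))).add
    (ma.mul (q0.mul s0))).add
    ((mb.mul (two.mul ((((q0.mul l1).add (q1.mul l0)).mul two).add
      ((q0.mul q1).mono (show 2 + 1 ≤ 2 + 2 by norm_num))))).add (mc.mul (q1.mul s1)))
  refine H.congr fun x y => ?_
  simp only [energy, partialDeriv_zero_rho, partialDeriv_one_rho]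
  have hd := A.det_eq_one (mid x y)
  simp only [rho, midQuad, midLin]
  linear_combination (4 * (A.c (mid x y) * ((x 0 - y 0) * (x 0 - y 0))
    - A.b (mid x y) * (2 * ((x 0 - y 0) * (x 1 - y 1)))
    + A.a (mid x y) * ((x 1 - y 1) * (x 1 - y 1)))) * hd

/-- Exchanging the two points changes `A ∇ρ · ∇ρ` only at fifth order: the third-order terms
cancel because `ρ` is frozen at the midpoint and `det A` is constant. -/
lemma ord_energy_rho_swap :
    OrderDiag 5 fun x y => A.energy (A.rho y) x - A.energy (A.rho x) y := by
  have l0 := A.ord_lin₀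
  have l1 := A.ord_lin₁
  have q0 := A.ord_remQuad 0
  have q1 := A.ord_remQuad 1
  have two := OrderDiag.const 2
  have four := OrderDiag.const 4
  have ra := A.tame_a.ord_three
  have rb := A.tame_b.ord_three
  have rc := A.tame_c.ord_three
  have sa := A.tame_a.ord_two
  have sb := A.tame_b.ord_two
  have sc := A.tame_c.ord_two
  have da := A.tame_a.ord_fst_sub_snd
  have db := A.tame_b.ord_fst_sub_snd
  have dc := A.tame_c.ord_fst_sub_snd
  have H := ((((ra.mul (four.mul (l0.mul l0))).add (da.mul (q0.mul q0))).add
      ((sa.mul (l0.mul q0)).mul four)).add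
    (((rb.mul ((two.mul four).mul (l0.mul l1))).add (two.mul (db.mul (q0.mul q1)))).add
      (four.mul (sb.mul ((l0.mul q1).add (l1.mul q0)))))).add
    (((rc.mul (four.mul (l1.mul l1))).add (dc.mul (q1.mul q1))).add
      ((sc.mul (l1.mul q1)).mul four))
  refine H.congr fun x y => ?_
  simp only [energy, partialDeriv_zero_rho, partialDeriv_one_rho]
  simp only [midLin_swap _ _ x y, A.remQuad_swap _ x y]
  have h0 := A.partialDeriv_det 0 (mid x y)
  have h1 := A.partialDeriv_det 1 (mid x y)
  simp only [remQuad, midQuad, midLin]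
  generalize partialDeriv 0 A.a (mid x y) = a0 at *
  generalize partialDeriv 0 A.b (mid x y) = b0 at *
  generalize partialDeriv 0 A.c (mid x y) = c0 at *
  generalize partialDeriv 1 A.a (mid x y) = a1 at *
  generalize partialDeriv 1 A.b (mid x y) = b1 at *
  generalize partialDeriv 1 A.c (mid x y) = c1 at *
  generalize A.a (mid x y) = a at *
  generalize A.b (mid x y) = b at *
  generalize A.c (mid x y) = c at *
  generalize A.a x = ax at *
  generalize A.b x = bx at *
  generalize A.c x = cx at *
  generalize A.a y = ay at *
  generalize A.b y = b_y at *
  generalize A.c y = cy at *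
  generalize x 0 - y 0 = k0 at *
  generalize x 1 - y 1 = k1 at *
  linear_combination 4 * (c * (k0 * k0) - 2 * b * (k0 * k1) + a * (k1 * k1)) * (k0 * h0 + k1 * h1)

lemma op_rho (x y : Plane) : A.op (A.rho y) x
    = A.a x * (2 * A.c (mid x y)
        + 2 * midLin (partialDeriv 0 A.c) (fun z => -partialDeriv 0 A.b z) y x + A.remQuad₂ 0 0 y x)
      + A.b x * (-4 * A.b (mid x y)
        + 2 * (midLin (partialDeriv 1 A.c) (fun z => -partialDeriv 1 A.b z) y x
          + midLin (fun z => -partialDeriv 0 A.b z) (partialDeriv 0 A.a) y x)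
        + (A.remQuad₂ 0 1 y x + A.remQuad₂ 1 0 y x))
      + A.c x * (2 * A.a (mid x y)
        + 2 * midLin (fun z => -partialDeriv 1 A.b z) (partialDeriv 1 A.a) y x
        + A.remQuad₂ 1 1 y x)
      + (partialDeriv 0 A.a x + partialDeriv 1 A.b x)
        * (2 * midLin A.c (fun z => -A.b z) y x + A.remQuad 0 y x)
      + (partialDeriv 0 A.b x + partialDeriv 1 A.c x)
        * (2 * midLin (fun z => -A.b z) A.a y x + A.remQuad 1 y x) := by
  rw [op_expand (A.contDiff_rho_right y)]
  simp only [partialDeriv_partialDeriv_zero_rho, partialDeriv_partialDeriv_one_rho]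
  simp only [partialDeriv_zero_rho, partialDeriv_one_rho]
  simp
  ring

/-- At leading order `L ρ` is `2 tr (A A⁻¹) = 4`. -/
lemma ord_op_rho : OrderDiag 1 fun x y => A.op (A.rho y) x - 4 := by
  have l0 := A.ord_lin₀
  have l1 := A.ord_lin₁
  have q0 := (A.ord_remQuad 0).mono one_le_two
  have q1 := (A.ord_remQuad 1).mono one_le_two
  have qq (i j) := (A.ord_remQuad₂ i j).mono one_le_two
  have two := OrderDiag.const 2
  have ta (i) := A.tame_a.partialDeriv i
  have tb (i) := A.tame_b.partialDeriv i
  have tc (i) := A.tame_c.partialDeriv i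
  have fa := A.tame_a.ord_fst_sub_mid
  have fb := A.tame_b.ord_fst_sub_mid
  have fc := A.tame_c.ord_fst_sub_mid
  have H := (((((two.mul (fa.mul A.tame_c.ord_mid)).add
      ((OrderDiag.const (-4)).mul (fb.mul A.tame_b.ord_mid))).add
      (two.mul (fc.mul A.tame_a.ord_mid))).add
    (A.tame_a.ord_fst.mul ((two.mul (OrderDiag.midLin (tc 0) (tb 0).neg)).add (qq 0 0)))).add
    ((A.tame_b.ord_fst.mul ((two.mul ((OrderDiag.midLin (tc 1) (tb 1).neg).add
      (OrderDiag.midLin (tb 0).neg (ta 0)))).add ((qq 0 1).add (qq 1 0)))).add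
    (A.tame_c.ord_fst.mul ((two.mul (OrderDiag.midLin (tb 1).neg (ta 1))).add (qq 1 1))))).add
    ((((ta 0).add (tb 1)).ord_fst.mul ((two.mul l0).add q0)).add
      (((tb 0).add (tc 1)).ord_fst.mul ((two.mul l1).add q1)))
  refine H.congr fun x y => ?_
  rw [op_rho]
  linear_combination 4 * A.det_eq_one (mid x y)

/-- Exchanging the two points changes `L ρ` only at third order; the first-order terms cancel, again
because `det A` is constant. -/
lemma ord_op_rho_swap : OrderDiag 3 fun x y => A.op (A.rho y) x - A.op (A.rho x) y := by
  have l0 := A.ord_lin₀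
  have l1 := A.ord_lin₁
  have q0 := A.ord_remQuad 0
  have q1 := A.ord_remQuad 1
  have qq := A.ord_remQuad₂
  have two := OrderDiag.const 2
  have ta (i) := A.tame_a.partialDeriv i
  have tb (i) := A.tame_b.partialDeriv i
  have tc (i) := A.tame_c.partialDeriv i
  have ma := A.tame_a.ord_mid
  have mb := A.tame_b.ord_mid
  have mc := A.tame_c.ord_mid
  have hα := (ta 0).add (tb 1)
  have hβ := (tb 0).add (tc 1)
  have H := (((((two.mul (A.tame_a.ord_three.mul mc)).add
      ((OrderDiag.const (-4)).mul (A.tame_b.ord_three.mul mb))).add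
      (two.mul (A.tame_c.ord_three.mul ma))).add
    ((A.tame_a.ord_fst_sub_snd.mul (qq 0 0)).add
      ((A.tame_b.ord_fst_sub_snd.mul ((qq 0 1).add (qq 1 0))).add
      (A.tame_c.ord_fst_sub_snd.mul (qq 1 1))))).add
    (two.mul ((A.tame_a.ord_two.mul (OrderDiag.midLin (tc 0) (tb 0).neg)).add
      ((A.tame_b.ord_two.mul ((OrderDiag.midLin (tc 1) (tb 1).neg).add
        (OrderDiag.midLin (tb 0).neg (ta 0)))).add
      (A.tame_c.ord_two.mul (OrderDiag.midLin (tb 1).neg (ta 1))))))).add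
    (((two.mul (hα.ord_two.mul l0)).add (hα.ord_fst_sub_snd.mul q0)).add
      ((two.mul (hβ.ord_two.mul l1)).add (hβ.ord_fst_sub_snd.mul q1)))
  refine H.congr fun x y => ?_
  rw [op_rho, op_rho]
  simp only [midLin_swap _ _ x y, A.remQuad_swap _ x y, A.remQuad₂_swap _ _ x y, mid_comm y x]
  have h0 := A.partialDeriv_det 0 (mid x y)
  have h1 := A.partialDeriv_det 1 (mid x y)
  simp only [midLin]
  linear_combination 6 * (x 0 - y 0) * h0 + 6 * (x 1 - y 1) * h1

end Coeff

end VortexSystem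

namespace VortexSystem

/-! ### Radial profiles -/

/-- A smooth bump on the line supported in `[1/2, 1]`. -/
def baseBump : ContDiffBump (3 / 4 : ℝ) := ⟨1 / 8, 1 / 4, by norm_num, by norm_num⟩

/-- A smooth bump supported in `[1/2, 1]`, such that `z ↦ eta (|z|²)` has integral one over the
plane. -/
def eta (s : ℝ) : ℝ := (∫ z : Plane, baseBump (‖z‖ ^ 2))⁻¹ * baseBump s

lemma baseBump_eq_zero {s : ℝ} (h : s ≤ 1 / 2 ∨ 1 ≤ s) : baseBump s = 0 := by
  apply baseBump.zero_of_le_dist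
  rw [Real.dist_eq]
  change 1 / 4 ≤ |s - 3 / 4|
  rcases h with h | h
  · rw [abs_of_nonpos (by linarith)]; linarith
  · rw [abs_of_nonneg (by linarith)]; linarith

lemma continuous_baseBump_norm : Continuous fun z : Plane => baseBump (‖z‖ ^ 2) :=
  baseBump.continuous.comp (by fun_prop)

lemma hasCompactSupport_baseBump_norm :
    HasCompactSupport fun z : Plane => baseBump (‖z‖ ^ 2) := by
  refine HasCompactSupport.intro (isCompact_closedBall (0 : Plane) 1) fun z hz => ?_
  rw [mem_closedBall_zero_iff, not_le] at hz
  exact baseBump_eq_zero (Or.inr (by nlinarith))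

lemma integral_baseBump_pos : 0 < ∫ z : Plane, baseBump (‖z‖ ^ 2) := by
  refine continuous_baseBump_norm.integral_pos_of_hasCompactSupport_nonneg_nonzero
    hasCompactSupport_baseBump_norm (fun z => baseBump.nonneg)
    (x := EuclideanSpace.single 0 (Real.sqrt (3 / 4))) ?_
  have : ‖(EuclideanSpace.single 0 (Real.sqrt (3 / 4)) : Plane)‖ ^ 2 = 3 / 4 := by
    rw [PiLp.norm_single, Real.norm_eq_abs, sq_abs, Real.sq_sqrt (by norm_num)]
  rw [this]
  have := baseBump.one_of_mem_closedBall (x := 3 / 4) (by simp [baseBump.rIn_pos.le])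
  rw [this]; norm_num

lemma contDiff_eta : ContDiff ℝ ∞ eta := contDiff_const.mul baseBump.contDiff

lemma eta_nonneg (s : ℝ) : 0 ≤ eta s :=
  mul_nonneg (inv_nonneg.2 integral_baseBump_pos.le) baseBump.nonneg

lemma eta_eq_zero {s : ℝ} (h : s ≤ 1 / 2 ∨ 1 ≤ s) : eta s = 0 := by
  rw [eta, baseBump_eq_zero h, mul_zero]

lemma integral_eta_norm : ∫ z : Plane, eta (‖z‖ ^ 2) = 1 := by
  simp only [eta]
  rw [integral_const_mul, inv_mul_cancel₀ integral_baseBump_pos.ne']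

lemma hasCompactSupport_eta : HasCompactSupport eta := by
  refine HasCompactSupport.intro (isCompact_Icc (a := (0 : ℝ)) (b := 1)) fun s hs => ?_
  rw [mem_Icc, not_and_or, not_le, not_le] at hs
  exact eta_eq_zero (hs.imp (fun h => by linarith) fun h => h.le)

lemma contDiff_deriv_eta : ContDiff ℝ ∞ (deriv eta) := (contDiff_infty_iff_deriv.1 contDiff_eta).2

lemma exists_eta_bound : ∃ C : ℝ, 0 ≤ C ∧ ∀ s, eta s ≤ C ∧ |deriv eta s| ≤ C ∧
    |deriv (deriv eta) s| ≤ C := by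
  obtain ⟨C0, h0⟩ := hasCompactSupport_eta.exists_bound_of_continuous contDiff_eta.continuous
  obtain ⟨C1, h1⟩ := hasCompactSupport_eta.deriv.exists_bound_of_continuous
    contDiff_deriv_eta.continuous
  obtain ⟨C2, h2⟩ := hasCompactSupport_eta.deriv.deriv.exists_bound_of_continuous
    (contDiff_infty_iff_deriv.1 contDiff_deriv_eta).2.continuous
  refine ⟨|C0| + |C1| + |C2|, by positivity, fun s => ?_⟩
  have e0 := (le_abs_self (eta s)).trans ((h0 s).trans (le_abs_self C0))
  have e1 : |deriv eta s| ≤ _ := (h1 s).trans (le_abs_self C1)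
  have e2 : |deriv (deriv eta) s| ≤ _ := (h2 s).trans (le_abs_self C2)
  have := abs_nonneg C0
  have := abs_nonneg C1
  have := abs_nonneg C2
  refine ⟨?_, ?_, ?_⟩ <;> linarith

/-- The primitive of `eta` vanishing at the origin. -/
def etaInt (s : ℝ) : ℝ := ∫ t in (0 : ℝ)..s, eta t

lemma hasDerivAt_etaInt (s : ℝ) : HasDerivAt etaInt (eta s) s :=
  intervalIntegral.integral_hasDerivAt_right (contDiff_eta.continuous.intervalIntegrable _ _)
    (contDiff_eta.continuous.stronglyMeasurableAtFilter _ _) contDiff_eta.continuous.continuousAt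

lemma contDiff_etaInt : ContDiff ℝ ∞ etaInt := by
  rw [contDiff_infty_iff_deriv]
  refine ⟨fun s => (hasDerivAt_etaInt s).differentiableAt, ?_⟩
  rw [show deriv etaInt = eta from funext fun s => (hasDerivAt_etaInt s).deriv]
  exact contDiff_eta

lemma monotone_etaInt : Monotone etaInt :=
  monotone_of_hasDerivAt_nonneg hasDerivAt_etaInt eta_nonneg

lemma etaInt_eq_zero {s : ℝ} (h : s ≤ 1 / 2) : etaInt s = 0 := by
  rw [etaInt, intervalIntegral.integral_congr (g := fun _ => (0 : ℝ))]
  · simp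
  · intro t ht
    rw [mem_uIcc] at ht
    exact eta_eq_zero (Or.inl (by rcases ht with ht | ht <;> linarith [ht.1, ht.2]))

lemma etaInt_eq_one {s : ℝ} (h : 1 ≤ s) : etaInt s = etaInt 1 := by
  have h1 : IntervalIntegrable eta volume 0 1 := contDiff_eta.continuous.intervalIntegrable _ _
  have h2 : IntervalIntegrable eta volume 1 s := contDiff_eta.continuous.intervalIntegrable _ _
  rw [etaInt, etaInt, ← intervalIntegral.integral_add_adjacent_intervals h1 h2]
  rw [intervalIntegral.integral_congr (g := fun _ => (0 : ℝ)) (a := 1)]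
  · simp
  · intro t ht
    rw [uIcc_of_le h] at ht
    exact eta_eq_zero (Or.inr ht.1)

lemma etaInt_nonneg (s : ℝ) : 0 ≤ etaInt s := by
  rcases le_total s (1 / 2) with h | h
  · rw [etaInt_eq_zero h]
  · rw [← etaInt_eq_zero le_rfl]; exact monotone_etaInt h

lemma etaInt_le (s : ℝ) : etaInt s ≤ etaInt 1 := by
  rcases le_total s 1 with h | h
  · exact monotone_etaInt h
  · rw [etaInt_eq_one h]

lemma etaInt_one_pos : 0 < etaInt 1 := by
  refine intervalIntegral.integral_pos zero_lt_one contDiff_eta.continuous.continuousOn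
    (fun t _ => eta_nonneg t) ⟨3 / 4, by norm_num, ?_⟩
  refine mul_pos (inv_pos.2 integral_baseBump_pos) ?_
  rw [baseBump.one_of_mem_closedBall (x := 3 / 4) (by simp [baseBump.rIn_pos.le])]
  exact one_pos

/-- The density of the truncated logarithm `logProfile`: a multiple of `1 / t`, cut off to
`ε² ≲ t ≲ R²`. -/
def logDensity (ε R t : ℝ) : ℝ := (etaInt (t / ε ^ 2) - etaInt (t / R ^ 2)) / t

/-- A truncated logarithm: up to the factor `etaInt 1`, it is `log (R² / s)` for
`ε² ≤ s ≤ R² / 2`, and it is constant for `s ≤ ε² / 2` and zero for `s ≥ R²`. -/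
def logProfile (ε R s : ℝ) : ℝ := ∫ t in s..R ^ 2, logDensity ε R t

section Profile

variable {ε R : ℝ}

lemma logDensity_eq_zero_of_le (hε : 0 < ε) (hR : ε ≤ R) {t : ℝ} (ht : t ≤ ε ^ 2 / 2) :
    logDensity ε R t = 0 := by
  have hε2 : 0 < ε ^ 2 := by positivity
  have hR2 : 0 < R ^ 2 := by have := hε.trans_le hR; positivity
  have h1 : ε ^ 2 ≤ R ^ 2 := by gcongr
  rw [logDensity, etaInt_eq_zero, etaInt_eq_zero, sub_zero, zero_div]
  · rw [div_le_iff₀ hR2]; linarith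
  · rw [div_le_iff₀ hε2]; linarith

lemma logDensity_eq_zero_of_ge (hε : 0 < ε) (hR : ε ≤ R) {t : ℝ} (ht : R ^ 2 ≤ t) :
    logDensity ε R t = 0 := by
  have hε2 : 0 < ε ^ 2 := by positivity
  have hR2 : 0 < R ^ 2 := by have := hε.trans_le hR; positivity
  have h1 : ε ^ 2 ≤ R ^ 2 := by gcongr
  rw [logDensity, etaInt_eq_one, etaInt_eq_one (s := t / R ^ 2), sub_self, zero_div]
  · rw [le_div_iff₀ hR2]; linarith
  · rw [le_div_iff₀ hε2]; linarith

lemma logDensity_nonneg (hε : 0 < ε) (hR : ε ≤ R) (t : ℝ) : 0 ≤ logDensity ε R t := by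
  rcases le_total t (ε ^ 2 / 2) with ht | ht
  · rw [logDensity_eq_zero_of_le hε hR ht]
  · have : 0 < ε ^ 2 := by positivity
    have ht : 0 < t := by linarith
    refine div_nonneg (sub_nonneg.2 (monotone_etaInt ?_)) ht.le
    gcongr

lemma logDensity_le {t : ℝ} (ht : 0 ≤ t) : logDensity ε R t ≤ etaInt 1 / t := by
  unfold logDensity
  gcongr
  linarith [etaInt_le (t / ε ^ 2), etaInt_nonneg (t / R ^ 2)]

lemma contDiff_logDensity (hε : 0 < ε) (hR : ε ≤ R) : ContDiff ℝ ∞ (logDensity ε R) := by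
  rw [contDiff_iff_contDiffAt]
  intro t
  have : 0 < ε ^ 2 := by positivity
  rcases lt_or_ge t (ε ^ 2 / 2) with ht | ht
  · refine (contDiffAt_const (c := (0 : ℝ))).congr_of_eventuallyEq ?_
    filter_upwards [Iio_mem_nhds ht] with t' ht'
    exact logDensity_eq_zero_of_le hε hR (le_of_lt ht')
  · have ht0 : t ≠ 0 := by linarith
    exact ((contDiff_etaInt.comp (contDiff_id.div_const _)).contDiffAt.sub
      (contDiff_etaInt.comp (contDiff_id.div_const _)).contDiffAt).div contDiffAt_id ht0

lemma hasDerivAt_logProfile (hε : 0 < ε) (hR : ε ≤ R) (s : ℝ) :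
    HasDerivAt (logProfile ε R) (-logDensity ε R s) s := by
  have hc := (contDiff_logDensity hε hR).continuous
  exact intervalIntegral.integral_hasDerivAt_left (hc.intervalIntegrable _ _)
    (hc.stronglyMeasurableAtFilter _ _) hc.continuousAt

lemma deriv_logProfile (hε : 0 < ε) (hR : ε ≤ R) :
    deriv (logProfile ε R) = fun s => -logDensity ε R s :=
  funext fun s => (hasDerivAt_logProfile hε hR s).deriv

lemma contDiff_logProfile (hε : 0 < ε) (hR : ε ≤ R) : ContDiff ℝ ∞ (logProfile ε R) := by
  rw [contDiff_infty_iff_deriv]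
  refine ⟨fun s => (hasDerivAt_logProfile hε hR s).differentiableAt, ?_⟩
  rw [deriv_logProfile hε hR]
  exact (contDiff_logDensity hε hR).neg

lemma logProfile_eq_zero (hε : 0 < ε) (hR : ε ≤ R) {s : ℝ} (hs : R ^ 2 ≤ s) :
    logProfile ε R s = 0 := by
  rw [logProfile, intervalIntegral.integral_congr (g := fun _ => (0 : ℝ))]
  · simp
  · intro t ht
    rw [uIcc_of_ge hs] at ht
    exact logDensity_eq_zero_of_ge hε hR ht.1

lemma logProfile_nonneg (hε : 0 < ε) (hR : ε ≤ R) (s : ℝ) : 0 ≤ logProfile ε R s := by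
  rcases le_total s (R ^ 2) with hs | hs
  · exact intervalIntegral.integral_nonneg hs fun t _ => logDensity_nonneg hε hR t
  · rw [logProfile_eq_zero hε hR hs]

lemma logProfile_le (hε : 0 < ε) (hR : ε ≤ R) {s : ℝ} (hs : 0 < s) (hs' : s ≤ R ^ 2) :
    logProfile ε R s ≤ etaInt 1 * Real.log (R ^ 2 / s) := by
  have hR2 : 0 < R ^ 2 := hs.trans_le hs'
  have h0 : (0 : ℝ) ∉ uIcc s (R ^ 2) := by
    rw [uIcc_of_le hs', mem_Icc]; intro h; linarith [h.1]
  rw [← integral_one_div h0, ← intervalIntegral.integral_const_mul]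
  refine intervalIntegral.integral_mono_on hs'
    ((contDiff_logDensity hε hR).continuous.intervalIntegrable _ _)
    ((intervalIntegral.intervalIntegrable_one_div (fun t ht h => h0 (h ▸ ht))
      continuousOn_id).const_mul _) fun t ht => ?_
  have := logDensity_le (ε := ε) (R := R) (hs.le.trans ht.1)
  rwa [mul_one_div]

lemma le_logProfile (hε : 0 < ε) (hR : ε ≤ R) {s : ℝ} (hs : ε ^ 2 ≤ s) (hs' : s ≤ R ^ 2 / 2) :
    etaInt 1 * Real.log (R ^ 2 / 2 / s) ≤ logProfile ε R s := by
  have hε2 : 0 < ε ^ 2 := by positivity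
  have hs0 : 0 < s := by linarith
  have hR2 : 0 < R ^ 2 := by linarith
  have h0 : (0 : ℝ) ∉ uIcc s (R ^ 2 / 2) := by
    rw [uIcc_of_le hs', mem_Icc]; intro h; linarith [h.1]
  have hc := (contDiff_logDensity hε hR).continuous
  have h1 : logProfile ε R s = (∫ t in s..R ^ 2 / 2, logDensity ε R t)
      + ∫ t in R ^ 2 / 2..R ^ 2, logDensity ε R t :=
    (intervalIntegral.integral_add_adjacent_intervals (hc.intervalIntegrable _ _)
      (hc.intervalIntegrable _ _)).symm
  have h2 : 0 ≤ ∫ t in R ^ 2 / 2..R ^ 2, logDensity ε R t :=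
    intervalIntegral.integral_nonneg (by linarith) fun t _ => logDensity_nonneg hε hR t
  rw [h1, ← integral_one_div h0, ← intervalIntegral.integral_const_mul]
  refine le_add_of_le_of_nonneg (intervalIntegral.integral_mono_on hs'
    ((intervalIntegral.intervalIntegrable_one_div (fun t ht h => h0 (h ▸ ht))
      continuousOn_id).const_mul _) (hc.intervalIntegrable _ _) fun t ht => ?_) h2
  have e1 : etaInt (t / ε ^ 2) = etaInt 1 :=
    etaInt_eq_one (by rw [le_div_iff₀ hε2]; linarith [ht.1])
  have e2 : etaInt (t / R ^ 2) = 0 :=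
    etaInt_eq_zero (by rw [div_le_iff₀ hR2]; linarith [ht.2])
  rw [logDensity, e1, e2, sub_zero, mul_one_div]

/-- Differentiating `t * logDensity ε R t`. -/
lemma logDensity_add_mul_deriv (hε : 0 < ε) (hR : ε ≤ R) (t : ℝ) :
    logDensity ε R t + t * deriv (logDensity ε R) t
      = eta (t / ε ^ 2) / ε ^ 2 - eta (t / R ^ 2) / R ^ 2 := by
  have h1 : HasDerivAt (fun t => t * logDensity ε R t)
      (1 * logDensity ε R t + t * deriv (logDensity ε R) t) t :=
    (hasDerivAt_id t).mul ((contDiff_logDensity hε hR).differentiable (by simp) t).hasDerivAt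
  have h2 : HasDerivAt (fun t => etaInt (t / ε ^ 2) - etaInt (t / R ^ 2))
      (eta (t / ε ^ 2) * (1 / ε ^ 2) - eta (t / R ^ 2) * (1 / R ^ 2)) t :=
    ((hasDerivAt_etaInt _).comp t ((hasDerivAt_id t).div_const _)).sub
      ((hasDerivAt_etaInt _).comp t ((hasDerivAt_id t).div_const _))
  have h3 : (fun t => t * logDensity ε R t) = fun t => etaInt (t / ε ^ 2) - etaInt (t / R ^ 2) := by
    funext t
    rcases eq_or_ne t 0 with rfl | ht
    · simp
    · rw [logDensity, mul_div_cancel₀ _ ht]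
  rw [h3] at h1
  have := h1.unique h2
  rw [one_mul] at this
  rw [this]
  ring

end Profile

end VortexSystem

namespace VortexSystem

/-! ### Mollification adapted to the operator -/

namespace Coeff

variable (A : Coeff)

/-- An ellipticity constant: both `|x - y|² ≤ ell * ρ` and `ρ ≤ ell * |x - y|²`. -/
def ell : ℝ := A.exists_rho_bounds.choose

lemma one_le_ell : 1 ≤ A.ell := A.exists_rho_bounds.choose_spec.1

lemma ell_pos : 0 < A.ell := zero_lt_one.trans_le A.one_le_ell

lemma norm_sq_le (x y : Plane) : ‖x - y‖ ^ 2 ≤ A.ell * A.rho y x :=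
  (A.exists_rho_bounds.choose_spec.2 x y).1

lemma rho_le (x y : Plane) : A.rho y x ≤ A.ell * ‖x - y‖ ^ 2 :=
  (A.exists_rho_bounds.choose_spec.2 x y).2

lemma rho_nonneg (x y : Plane) : 0 ≤ A.rho y x := by
  have := (sq_nonneg _).trans (A.norm_sq_le x y)
  exact nonneg_of_mul_nonneg_right this A.ell_pos

lemma rho_pos {x y : Plane} (h : x ≠ y) : 0 < A.rho y x := by
  have h1 : 0 < ‖x - y‖ := norm_pos_iff.2 (sub_ne_zero.2 h)
  have := (pow_pos h1 2).trans_le (A.norm_sq_le x y)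
  exact pos_of_mul_pos_right this A.ell_pos.le

lemma lt_rho_of_lt {ε : ℝ} (hε : 0 < ε) {x y : Plane} (h : A.ell * ε < ‖x - y‖) :
    ε ^ 2 < A.rho y x := by
  have h1 := A.norm_sq_le x y
  have h2 := A.one_le_ell
  have h3 : (A.ell * ε) ^ 2 < ‖x - y‖ ^ 2 := by
    have := A.ell_pos
    gcongr
  have h4 : A.ell * (A.ell * ε ^ 2) < A.ell * A.rho y x := by nlinarith
  have h5 := lt_of_mul_lt_mul_left h4 A.ell_pos.le
  nlinarith [sq_nonneg ε]

/-- The mollifying kernel at scale `ε`. Its integral tends to one as `ε` tends to zero, because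
`det A⁻¹ = 1`. -/
def kernel (ε : ℝ) (y x : Plane) : ℝ := eta (A.rho y x / ε ^ 2) / ε ^ 2

variable {A} {ε : ℝ}

lemma kernel_comm (x y : Plane) : A.kernel ε y x = A.kernel ε x y := by
  rw [kernel, rho_comm]; rfl

lemma kernel_nonneg (x y : Plane) : 0 ≤ A.kernel ε y x :=
  div_nonneg (eta_nonneg _) (sq_nonneg ε)

lemma contDiff_kernel : ContDiff ℝ ∞ fun p : Plane × Plane => A.kernel ε p.1 p.2 :=
  (contDiff_eta.comp (A.contDiff_rho.div_const _)).div_const _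

lemma contDiff_kernel_right (y : Plane) : ContDiff ℝ ∞ (A.kernel ε y) :=
  (contDiff_eta.comp ((A.contDiff_rho_right y).div_const _)).div_const _

lemma kernel_eq_zero (hε : 0 < ε) {x y : Plane} (h : A.ell * ε < ‖x - y‖) :
    A.kernel ε y x = 0 := by
  have h1 := A.lt_rho_of_lt hε h
  rw [kernel, eta_eq_zero (Or.inr ?_), zero_div]
  rw [le_div_iff₀ (by positivity)]
  linarith

lemma tsupport_kernel (hε : 0 < ε) (y : Plane) :
    tsupport (A.kernel ε y) ⊆ Metric.closedBall y (A.ell * ε) := by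
  refine closure_minimal (fun x hx => ?_) Metric.isClosed_closedBall
  by_contra h
  rw [Metric.mem_closedBall, not_le, dist_eq_norm] at h
  exact hx (kernel_eq_zero hε h)

lemma hasCompactSupport_kernel (hε : 0 < ε) (y : Plane) : HasCompactSupport (A.kernel ε y) :=
  (isCompact_closedBall y (A.ell * ε)).of_isClosed_subset (isClosed_tsupport _)
    (tsupport_kernel hε y)

lemma op_kernel_eq_zero (hε : 0 < ε) {x y : Plane} (h : A.ell * ε < ‖x - y‖) :
    A.op (A.kernel ε y) x = 0 := by
  refine op_eq_zero_of_notMem fun h' => ?_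
  have := tsupport_kernel hε y h'
  rw [Metric.mem_closedBall, dist_eq_norm] at this
  linarith

lemma op_kernel (x y : Plane) : A.op (A.kernel ε y) x
    = deriv (deriv eta) (A.rho y x / ε ^ 2) / ε ^ 6 * A.energy (A.rho y) x
      + deriv eta (A.rho y x / ε ^ 2) / ε ^ 4 * A.op (A.rho y) x := by
  have hF : ContDiff ℝ ∞ fun s => eta (s / ε ^ 2) / ε ^ 2 :=
    (contDiff_eta.comp (contDiff_id.div_const _)).div_const _
  have d1 : deriv (fun s => eta (s / ε ^ 2) / ε ^ 2) = fun s => deriv eta (s / ε ^ 2) / ε ^ 4 := by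
    funext s
    have := (((contDiff_eta.differentiable (by simp) _).hasDerivAt).comp s
      ((hasDerivAt_id s).div_const (ε ^ 2))).div_const (ε ^ 2)
    refine Eq.trans this.deriv ?_
    simp only [id]
    ring
  have d2 : deriv (fun s => deriv eta (s / ε ^ 2) / ε ^ 4)
      = fun s => deriv (deriv eta) (s / ε ^ 2) / ε ^ 6 := by
    funext s
    have := (((contDiff_deriv_eta.differentiable (by simp) _).hasDerivAt).comp s
      ((hasDerivAt_id s).div_const (ε ^ 2))).div_const (ε ^ 4)
    refine Eq.trans this.deriv ?_
    simp only [id]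
    ring
  have := op_comp (A := A) (y := x) hF (A.contDiff_rho_right y)
  rw [d1, d2] at this
  exact this

/-- The commutator of `L` with the mollification is of order `ε`: its kernel is of size `1 / ε`
on a disc of area of order `ε ^ 2`. -/
lemma exists_op_kernel_swap_le (A : Coeff) : ∃ C : ℝ, 0 ≤ C ∧ ∀ ε : ℝ, 0 < ε → A.ell * ε ≤ 1 →
    ∀ x y, |A.op (A.kernel ε y) x - A.op (A.kernel ε x) y| ≤ C / ε := by
  obtain ⟨C, hC, hη⟩ := exists_eta_bound
  obtain ⟨C₁, hC₁, h₁⟩ := A.ord_energy_rho_swap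
  obtain ⟨C₂, hC₂, h₂⟩ := A.ord_op_rho_swap
  have hT := A.ell_pos
  refine ⟨C * C₁ * A.ell ^ 5 + C * C₂ * A.ell ^ 3, by positivity, fun ε hε hε1 x y => ?_⟩
  rcases lt_or_ge (A.ell * ε) ‖x - y‖ with h | h
  · rw [op_kernel_eq_zero hε h, op_kernel_eq_zero hε (by rwa [norm_sub_rev]), sub_zero, abs_zero]
    positivity
  · have e1 := h₁ x y (h.trans hε1)
    have e2 := h₂ x y (h.trans hε1)
    have b1 : ‖x - y‖ ^ 5 ≤ (A.ell * ε) ^ 5 := by gcongr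
    have b2 : ‖x - y‖ ^ 3 ≤ (A.ell * ε) ^ 3 := by gcongr
    rw [op_kernel, op_kernel, A.rho_comm y x]
    have e : deriv (deriv eta) (A.rho y x / ε ^ 2) / ε ^ 6 * A.energy (A.rho y) x
        + deriv eta (A.rho y x / ε ^ 2) / ε ^ 4 * A.op (A.rho y) x
        - (deriv (deriv eta) (A.rho y x / ε ^ 2) / ε ^ 6 * A.energy (A.rho x) y
        + deriv eta (A.rho y x / ε ^ 2) / ε ^ 4 * A.op (A.rho x) y)
        = deriv (deriv eta) (A.rho y x / ε ^ 2) / ε ^ 6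
            * (A.energy (A.rho y) x - A.energy (A.rho x) y)
          + deriv eta (A.rho y x / ε ^ 2) / ε ^ 4
            * (A.op (A.rho y) x - A.op (A.rho x) y) := by ring
    rw [e]
    refine (abs_add_le _ _).trans ?_
    rw [abs_mul, abs_mul, abs_div, abs_div, abs_of_pos (show 0 < ε ^ 6 by positivity),
      abs_of_pos (show 0 < ε ^ 4 by positivity)]
    calc _ ≤ C / ε ^ 6 * (C₁ * (A.ell * ε) ^ 5) + C / ε ^ 4 * (C₂ * (A.ell * ε) ^ 3) := by
          gcongr
          · exact (hη _).2.2
          · exact e1.trans (by gcongr)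
          · exact (hη _).2.1
          · exact e2.trans (by gcongr)
      _ = _ := by field_simp

lemma exists_kernel_le (A : Coeff) : ∃ C : ℝ, 0 ≤ C ∧ ∀ ε : ℝ, ∀ x y, A.kernel ε y x ≤ C / ε ^ 2 := by
  obtain ⟨C, hC, hη⟩ := exists_eta_bound
  exact ⟨C, hC, fun ε x y => div_le_div_of_nonneg_right (hη _).1 (sq_nonneg ε)⟩

lemma kernel_def (x y : Plane) : A.kernel ε y x = eta (A.rho y x / ε ^ 2) / ε ^ 2 := rfl

attribute [irreducible] kernel

lemma volume_closedBall_eq (y : Plane) {r : ℝ} (hr : 0 ≤ r) :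
    volume (Metric.closedBall y r)
      = ENNReal.ofReal (r ^ 2) * volume (Metric.ball (0 : Plane) 1) := by
  rw [Measure.addHaar_closedBall _ _ hr]
  simp

/-- A kernel that is bounded by `B` and supported within distance `r` of the diagonal acts on
integrable functions with norm at most `B` times the area of a disc of radius `r`. -/
lemma lintegral_lintegral_kernel_le {w : Plane → ℝ} (hw : Integrable w)
    {k : Plane → Plane → ℝ} (hk : Measurable fun p : Plane × Plane => k p.1 p.2) {B r : ℝ}
    (hr : 0 ≤ r) (hB : ∀ x y, |k x y| ≤ B) (h0 : ∀ x y, r < ‖x - y‖ → k x y = 0) :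
    ∫⁻ y, ∫⁻ x, ‖w x‖ₑ * ‖k x y‖ₑ
      ≤ ENNReal.ofReal B * (ENNReal.ofReal (r ^ 2) * volume (Metric.ball (0 : Plane) 1))
        * ∫⁻ x, ‖w x‖ₑ := by
  rw [lintegral_lintegral_swap]
  · have key (x : Plane) : ∫⁻ y, ‖w x‖ₑ * ‖k x y‖ₑ ≤ ‖w x‖ₑ * (ENNReal.ofReal B
        * (ENNReal.ofReal (r ^ 2) * volume (Metric.ball (0 : Plane) 1))) := by
      rw [lintegral_const_mul _ (by fun_prop)]
      gcongr
      calc ∫⁻ y, ‖k x y‖ₑ ≤ ∫⁻ y, (Metric.closedBall x r).indicator (fun _ => ENNReal.ofReal B) y := by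
            refine lintegral_mono fun y => ?_
            by_cases hy : y ∈ Metric.closedBall x r
            · rw [indicator_of_mem hy, ← ofReal_norm]
              exact ENNReal.ofReal_le_ofReal (hB x y)
            · rw [Metric.mem_closedBall, not_le, dist_comm, dist_eq_norm] at hy
              rw [h0 x y hy]; simp
        _ = _ := by
            rw [lintegral_indicator Metric.isClosed_closedBall.measurableSet, lintegral_const,
              Measure.restrict_apply_univ, volume_closedBall_eq x hr]
    refine (lintegral_mono key).trans (le_of_eq ?_)
    rw [lintegral_mul_const'' _ hw.1.enorm, mul_comm]
  · have h1 : AEMeasurable (fun p : Plane × Plane => ‖w p.2‖ₑ) (volume.prod volume) :=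
      hw.1.enorm.comp_snd
    exact h1.mul (hk.comp measurable_swap).enorm.aemeasurable

variable (A) in
/-- The mollification of an integrable function at scale `ε`. -/
def mollify (ε : ℝ) (w : Plane → ℝ) (y : Plane) : ℝ := ∫ x, w x * A.kernel ε y x

lemma contDiff_mollify (hε : 0 < ε) {w : Plane → ℝ} (hw : Integrable w) :
    ContDiff ℝ ∞ (A.mollify ε w) := by
  have h := contDiffOn_convolution_right_with_param_comp (n := ⊤) (s := univ) (v := fun p : Plane => p)
    (f := w) (μ := volume) (k := Metric.closedBall 0 (A.ell * ε))
    (g := fun p z => A.kernel ε p (p - z)) (ContinuousLinearMap.mul ℝ ℝ) contDiff_id.contDiffOn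
    isOpen_univ (isCompact_closedBall _ _) (fun p z _ hz => ?_) hw.locallyIntegrable ?_
  · rw [contDiffOn_univ] at h
    convert h using 1
    funext y
    simp [mollify, convolution]
  · rw [mem_closedBall_zero_iff, not_le] at hz
    apply kernel_eq_zero hε
    simpa using hz
  · exact (contDiff_kernel.comp (contDiff_fst.prodMk (contDiff_fst.sub contDiff_snd))).contDiffOn

lemma integrable_mul_kernel {w : Plane → ℝ} (hw : Integrable w) (y : Plane) :
    Integrable fun x => w x * A.kernel ε y x := by
  obtain ⟨C, hC, h⟩ := exists_kernel_le A
  refine hw.mul_bdd (c := C / ε ^ 2) (contDiff_kernel_right y).continuous.aestronglyMeasurable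
    (Filter.Eventually.of_forall fun x => ?_)
  rw [Real.norm_eq_abs, abs_of_nonneg (kernel_nonneg _ _)]
  exact h ε x y

lemma mollify_sub {w w' : Plane → ℝ} (hw : Integrable w) (hw' : Integrable w') (y : Plane) :
    A.mollify ε (fun x => w x - w' x) y = A.mollify ε w y - A.mollify ε w' y := by
  simp only [mollify, sub_mul]
  exact integral_sub (integrable_mul_kernel hw y) (integrable_mul_kernel hw' y)

/-- Mollification is bounded on `L¹`, uniformly in the scale. -/
lemma exists_lintegral_mollify_le (A : Coeff) : ∃ M : ENNReal, M ≠ ⊤ ∧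
    ∀ ε : ℝ, 0 < ε → ∀ w : Plane → ℝ, Integrable w →
      ∫⁻ y, ‖A.mollify ε w y‖ₑ ≤ M * ∫⁻ x, ‖w x‖ₑ := by
  obtain ⟨C, hC, h⟩ := exists_kernel_le A
  refine ⟨ENNReal.ofReal (C * A.ell ^ 2) * volume (Metric.ball (0 : Plane) 1),
    ENNReal.mul_ne_top ENNReal.ofReal_ne_top measure_ball_lt_top.ne, fun ε hε w hw => ?_⟩
  have h1 : ∫⁻ y, ‖A.mollify ε w y‖ₑ ≤ ∫⁻ y, ∫⁻ x, ‖w x‖ₑ * ‖A.kernel ε y x‖ₑ := by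
    refine lintegral_mono fun y => (enorm_integral_le_lintegral_enorm _).trans (le_of_eq ?_)
    simp only [enorm_mul]
  have hm : Measurable fun p : Plane × Plane => A.kernel ε p.2 p.1 := by
    rw [show (fun p : Plane × Plane => A.kernel ε p.2 p.1) = fun p => A.kernel ε p.1 p.2 from
      funext fun p => kernel_comm _ _]
    exact contDiff_kernel.continuous.measurable
  refine h1.trans ((lintegral_lintegral_kernel_le hw (k := fun x y => A.kernel ε y x)
    hm (B := C / ε ^ 2) (r := A.ell * ε)
    (by have := A.ell_pos; positivity) (fun x y => ?_) fun x y hxy => kernel_eq_zero hε hxy).trans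
    (le_of_eq ?_))
  · rw [abs_of_nonneg (kernel_nonneg _ _)]; exact h ε x y
  · rw [← mul_assoc (ENNReal.ofReal _), ← ENNReal.ofReal_mul (by positivity)]
    have e : C / ε ^ 2 * (A.ell * ε) ^ 2 = C * A.ell ^ 2 := by field_simp
    rw [e]

end Coeff

end VortexSystem

namespace VortexSystem

/-! ### Convergence of the mollifications -/

namespace Coeff

variable {A : Coeff} {ε : ℝ}

/-- The quadratic form of `A⁻¹`. -/
def invForm (A : Coeff) (y z : Plane) : ℝ :=
  A.c y * (z 0 * z 0) - A.b y * (2 * (z 0 * z 1)) + A.a y * (z 1 * z 1)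

/-- The form `A⁻¹` is the pullback of the Euclidean square under a linear map of determinant one. -/
lemma integral_eta_invForm (y : Plane) : ∫ z, eta (A.invForm y z) = 1 := by
  have ha := A.pos_a y
  have hs : 0 < Real.sqrt (A.a y) := Real.sqrt_pos.2 ha
  have hss : Real.sqrt (A.a y) * Real.sqrt (A.a y) = A.a y := Real.mul_self_sqrt ha.le
  set r := Real.sqrt (A.a y) with hr
  let M : Matrix (Fin 2) (Fin 2) ℝ := !![r⁻¹, 0; -A.b y * r⁻¹, A.a y * r⁻¹]
  let T : Plane →ₗ[ℝ] Plane := Matrix.toEuclideanLin M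
  have hdet : LinearMap.det T = 1 := by
    have : LinearMap.det T = M.det := by
      simp only [T, Matrix.toLpLin_eq_toLin]
      exact LinearMap.det_toLin _ _
    rw [this, Matrix.det_fin_two_of, ← hss]
    field_simp
    simp
  have hT (z : Plane) : ‖T z‖ ^ 2 = A.invForm y z := by
    have h0 : (T z) 0 = r⁻¹ * z 0 := by
      simp [T, M, Matrix.toLpLin_apply, dotProduct, Fin.sum_univ_two]
    have h1 : (T z) 1 = -A.b y * r⁻¹ * z 0 + A.a y * r⁻¹ * z 1 := by
      simp [T, M, Matrix.toLpLin_apply, dotProduct, Fin.sum_univ_two]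
    rw [EuclideanSpace.norm_sq_eq, Fin.sum_univ_two, h0, h1, Real.norm_eq_abs, Real.norm_eq_abs,
      sq_abs, sq_abs, invForm]
    have hd := A.det_eq_one y
    rw [← hss] at hd ⊢
    field_simp
    linear_combination (-z 0 ^ 2) * hd
  have hmap := Measure.map_linearMap_addHaar_eq_smul_addHaar (volume : Measure Plane) (f := T)
    (by rw [hdet]; exact one_ne_zero)
  rw [hdet] at hmap
  simp only [inv_one, abs_one, ENNReal.ofReal_one, one_smul] at hmap
  have hc : Continuous T := T.continuous_of_finiteDimensional
  calc ∫ z, eta (A.invForm y z) = ∫ z, eta (‖T z‖ ^ 2) := by simp only [hT]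
    _ = ∫ z, eta (‖z‖ ^ 2) ∂(Measure.map T volume) := by
        rw [integral_map hc.measurable.aemeasurable]
        exact (contDiff_eta.continuous.comp (by fun_prop)).aestronglyMeasurable
    _ = 1 := by rw [hmap, integral_eta_norm]

lemma rho_add_smul (y z : Plane) :
    A.rho y (y + ε • z) = ε ^ 2 * A.invForm (y + (ε / 2) • z) z := by
  have : mid (y + ε • z) y = y + (ε / 2) • z := by
    rw [mid]; ext i; simp; ring
  simp only [rho, midQuad, invForm, this]
  simp
  ring

/-- The mollification after the substitution `x = y + ε z`. -/
lemma mollify_eq (hε : 0 < ε) (w : Plane → ℝ) (y : Plane) :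
    A.mollify ε w y = ∫ z, w (y + ε • z) * eta (A.invForm (y + (ε / 2) • z) z) := by
  have h1 := Measure.integral_comp_smul (volume : Measure Plane)
    (fun x => w (y + x) * A.kernel ε y (y + x)) ε
  have h2 : ∫ x, w (y + x) * A.kernel ε y (y + x) = A.mollify ε w y :=
    integral_add_left_eq_self (fun x => w x * A.kernel ε y x) y
  rw [h2] at h1
  have hε2 : 0 < ε ^ 2 := by positivity
  have h3 (z : Plane) : A.kernel ε y (y + ε • z)
      = (ε ^ 2)⁻¹ * eta (A.invForm (y + (ε / 2) • z) z) := by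
    rw [kernel_def, rho_add_smul, mul_div_cancel_left₀ _ hε2.ne', div_eq_inv_mul]
  simp only [h3, finrank_euclideanSpace, Fintype.card_fin, abs_of_pos (inv_pos.2 hε2),
    smul_eq_mul] at h1
  have h4 (z : Plane) : w (y + ε • z) * ((ε ^ 2)⁻¹ * eta (A.invForm (y + (ε / 2) • z) z))
      = (ε ^ 2)⁻¹ * (w (y + ε • z) * eta (A.invForm (y + (ε / 2) • z) z)) := by ring
  simp only [h4, integral_const_mul] at h1
  exact (mul_left_cancel₀ (inv_pos.2 hε2).ne' h1).symm

lemma continuous_invForm : Continuous fun p : Plane × Plane => A.invForm p.1 p.2 := by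
  have ha := A.smooth_a.continuous
  have hb := A.smooth_b.continuous
  have hc := A.smooth_c.continuous
  unfold invForm
  fun_prop

lemma eta_invForm_eq_zero (y : Plane) {z : Plane} (h : A.ell < ‖z‖) :
    eta (A.invForm y z) = 0 := by
  have h1 := A.lt_rho_of_lt one_pos (x := y + (1 / 2 : ℝ) • z) (y := y - (1 / 2 : ℝ) • z) (by
    rw [add_sub_sub_cancel, ← add_smul]; norm_num; exact h)
  have h2 : mid (y + (1 / 2 : ℝ) • z) (y - (1 / 2 : ℝ) • z) = y := by
    rw [mid]; ext i; simp; ring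
  have h3 : A.rho (y - (1 / 2 : ℝ) • z) (y + (1 / 2 : ℝ) • z) = A.invForm y z := by
    simp only [rho, midQuad, invForm, h2]
    simp
    ring
  rw [h3, one_pow] at h1
  exact eta_eq_zero (Or.inr h1.le)

/-- For continuous functions of compact support the mollifications converge in `L¹`. -/
lemma tendsto_mollify_of_continuous {g : Plane → ℝ} (hg : Continuous g) (hc : HasCompactSupport g) :
    Filter.Tendsto (fun ε => ∫⁻ y, ‖A.mollify ε g y - g y‖ₑ) (nhdsWithin 0 (Ioi 0)) (nhds 0) := by
  obtain ⟨G, hG⟩ := hc.exists_bound_of_continuous hg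
  obtain ⟨C, hC, hη⟩ := exists_eta_bound
  have hG0 : 0 ≤ G := (norm_nonneg _).trans (hG 0)
  set bd : Plane → ℝ := (Metric.closedBall 0 A.ell).indicator fun _ => G * C with hbd
  have hbdi : Integrable bd := by
    rw [hbd, integrable_indicator_iff Metric.isClosed_closedBall.measurableSet]
    exact integrableOn_const (measure_closedBall_lt_top).ne
  have hle (ε : ℝ) (y z : Plane) :
      ‖g (y + ε • z) * eta (A.invForm (y + (ε / 2) • z) z)‖ ≤ bd z := by
    by_cases hz : z ∈ Metric.closedBall 0 A.ell
    · rw [hbd, indicator_of_mem hz, norm_mul, Real.norm_eq_abs (eta _),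
        abs_of_nonneg (eta_nonneg _)]
      exact mul_le_mul (hG _) (hη _).1 (eta_nonneg _) hG0
    · rw [hbd, indicator_of_notMem hz]
      rw [mem_closedBall_zero_iff, not_le] at hz
      rw [eta_invForm_eq_zero _ hz]; simp
  have hI := A.continuous_invForm
  have hη0 := contDiff_eta.continuous
  have hpt (y : Plane) : Filter.Tendsto (fun ε => A.mollify ε g y) (nhdsWithin 0 (Ioi 0))
      (nhds (g y)) := by
    have h1 : Filter.Tendsto
        (fun ε : ℝ => ∫ z, g (y + ε • z) * eta (A.invForm (y + (ε / 2) • z) z))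
        (nhdsWithin 0 (Ioi 0)) (nhds (∫ z, g y * eta (A.invForm y z))) := by
      refine tendsto_integral_filter_of_dominated_convergence bd
        (Filter.Eventually.of_forall fun ε => ?_)
        (Filter.Eventually.of_forall fun ε => Filter.Eventually.of_forall (hle ε y)) hbdi
        (Filter.Eventually.of_forall fun z => ?_)
      · exact Continuous.aestronglyMeasurable
          ((hg.comp (by fun_prop)).mul (hη0.comp (hI.comp (f := fun z => (y + (ε / 2) • z, z))
            (by fun_prop))))
      · have : Continuous fun ε : ℝ => g (y + ε • z) * eta (A.invForm (y + (ε / 2) • z) z) :=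
          (hg.comp (by fun_prop)).mul (hη0.comp (hI.comp
            (f := fun ε : ℝ => (y + (ε / 2) • z, z)) (by fun_prop)))
        have := (this.tendsto 0).mono_left (nhdsWithin_le_nhds (s := Ioi 0))
        simpa using this
    rw [integral_const_mul, integral_eta_invForm, mul_one] at h1
    refine h1.congr' ?_
    filter_upwards [self_mem_nhdsWithin] with ε hε
    rw [mollify_eq hε]
  obtain ⟨r, hr⟩ := hc.isCompact.isBounded.subset_closedBall 0
  set bd2 : Plane → ENNReal := (Metric.closedBall 0 (r + A.ell)).indicator
    fun _ => ENNReal.ofReal (∫ z, bd z) + ENNReal.ofReal G with hbd2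
  have h0 (y : Plane) (hy : r + A.ell < ‖y‖) (z : Plane) (hz : ‖z‖ ≤ A.ell) : g (y + z) = 0 := by
    by_contra h
    have := hr (subset_closure (Function.mem_support.2 h))
    rw [mem_closedBall_zero_iff] at this
    have h' := norm_sub_norm_le y (-z)
    rw [sub_neg_eq_add, norm_neg] at h'
    linarith
  have key := tendsto_lintegral_filter_of_dominated_convergence (μ := (volume : Measure Plane))
    (F := fun ε y => ‖A.mollify ε g y - g y‖ₑ) (f := fun _ => 0) (l := nhdsWithin 0 (Ioi 0)) bd2 ?_ ?_
    ?_ ?_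
  · simpa using key
  · filter_upwards [self_mem_nhdsWithin] with ε hε
    exact ((contDiff_mollify hε (hg.integrable_of_hasCompactSupport hc)).continuous.sub
      hg).measurable.enorm
  · filter_upwards [self_mem_nhdsWithin, nhdsWithin_le_nhds (Iic_mem_nhds one_pos)] with ε hε hε1
    refine Filter.Eventually.of_forall fun y => ?_
    simp only [mem_Ioi, mem_Iic] at hε hε1
    by_cases hy : y ∈ Metric.closedBall 0 (r + A.ell)
    · rw [hbd2, indicator_of_mem hy]
      refine (enorm_sub_le).trans ?_
      gcongr
      · rw [mollify_eq hε, ← ofReal_norm]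
        exact ENNReal.ofReal_le_ofReal (norm_integral_le_of_norm_le hbdi
          (Filter.Eventually.of_forall (hle ε y)))
      · rw [← ofReal_norm]
        exact ENNReal.ofReal_le_ofReal (hG y)
    · rw [hbd2, indicator_of_notMem hy]
      rw [mem_closedBall_zero_iff, not_le] at hy
      have e1 : g y = 0 := by simpa using h0 y hy 0 (by simpa using A.ell_pos.le)
      have e2 : A.mollify ε g y = 0 := by
        rw [mollify_eq hε]
        refine integral_eq_zero_of_ae (Filter.Eventually.of_forall fun z => ?_)
        rcases lt_or_ge A.ell ‖z‖ with hz | hz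
        · simp [eta_invForm_eq_zero _ hz]
        · have : ‖ε • z‖ ≤ A.ell := by
            rw [norm_smul, Real.norm_eq_abs, abs_of_pos hε]
            nlinarith [norm_nonneg z]
          simp [h0 y hy _ this]
      rw [e1, e2]; simp
  · rw [hbd2, lintegral_indicator Metric.isClosed_closedBall.measurableSet, lintegral_const,
      Measure.restrict_apply_univ]
    exact ENNReal.mul_ne_top (by simp) measure_closedBall_lt_top.ne
  · refine Filter.Eventually.of_forall fun y => ?_
    have := ((hpt y).sub_const (g y)).enorm
    simpa using this

/-- The mollifications of an integrable function converge to it in `L¹`. -/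
lemma tendsto_mollify {w : Plane → ℝ} (hw : Integrable w) :
    Filter.Tendsto (fun ε => ∫⁻ y, ‖A.mollify ε w y - w y‖ₑ) (nhdsWithin 0 (Ioi 0)) (nhds 0) := by
  obtain ⟨M, hM, hMle⟩ := exists_lintegral_mollify_le A
  rw [ENNReal.tendsto_nhds_zero]
  intro δ hδ
  rcases eq_or_ne δ ⊤ with rfl | hδt
  · simp
  have hγ : δ / 2 / (M + 1) ≠ 0 :=
    (ENNReal.div_pos (ENNReal.half_pos hδ.ne').ne' (by simp [hM])).ne'
  obtain ⟨g, hgc, hgw, hgcont, hgi⟩ := hw.exists_hasCompactSupport_lintegral_sub_le hγ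
  have h2 := (ENNReal.tendsto_nhds_zero.1 (tendsto_mollify_of_continuous (A := A) hgcont hgc))
    (δ / 2) (ENNReal.half_pos hδ.ne')
  filter_upwards [h2, self_mem_nhdsWithin] with ε h2 hε
  have hε : 0 < ε := hε
  have hsub := (contDiff_mollify (A := A) hε (hw.sub hgi)).continuous.measurable
  have hwm := hw.1.aemeasurable
  have hgm := hgcont.measurable
  have e (y : Plane) : ‖A.mollify ε w y - w y‖ₑ
      ≤ ‖A.mollify ε (fun x => w x - g x) y‖ₑ + ‖A.mollify ε g y - g y‖ₑ + ‖w y - g y‖ₑ := by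
    have : A.mollify ε w y - w y
        = (A.mollify ε (fun x => w x - g x) y + (A.mollify ε g y - g y)) - (w y - g y) := by
      rw [mollify_sub hw hgi]; ring
    rw [this]
    exact enorm_sub_le.trans (by gcongr; exact enorm_add_le _ _)
  calc ∫⁻ y, ‖A.mollify ε w y - w y‖ₑ
      ≤ ∫⁻ y, (‖A.mollify ε (fun x => w x - g x) y‖ₑ + ‖A.mollify ε g y - g y‖ₑ + ‖w y - g y‖ₑ) :=
        lintegral_mono e
    _ = (∫⁻ y, ‖A.mollify ε (fun x => w x - g x) y‖ₑ) + (∫⁻ y, ‖A.mollify ε g y - g y‖ₑ)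
        + ∫⁻ y, ‖w y - g y‖ₑ := by
      rw [lintegral_add_right' _ (by fun_prop), lintegral_add_left]
      exact hsub.enorm
    _ ≤ M * (δ / 2 / (M + 1)) + δ / 2 + δ / 2 / (M + 1) := by
      gcongr
      exact (hMle ε hε _ (hw.sub hgi)).trans (by gcongr; exact hgw)
    _ = (M + 1) * (δ / 2 / (M + 1)) + δ / 2 := by ring
    _ = δ / 2 + δ / 2 := by
      rw [ENNReal.mul_div_cancel (by simp) (by simp [hM])]
    _ = δ := ENNReal.add_halves δ

/-- Along a sequence of scales the mollifications converge almost everywhere. -/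
lemma exists_seq_tendsto_mollify (A : Coeff) {w : Plane → ℝ} (hw : Integrable w) :
    ∃ e : ℕ → ℝ, (∀ n, 0 < e n) ∧ Filter.Tendsto e Filter.atTop (nhdsWithin 0 (Ioi 0)) ∧
      ∀ᵐ y, Filter.Tendsto (fun n => A.mollify (e n) w y) Filter.atTop (nhds (w y)) := by
  have h0 : Filter.Tendsto (fun n : ℕ => 1 / ((n : ℝ) + 1)) Filter.atTop (nhdsWithin 0 (Ioi 0)) :=
    tendsto_nhdsWithin_iff.2 ⟨tendsto_one_div_add_atTop_nhds_zero_nat,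
      Filter.Eventually.of_forall fun n => by simp only [mem_Ioi]; positivity⟩
  have h1 := (tendsto_mollify (A := A) hw).comp h0
  have h2 : Filter.Tendsto (fun n : ℕ => eLpNorm (A.mollify (1 / ((n : ℝ) + 1)) w - w) 1 volume)
      Filter.atTop (nhds 0) := by
    simp only [eLpNorm_one_eq_lintegral_enorm]
    exact h1
  have h3 := tendstoInMeasure_of_tendsto_eLpNorm one_ne_zero
    (fun n => (contDiff_mollify (by positivity) hw).continuous.aestronglyMeasurable) hw.1 h2
  obtain ⟨ns, hns, h4⟩ := h3.exists_seq_tendsto_ae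
  exact ⟨fun n => 1 / ((ns n : ℝ) + 1), fun n => by positivity, h0.comp hns.tendsto_atTop, h4⟩

end Coeff

end VortexSystem

namespace VortexSystem

/-! ### Distributional inequalities and Kato's inequality -/

namespace Coeff

variable {A : Coeff} {ε : ℝ}

/-- `L w ≥ h` on the open set `Ω` in the sense of distributions. -/
def WeakGE (A : Coeff) (Ω : Set Plane) (w h : Plane → ℝ) : Prop :=
  ∀ φ : Plane → ℝ, ContDiff ℝ ∞ φ → HasCompactSupport φ → tsupport φ ⊆ Ω → (∀ y, 0 ≤ φ y) →
    ∫ y, h y * φ y ≤ ∫ y, w y * A.op φ y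

lemma contDiff_partialDeriv_param {F : Plane → Plane → ℝ}
    (hF : ContDiff ℝ ∞ fun p : Plane × Plane => F p.1 p.2) (i : Fin 2) :
    ContDiff ℝ ∞ fun p : Plane × Plane => partialDeriv i (F p.1) p.2 := by
  unfold partialDeriv
  have h := ContDiff.fderiv (𝕜 := ℝ) (n := ∞) (m := ∞) (f := fun p : Plane × Plane => F p.1)
    (g := fun p : Plane × Plane => p.2)
    (hF.comp ((contDiff_fst.comp contDiff_fst).prodMk contDiff_snd)) contDiff_snd (by norm_cast)
  exact h.clm_apply contDiff_const

lemma contDiff_op_param {F : Plane → Plane → ℝ}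
    (hF : ContDiff ℝ ∞ fun p : Plane × Plane => F p.1 p.2) :
    ContDiff ℝ ∞ fun p : Plane × Plane => A.op (F p.1) p.2 := by
  have d0 := contDiff_partialDeriv_param hF 0
  have d1 := contDiff_partialDeriv_param hF 1
  have f0 : ContDiff ℝ ∞ fun p : Plane × Plane => A.flux₀ (F p.1) p.2 :=
    ((A.smooth_a.comp contDiff_snd).mul d0).add ((A.smooth_b.comp contDiff_snd).mul d1)
  have f1 : ContDiff ℝ ∞ fun p : Plane × Plane => A.flux₁ (F p.1) p.2 :=
    ((A.smooth_b.comp contDiff_snd).mul d0).add ((A.smooth_c.comp contDiff_snd).mul d1)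
  exact (contDiff_partialDeriv_param (F := fun q => A.flux₀ (F q)) f0 0).add
    (contDiff_partialDeriv_param (F := fun q => A.flux₁ (F q)) f1 1)

lemma integrable_prod_of_compact {w : Plane → ℝ} (hw : Integrable w) {k : Plane → Plane → ℝ}
    (hk : Continuous fun p : Plane × Plane => k p.1 p.2) {S : Set Plane} (hS : IsCompact S) {r : ℝ}
    (h0 : ∀ x y, y ∉ S → k x y = 0) (h1 : ∀ x y, r < ‖x - y‖ → k x y = 0) :
    Integrable (fun p : Plane × Plane => w p.1 * k p.1 p.2) (volume.prod volume) := by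
  have hc : HasCompactSupport fun p : Plane × Plane => k p.1 p.2 := by
    refine HasCompactSupport.intro ((hS.cthickening (r := r)).prod hS) fun p hp => ?_
    by_contra hne
    have hy : p.2 ∈ S := by by_contra h; exact hne (h0 _ _ h)
    have hx : ‖p.1 - p.2‖ ≤ r := by by_contra h; exact hne (h1 _ _ (not_le.1 h))
    exact hp ⟨Metric.mem_cthickening_of_dist_le p.1 p.2 r S hy (by rwa [dist_eq_norm]), hy⟩
  obtain ⟨B, hB⟩ := hc.exists_bound_of_continuous hk
  have hi : Integrable (S.indicator fun _ => (1 : ℝ)) := by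
    rw [integrable_indicator_iff hS.measurableSet]
    exact integrableOn_const hS.measure_lt_top.ne
  have := (hw.mul_prod hi).mul_bdd (c := B) hk.aestronglyMeasurable
    (Filter.Eventually.of_forall hB)
  refine this.congr (Filter.Eventually.of_forall fun p => ?_)
  by_cases hp : p.2 ∈ S
  · simp [indicator_of_mem hp]
  · simp [h0 _ _ hp]

/-- One step of the regularization: if `L w ≥ h` weakly, then the mollification of `w` satisfies
the inequality up to an error of order `ε`, uniformly over test functions below a given one. -/
lemma exists_mollify_weakGE {Ω : Set Plane} (hΩ : IsOpen Ω) {w h : Plane → ℝ} (hw : Integrable w)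
    (hh : Integrable h) (H : A.WeakGE Ω w h) {S : Set Plane} (hS : IsCompact S) (hSΩ : S ⊆ Ω)
    (B : ℝ) :
    ∃ C : ℝ, ∃ ε₀ : ℝ, 0 < ε₀ ∧ ∀ ε, 0 < ε → ε < ε₀ → ∀ ψ : Plane → ℝ, ContDiff ℝ ∞ ψ →
      tsupport ψ ⊆ S → (∀ y, 0 ≤ ψ y) → (∀ y, ψ y ≤ B) →
      (∫ y, ψ y * A.mollify ε h y) - C * ε ≤ ∫ y, A.mollify ε w y * A.op ψ y := by
  obtain ⟨δ, hδ, hδΩ⟩ := hS.exists_cthickening_subset_open hΩ hSΩ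
  obtain ⟨C, hC, hswap⟩ := exists_op_kernel_swap_le A
  set V : ℝ := (volume (Metric.ball (0 : Plane) 1)).toReal with hV
  have hT := A.ell_pos
  refine ⟨C * |B| * (A.ell ^ 2 * V) * ∫ x, |w x|, min (δ / A.ell) (1 / A.ell), by positivity,
    fun ε hε hε0 ψ hψ hψS hψ0 hψB => ?_⟩
  have hε1 : A.ell * ε ≤ δ := by
    have := (hε0.trans_le (min_le_left _ _)).le
    rw [le_div_iff₀ hT] at this
    linarith
  have hε2 : A.ell * ε ≤ 1 := by
    have := (hε0.trans_le (min_le_right _ _)).le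
    rw [le_div_iff₀ hT] at this
    linarith
  have hψc : HasCompactSupport ψ := hS.of_isClosed_subset (isClosed_tsupport _) hψS
  have hψz (y) (hy : y ∉ S) : ψ y = 0 := image_eq_zero_of_notMem_tsupport fun h' => hy (hψS h')
  have hopz (y) (hy : y ∉ S) : A.op ψ y = 0 := op_eq_zero_of_notMem fun h' => hy (hψS h')
  have hkc : Continuous fun p : Plane × Plane => A.kernel ε p.1 p.2 :=
    contDiff_kernel.continuous
  have hkop : Continuous fun p : Plane × Plane => A.op (A.kernel ε p.1) p.2 :=
    (contDiff_op_param contDiff_kernel).continuous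
  have hkop' : Continuous fun p : Plane × Plane => A.op (A.kernel ε p.2) p.1 :=
    hkop.comp continuous_swap
  -- the three double integrals that occur
  have i1 : Integrable (fun p : Plane × Plane => w p.1 * (A.kernel ε p.1 p.2 * A.op ψ p.2))
      (volume.prod volume) :=
    integrable_prod_of_compact hw (k := fun x y => A.kernel ε x y * A.op ψ y)
      (hkc.mul ((contDiff_op hψ).continuous.comp continuous_snd)) hS (r := A.ell * ε)
      (fun x y hy => by simp [hopz y hy])
      (fun x y hxy => by rw [kernel_comm, kernel_eq_zero hε hxy, zero_mul])
  have i2 : Integrable (fun p : Plane × Plane => w p.1 * (A.op (A.kernel ε p.1) p.2 * ψ p.2))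
      (volume.prod volume) :=
    integrable_prod_of_compact hw (k := fun x y => A.op (A.kernel ε x) y * ψ y)
      (hkop.mul (hψ.continuous.comp continuous_snd)) hS (r := A.ell * ε)
      (fun x y hy => by simp [hψz y hy])
      (fun x y hxy => by rw [op_kernel_eq_zero hε (by rwa [norm_sub_rev]), zero_mul])
  have i3 : Integrable (fun p : Plane × Plane => w p.1 * (A.op (A.kernel ε p.2) p.1 * ψ p.2))
      (volume.prod volume) :=
    integrable_prod_of_compact hw (k := fun x y => A.op (A.kernel ε y) x * ψ y)
      (hkop'.mul (hψ.continuous.comp continuous_snd)) hS (r := A.ell * ε)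
      (fun x y hy => by simp [hψz y hy])
      (fun x y hxy => by rw [op_kernel_eq_zero hε hxy, zero_mul])
  have e1 : ∫ y, A.mollify ε w y * A.op ψ y
      = ∫ p : Plane × Plane, w p.1 * (A.op (A.kernel ε p.1) p.2 * ψ p.2)
        ∂(volume.prod volume) := by
    calc ∫ y, A.mollify ε w y * A.op ψ y
        = ∫ y, ∫ x, w x * (A.kernel ε x y * A.op ψ y) := by
          refine integral_congr_ae (Filter.Eventually.of_forall fun y => ?_)
          simp only [mollify, ← integral_mul_const]
          refine integral_congr_ae (Filter.Eventually.of_forall fun x => ?_)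
          simp only [kernel_comm x y]
          ring
      _ = ∫ x, ∫ y, w x * (A.kernel ε x y * A.op ψ y) := integral_integral_swap (i1.swap)
      _ = ∫ x, ∫ y, w x * (A.op (A.kernel ε x) y * ψ y) := by
          refine integral_congr_ae (Filter.Eventually.of_forall fun x => ?_)
          simp only [integral_const_mul]
          rw [integral_mul_op (contDiff_kernel_right x) hψ hψc]
          simp only [mul_comm]
      _ = _ := (integral_prod _ i2).symm
  have e2 : ∫ y, ψ y * A.mollify ε h y
      ≤ ∫ p : Plane × Plane, w p.1 * (A.op (A.kernel ε p.2) p.1 * ψ p.2)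
        ∂(volume.prod volume) := by
    rw [integral_prod_symm _ i3]
    refine integral_mono (((hψ.continuous.mul (contDiff_mollify hε hh).continuous)
      ).integrable_of_hasCompactSupport hψc.mul_right) i3.integral_prod_right fun y => ?_
    have e (x) : w x * (A.op (A.kernel ε y) x * ψ y) = ψ y * (w x * A.op (A.kernel ε y) x) := by
      ring
    simp only [e, integral_const_mul]
    by_cases hy : y ∈ S
    · refine mul_le_mul_of_nonneg_left ?_ (hψ0 y)
      refine H _ (contDiff_kernel_right y) (hasCompactSupport_kernel hε y) ?_ (kernel_nonneg · y)
      refine (tsupport_kernel hε y).trans (subset_trans ?_ hδΩ)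
      exact (Metric.closedBall_subset_closedBall hε1).trans (Metric.closedBall_subset_cthickening hy δ)
    · simp [hψz y hy]
  have e3 : |∫ p : Plane × Plane, (w p.1 * (A.op (A.kernel ε p.1) p.2 * ψ p.2)
      - w p.1 * (A.op (A.kernel ε p.2) p.1 * ψ p.2)) ∂(volume.prod volume)|
      ≤ (C * |B| * (A.ell ^ 2 * V) * ∫ x, |w x|) * ε := by
    have hk : Continuous fun p : Plane × Plane =>
        (A.op (A.kernel ε p.1) p.2 - A.op (A.kernel ε p.2) p.1) * ψ p.2 :=
      (hkop.sub hkop').mul (hψ.continuous.comp continuous_snd)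
    have hle := lintegral_lintegral_kernel_le hw (r := A.ell * ε) (B := C / ε * |B|)
      (k := fun x y => (A.op (A.kernel ε x) y - A.op (A.kernel ε y) x) * ψ y) hk.measurable
      (by positivity)
      (fun x y => by
        rw [abs_mul, abs_sub_comm]
        refine mul_le_mul (hswap ε hε hε2 x y) ?_ (abs_nonneg _) (by positivity)
        rw [abs_of_nonneg (hψ0 y)]
        exact (hψB y).trans (le_abs_self B))
      (fun x y hxy => by
        rw [op_kernel_eq_zero hε hxy, op_kernel_eq_zero hε (by rwa [norm_sub_rev]), sub_zero,
          zero_mul])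
    have hfin : volume (Metric.ball (0 : Plane) 1) = ENNReal.ofReal V :=
      (ENNReal.ofReal_toReal measure_ball_lt_top.ne).symm
    rw [hfin, ← ofReal_integral_norm_eq_lintegral_enorm hw, ← ENNReal.ofReal_mul (by positivity),
      ← ENNReal.ofReal_mul (by positivity), ← ENNReal.ofReal_mul (by positivity)] at hle
    rw [← Real.norm_eq_abs]
    have h1 := enorm_integral_le_lintegral_enorm (μ := (volume : Measure Plane).prod volume)
      fun p : Plane × Plane => (w p.1 * (A.op (A.kernel ε p.1) p.2 * ψ p.2)
      - w p.1 * (A.op (A.kernel ε p.2) p.1 * ψ p.2))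
    have h2 : ∫⁻ p : Plane × Plane, ‖w p.1 * (A.op (A.kernel ε p.1) p.2 * ψ p.2)
        - w p.1 * (A.op (A.kernel ε p.2) p.1 * ψ p.2)‖ₑ ∂(volume.prod volume)
        = ∫⁻ y, ∫⁻ x, ‖w x‖ₑ * ‖(A.op (A.kernel ε x) y - A.op (A.kernel ε y) x) * ψ y‖ₑ := by
      refine (lintegral_prod_symm _ (i2.sub i3).1.enorm).trans ?_
      refine lintegral_congr fun y => lintegral_congr fun x => ?_
      rw [← enorm_mul]
      congr 1
      simp only [Pi.sub_apply]
      ring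
    rw [h2] at h1
    have h3 := h1.trans hle
    rw [← ofReal_norm, ENNReal.ofReal_le_ofReal_iff (by positivity)] at h3
    refine h3.trans (le_of_eq ?_)
    simp only [Real.norm_eq_abs]
    field_simp
  rw [integral_sub i2 i3] at e3
  rw [e1]
  have := (abs_le.1 e3).1
  linarith

end Coeff

end VortexSystem

namespace VortexSystem

namespace Coeff

variable {A : Coeff}

/-- Kato's inequality for a smooth convex nondecreasing function `β` of slope at most one. -/
lemma WeakGE.comp_convex {Ω : Set Plane} (hΩ : IsOpen Ω) {w h : Plane → ℝ} (hw : Integrable w)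
    (hh : Integrable h) (H : A.WeakGE Ω w h) {β : ℝ → ℝ} (hβ : ContDiff ℝ ∞ β)
    (hβ0 : ∀ t, 0 ≤ deriv β t) (hβ1 : ∀ t, deriv β t ≤ 1) (hβ2 : ∀ t, 0 ≤ deriv (deriv β) t) :
    A.WeakGE Ω (fun y => β (w y)) (fun y => deriv β (w y) * h y) := by
  intro φ hφ hφc hφΩ hφ0
  have hβ' : ContDiff ℝ ∞ (deriv β) := (contDiff_infty_iff_deriv.1 hβ).2
  obtain ⟨B, hB⟩ := hφc.exists_bound_of_continuous hφ.continuous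
  obtain ⟨B', hB'⟩ := (hasCompactSupport_op (A := A) hφc).exists_bound_of_continuous
    (contDiff_op hφ).continuous
  have hB0 : 0 ≤ B := (norm_nonneg _).trans (hB 0)
  have hB'0 : 0 ≤ B' := (norm_nonneg _).trans (hB' 0)
  have hLip (s t : ℝ) : |β s - β t| ≤ |s - t| := by
    have := Convex.norm_image_sub_le_of_norm_deriv_le (f := β) (C := 1) (s := univ) (x := t) (y := s)
      (fun x _ => hβ.differentiable (by simp) x)
      (fun x _ => by rw [Real.norm_eq_abs, abs_of_nonneg (hβ0 x)]; exact hβ1 x)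
      convex_univ trivial trivial
    simpa using this
  obtain ⟨C, ε₀, hε₀, hstep⟩ := exists_mollify_weakGE hΩ hw hh H (hφc : IsCompact (tsupport φ)) hφΩ B
  obtain ⟨e, he0, he, hae⟩ := exists_seq_tendsto_mollify A hw
  have hWc (n) : ContDiff ℝ ∞ (A.mollify (e n) w) := contDiff_mollify (he0 n) hw
  have hhc (n) : ContDiff ℝ ∞ (A.mollify (e n) h) := contDiff_mollify (he0 n) hh
  have hLφ : Integrable fun y => A.op φ y :=
    (contDiff_op hφ).continuous.integrable_of_hasCompactSupport (hasCompactSupport_op hφc)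
  -- The inequality at scale `e n`: test with `β'(w_ε) φ`, where `w_ε` is the mollification, and drop
  -- the nonnegative term `β''(w_ε) A∇w_ε · ∇w_ε φ`.
  have hn : ∀ᶠ n in Filter.atTop,
      (∫ y, deriv β (A.mollify (e n) w y) * φ y * A.mollify (e n) h y) - C * e n
        ≤ ∫ y, β (A.mollify (e n) w y) * A.op φ y := by
    have he' := (tendsto_nhdsWithin_iff.1 he).1
    filter_upwards [he'.eventually (Iio_mem_nhds hε₀)] with n hlt
    set W := A.mollify (e n) w
    set ψ : Plane → ℝ := fun y => deriv β (W y) * φ y with hψ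
    have hψs : ContDiff ℝ ∞ ψ := (hβ'.comp (hWc n)).mul hφ
    have hψc : HasCompactSupport ψ := hφc.mul_left
    refine (hstep (e n) (he0 n) hlt ψ hψs (tsupport_mul_subset_right)
      (fun y => mul_nonneg (hβ0 _) (hφ0 y)) fun y => ?_).trans ?_
    · have := (le_abs_self _).trans (hB y)
      have := hφ0 y
      calc ψ y ≤ 1 * φ y := mul_le_mul_of_nonneg_right (hβ1 _) (hφ0 y)
        _ ≤ B := by linarith
    · rw [integral_mul_op (hWc n) hψs hψc]
      rw [integral_mul_op (φ := fun y => β (W y)) (hβ.comp (hWc n)) hφ hφc]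
      have hβW : ContDiff ℝ ∞ fun y => β (W y) := hβ.comp (hWc n)
      refine integral_mono
        ((hψs.continuous.mul (contDiff_op (hWc n)).continuous).integrable_of_hasCompactSupport
          hψc.mul_right)
        ((hφ.continuous.mul (contDiff_op hβW).continuous).integrable_of_hasCompactSupport
          hφc.mul_right) fun y => ?_
      have hop : A.op (fun y => β (W y)) y
          = deriv (deriv β) (W y) * A.energy W y + deriv β (W y) * A.op W y := op_comp hβ (hWc n)
      have := mul_nonneg (hφ0 y) (mul_nonneg (hβ2 (W y)) (energy_nonneg (A := A) (φ := W) (y := y)))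
      change deriv β (W y) * φ y * A.op W y ≤ φ y * A.op (fun y => β (W y)) y
      rw [hop]
      linarith
  have hL1w := (tendsto_mollify (A := A) hw).comp he
  have hL1h := (tendsto_mollify (A := A) hh).comp he
  have hβw : Integrable fun y => β (w y) * A.op φ y := by
    have h1 : Integrable fun y => (β (w y) - β 0) * A.op φ y := by
      refine (hw.norm.mul_const B').mono' ?_ (Filter.Eventually.of_forall fun y => ?_)
      · exact ((hβ.continuous.comp_aestronglyMeasurable hw.1).sub
          aestronglyMeasurable_const).mul (contDiff_op hφ).continuous.aestronglyMeasurable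
      · rw [norm_mul]
        exact mul_le_mul (by simpa using hLip (w y) 0) (hB' y) (norm_nonneg _) (norm_nonneg _)
    refine (h1.add (hLφ.const_mul (β 0))).congr (Filter.Eventually.of_forall fun y => ?_)
    simp only [Pi.add_apply]
    ring
  have lim1 : Filter.Tendsto (fun n => ∫ y, β (A.mollify (e n) w y) * A.op φ y) Filter.atTop
      (nhds (∫ y, β (w y) * A.op φ y)) := by
    refine tendsto_integral_of_L1 _ hβw.1 (Filter.Eventually.of_forall fun n =>
      ((hβ.continuous.comp (hWc n).continuous).mul
        (contDiff_op hφ).continuous).integrable_of_hasCompactSupport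
        (hasCompactSupport_op hφc).mul_left) ?_
    have h2 := ENNReal.Tendsto.const_mul (a := ENNReal.ofReal B') hL1w (Or.inr ENNReal.ofReal_ne_top)
    rw [mul_zero] at h2
    refine tendsto_of_tendsto_of_tendsto_of_le_of_le tendsto_const_nhds h2 (fun _ => zero_le)
      fun n => ?_
    simp only [Function.comp_apply]
    rw [← lintegral_const_mul' _ _ ENNReal.ofReal_ne_top]
    refine lintegral_mono fun y => ?_
    rw [← ofReal_norm, ← ofReal_norm, ← ENNReal.ofReal_mul hB'0, ← sub_mul, norm_mul, mul_comm]
    exact ENNReal.ofReal_le_ofReal (mul_le_mul (hB' y) (hLip _ _) (norm_nonneg _) hB'0)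
  have lim2 : Filter.Tendsto
      (fun n => ∫ y, deriv β (A.mollify (e n) w y) * φ y * A.mollify (e n) h y) Filter.atTop
      (nhds (∫ y, deriv β (w y) * h y * φ y)) := by
    have hb (n y) : ‖deriv β (A.mollify (e n) w y) * φ y‖ ≤ B := by
      rw [norm_mul, Real.norm_eq_abs, abs_of_nonneg (hβ0 _)]
      calc _ ≤ 1 * ‖φ y‖ := mul_le_mul_of_nonneg_right (hβ1 _) (norm_nonneg _)
        _ ≤ B := by linarith [hB y]
    have hcn (n) : Continuous fun y => deriv β (A.mollify (e n) w y) * φ y :=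
      (hβ'.continuous.comp (hWc n).continuous).mul hφ.continuous
    have i1 (n) : Integrable fun y => deriv β (A.mollify (e n) w y) * φ y * h y :=
      hh.bdd_mul (hcn n).aestronglyMeasurable (Filter.Eventually.of_forall (hb n))
    have i2 (n) : Integrable fun y => deriv β (A.mollify (e n) w y) * φ y * A.mollify (e n) h y :=
      ((hcn n).mul (hhc n).continuous).integrable_of_hasCompactSupport hφc.mul_left.mul_right
    have a1 : Filter.Tendsto (fun n => ∫ y, deriv β (A.mollify (e n) w y) * φ y * h y) Filter.atTop
        (nhds (∫ y, deriv β (w y) * h y * φ y)) := by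
      refine tendsto_integral_of_dominated_convergence (fun y => B * ‖h y‖) (fun n => (i1 n).1)
        (hh.norm.const_mul B) (fun n => Filter.Eventually.of_forall fun y => ?_) ?_
      · rw [norm_mul]
        exact mul_le_mul_of_nonneg_right (hb n y) (norm_nonneg _)
      · filter_upwards [hae] with y hy
        rw [mul_right_comm]
        exact (((hβ'.continuous.tendsto _).comp hy).mul_const _).mul_const _
    have a2 : Filter.Tendsto (fun n => (∫ y, deriv β (A.mollify (e n) w y) * φ y
        * A.mollify (e n) h y) - ∫ y, deriv β (A.mollify (e n) w y) * φ y * h y) Filter.atTop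
        (nhds 0) := by
      have h2 := ENNReal.Tendsto.const_mul (a := ENNReal.ofReal B) hL1h
        (Or.inr ENNReal.ofReal_ne_top)
      rw [mul_zero] at h2
      rw [tendsto_iff_enorm_sub_tendsto_zero]
      refine tendsto_of_tendsto_of_tendsto_of_le_of_le tendsto_const_nhds h2 (fun _ => zero_le)
        fun n => ?_
      simp only [Function.comp_apply, sub_zero]
      rw [← integral_sub (i2 n) (i1 n), ← lintegral_const_mul' _ _ ENNReal.ofReal_ne_top]
      refine (enorm_integral_le_lintegral_enorm _).trans (lintegral_mono fun y => ?_)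
      rw [← mul_sub, enorm_mul]
      gcongr
      rw [← ofReal_norm]
      exact ENNReal.ofReal_le_ofReal (hb n y)
    simpa using a2.add a1
  have lim3 : Filter.Tendsto (fun n => C * e n) Filter.atTop (nhds 0) := by
    simpa using (tendsto_nhdsWithin_iff.1 he).1.const_mul C
  have := le_of_tendsto_of_tendsto (lim2.sub lim3) lim1 hn
  simpa using this

/-- The derivative of the positive part, with the value `1/2` at zero. -/
def upperSign (t : ℝ) : ℝ := (1 + t / |t|) / 2

lemma upperSign_of_pos {t : ℝ} (h : 0 < t) : upperSign t = 1 := by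
  rw [upperSign, abs_of_pos h, div_self h.ne']; norm_num

lemma upperSign_of_neg {t : ℝ} (h : t < 0) : upperSign t = 0 := by
  rw [upperSign, abs_of_neg h, div_neg, div_self h.ne]; norm_num

lemma upperSign_zero : upperSign 0 = 1 / 2 := by simp [upperSign]

lemma upperSign_nonneg (t : ℝ) : 0 ≤ upperSign t := by
  rcases lt_trichotomy t 0 with h | rfl | h
  · rw [upperSign_of_neg h]
  · rw [upperSign_zero]; norm_num
  · rw [upperSign_of_pos h]; norm_num

lemma upperSign_le_one (t : ℝ) : upperSign t ≤ 1 := by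
  rcases lt_trichotomy t 0 with h | rfl | h
  · rw [upperSign_of_neg h]; norm_num
  · rw [upperSign_zero]; norm_num
  · rw [upperSign_of_pos h]

/-- A smooth convex approximation of the positive part. -/
def softPos (δ t : ℝ) : ℝ := (t + Real.sqrt (t ^ 2 + δ ^ 2)) / 2

section SoftPos

variable {δ : ℝ}

lemma softPos_rad_pos (hδ : 0 < δ) (t : ℝ) : 0 < t ^ 2 + δ ^ 2 := by positivity

lemma contDiff_softPos (hδ : 0 < δ) : ContDiff ℝ ∞ (softPos δ) := by
  unfold softPos
  exact (contDiff_id.add (((contDiff_id.pow 2).add contDiff_const).sqrt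
    fun t => (softPos_rad_pos hδ t).ne')).div_const 2

lemma hasDerivAt_sqrt_rad (hδ : 0 < δ) (t : ℝ) :
    HasDerivAt (fun t => Real.sqrt (t ^ 2 + δ ^ 2)) (t / Real.sqrt (t ^ 2 + δ ^ 2)) t := by
  have h := (((hasDerivAt_id t).pow 2).add_const (δ ^ 2)).sqrt (softPos_rad_pos hδ t).ne'
  refine h.congr_deriv ?_
  have hs := (Real.sqrt_pos.2 (softPos_rad_pos hδ t)).ne'
  simp only [id, Pi.pow_apply, Nat.cast_ofNat]
  field_simp
  simp

lemma deriv_softPos (hδ : 0 < δ) :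
    deriv (softPos δ) = fun t => (1 + t / Real.sqrt (t ^ 2 + δ ^ 2)) / 2 :=
  funext fun t => (((hasDerivAt_id t).add (hasDerivAt_sqrt_rad hδ t)).div_const 2).deriv

lemma abs_lt_sqrt_rad (hδ : 0 < δ) (t : ℝ) : |t| < Real.sqrt (t ^ 2 + δ ^ 2) := by
  rw [← Real.sqrt_sq_eq_abs]
  exact Real.sqrt_lt_sqrt (sq_nonneg t) (by linarith [pow_pos hδ 2])

lemma abs_div_sqrt_rad_le (hδ : 0 < δ) (t : ℝ) : |t / Real.sqrt (t ^ 2 + δ ^ 2)| ≤ 1 := by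
  have h := abs_lt_sqrt_rad hδ t
  rw [abs_div, abs_of_nonneg (Real.sqrt_nonneg _)]
  exact div_le_one_of_le₀ h.le (Real.sqrt_nonneg _)

lemma deriv_deriv_softPos_nonneg (hδ : 0 < δ) (t : ℝ) : 0 ≤ deriv (deriv (softPos δ)) t := by
  have hs := Real.sqrt_pos.2 (softPos_rad_pos hδ t)
  have hss := Real.sq_sqrt (softPos_rad_pos hδ t).le
  have h := (((hasDerivAt_id t).div (hasDerivAt_sqrt_rad hδ t) hs.ne').const_add 1).div_const 2
  rw [deriv_softPos hδ]
  refine le_of_le_of_eq ?_ h.deriv.symm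
  simp only [id]
  have : t * (t / Real.sqrt (t ^ 2 + δ ^ 2)) = t ^ 2 / Real.sqrt (t ^ 2 + δ ^ 2) := by ring
  rw [this]
  have h2 : 1 * Real.sqrt (t ^ 2 + δ ^ 2) - t ^ 2 / Real.sqrt (t ^ 2 + δ ^ 2)
      = δ ^ 2 / Real.sqrt (t ^ 2 + δ ^ 2) := by
    rw [eq_div_iff hs.ne', sub_mul, div_mul_cancel₀ _ hs.ne', one_mul, ← sq, hss]
    ring
  rw [h2]
  positivity

end SoftPos

/-- **Kato's inequality**: if `L w ≥ h`, then `L w⁺ ≥ h` where `w` is positive, and `L w⁺ ≥ 0` where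
it is negative. -/
theorem WeakGE.pos_part {Ω : Set Plane} (hΩ : IsOpen Ω) {w h : Plane → ℝ} (hw : Integrable w)
    (hh : Integrable h) (H : A.WeakGE Ω w h) :
    A.WeakGE Ω (fun y => max (w y) 0) (fun y => upperSign (w y) * h y) := by
  intro φ hφ hφc hφΩ hφ0
  set d : ℕ → ℝ := fun n => 1 / ((n : ℝ) + 1) with hd
  have hd0 (n) : 0 < d n := by simp only [hd]; positivity
  have hd1 (n) : d n ≤ 1 := by
    simp only [hd]
    rw [div_le_one (by positivity)]
    linarith [Nat.cast_nonneg (α := ℝ) n]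
  have hdlim : Filter.Tendsto d Filter.atTop (nhds 0) := tendsto_one_div_add_atTop_nhds_zero_nat
  have hn (n : ℕ) := (H.comp_convex hΩ hw hh (contDiff_softPos (hd0 n))
    (fun t => by
      rw [deriv_softPos (hd0 n)]
      have := (abs_le.1 (abs_div_sqrt_rad_le (hd0 n) t)).1
      simp only
      linarith)
    (fun t => by
      rw [deriv_softPos (hd0 n)]
      have := (abs_le.1 (abs_div_sqrt_rad_le (hd0 n) t)).2
      simp only
      linarith)
    (deriv_deriv_softPos_nonneg (hd0 n))) φ hφ hφc hφΩ hφ0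
  have hsq (t : ℝ) : Filter.Tendsto (fun n => Real.sqrt (t ^ 2 + d n ^ 2)) Filter.atTop
      (nhds |t|) := by
    have := ((hdlim.pow 2).const_add (t ^ 2)).sqrt
    simpa [Real.sqrt_sq_eq_abs] using this
  obtain ⟨B, hB⟩ := hφc.exists_bound_of_continuous hφ.continuous
  have hLc := hasCompactSupport_op (A := A) hφc
  obtain ⟨B', hB'⟩ := hLc.exists_bound_of_continuous (contDiff_op hφ).continuous
  have hLφ : Integrable fun y => A.op φ y :=
    (contDiff_op hφ).continuous.integrable_of_hasCompactSupport hLc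
  have lim1 : Filter.Tendsto (fun n => ∫ y, softPos (d n) (w y) * A.op φ y) Filter.atTop
      (nhds (∫ y, max (w y) 0 * A.op φ y)) := by
    refine tendsto_integral_of_dominated_convergence (fun y => (B' * ‖w y‖ + ‖A.op φ y‖))
      (fun n => ?_) ((hw.norm.const_mul B').add hLφ.norm)
      (fun n => Filter.Eventually.of_forall fun y => ?_) (Filter.Eventually.of_forall fun y => ?_)
    · exact ((contDiff_softPos (hd0 n)).continuous.comp_aestronglyMeasurable hw.1).mul hLφ.1
    · have h1 : |softPos (d n) (w y)| ≤ |w y| + 1 := by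
        have : Real.sqrt (w y ^ 2 + d n ^ 2) ≤ |w y| + 1 := by
          rw [Real.sqrt_le_left (by positivity)]
          nlinarith [sq_abs (w y), abs_nonneg (w y), hd0 n, hd1 n]
        have h0 := Real.sqrt_nonneg (w y ^ 2 + d n ^ 2)
        have h3 := abs_le.1 (le_refl |w y|)
        rw [softPos, abs_le]
        constructor <;> linarith [h3.1, h3.2, abs_nonneg (w y)]
      rw [norm_mul, Real.norm_eq_abs]
      have := mul_le_mul_of_nonneg_right h1 (norm_nonneg (A.op φ y))
      have := mul_le_mul_of_nonneg_left (hB' y) (norm_nonneg (w y))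
      rw [Real.norm_eq_abs (w y)] at *
      linarith
    · have h1 : max (w y) 0 = (w y + |w y|) / 2 := by
        rcases le_total (w y) 0 with h | h
        · rw [max_eq_right h, abs_of_nonpos h]; ring
        · rw [max_eq_left h, abs_of_nonneg h]; ring
      rw [h1]
      exact (((hsq (w y)).const_add (w y)).div_const 2).mul_const _
  have lim2 : Filter.Tendsto (fun n => ∫ y, deriv (softPos (d n)) (w y) * h y * φ y) Filter.atTop
      (nhds (∫ y, upperSign (w y) * h y * φ y)) := by
    refine tendsto_integral_of_dominated_convergence (fun y => ‖h y‖ * B)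
      (fun n => ?_) (hh.norm.mul_const B)
      (fun n => Filter.Eventually.of_forall fun y => ?_) (Filter.Eventually.of_forall fun y => ?_)
    · exact (((contDiff_infty_iff_deriv.1 (contDiff_softPos
        (hd0 n))).2.continuous.comp_aestronglyMeasurable hw.1).mul hh.1).mul
        hφ.continuous.aestronglyMeasurable
    · have h1 : |deriv (softPos (d n)) (w y)| ≤ 1 := by
        rw [deriv_softPos (hd0 n)]
        have h3 := abs_le.1 (abs_div_sqrt_rad_le (hd0 n) (w y))
        simp only
        rw [abs_le]
        constructor <;> linarith [h3.1, h3.2]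
      rw [norm_mul, norm_mul, Real.norm_eq_abs (deriv _ _)]
      have := mul_le_mul_of_nonneg_right h1 (norm_nonneg (h y))
      rw [one_mul] at this
      exact mul_le_mul this (hB y) (norm_nonneg _) (norm_nonneg _)
    · simp only [deriv_softPos (hd0 _)]
      refine Filter.Tendsto.mul_const _ (Filter.Tendsto.mul_const _ ?_)
      refine (Filter.Tendsto.const_add 1 ?_).div_const 2
      rcases eq_or_ne (w y) 0 with h0 | h0
      · simp [h0]
      · exact tendsto_const_nhds.div (hsq (w y)) (abs_ne_zero.2 h0)
  exact le_of_tendsto_of_tendsto' lim2 lim1 hn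

end Coeff

end VortexSystem

namespace VortexSystem

/-! ### Truncated Green functions -/

namespace Coeff

variable {A : Coeff} {ε R : ℝ}

variable (A) in
/-- A truncated fundamental solution of the operator `L`, with pole `y` smoothed at scale `ε` and
supported within distance of order `R` of `y`. Up to a small error, `L` of it is four times the
difference of the mollifying kernels at the scales `R` and `ε`. -/
def green (ε R : ℝ) (y x : Plane) : ℝ := logProfile ε R (A.rho y x)

lemma contDiff_green (hε : 0 < ε) (hR : ε ≤ R) (y : Plane) : ContDiff ℝ ∞ (A.green ε R y) :=
  (contDiff_logProfile hε hR).comp (A.contDiff_rho_right y)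

lemma green_nonneg (hε : 0 < ε) (hR : ε ≤ R) (x y : Plane) : 0 ≤ A.green ε R y x :=
  logProfile_nonneg hε hR _

lemma green_comm (x y : Plane) : A.green ε R y x = A.green ε R x y := by
  rw [green, green, rho_comm]

lemma green_eq_zero (hε : 0 < ε) (hR : ε ≤ R) {x y : Plane} (h : A.ell * R < ‖x - y‖) :
    A.green ε R y x = 0 :=
  logProfile_eq_zero hε hR (A.lt_rho_of_lt (hε.trans_le hR) h).le

lemma tsupport_green (hε : 0 < ε) (hR : ε ≤ R) (y : Plane) :
    tsupport (A.green ε R y) ⊆ Metric.closedBall y (A.ell * R) := by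
  refine closure_minimal (fun x hx => ?_) Metric.isClosed_closedBall
  rw [Metric.mem_closedBall, dist_eq_norm]
  by_contra h
  exact hx (green_eq_zero hε hR (not_le.1 h))

lemma hasCompactSupport_green (hε : 0 < ε) (hR : ε ≤ R) (y : Plane) :
    HasCompactSupport (A.green ε R y) :=
  (isCompact_closedBall _ _).of_isClosed_subset (isClosed_tsupport _) (tsupport_green hε hR y)

lemma op_green_eq_zero (hε : 0 < ε) (hR : ε ≤ R) {x y : Plane} (h : A.ell * R < ‖x - y‖) :
    A.op (A.green ε R y) x = 0 := by
  refine op_eq_zero_of_notMem fun h' => ?_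
  have := tsupport_green hε hR y h'
  rw [Metric.mem_closedBall, dist_eq_norm] at this
  linarith

lemma op_green (hε : 0 < ε) (hR : ε ≤ R) (x y : Plane) : A.op (A.green ε R y) x
    = -(deriv (logDensity ε R) (A.rho y x) * A.energy (A.rho y) x
      + logDensity ε R (A.rho y x) * A.op (A.rho y) x) := by
  have := op_comp (A := A) (y := x) (contDiff_logProfile hε hR) (A.contDiff_rho_right y)
  rw [deriv_logProfile hε hR] at this
  refine Eq.trans this ?_
  rw [deriv.fun_neg]
  ring

/-- The density of the truncated logarithm is an average over scales. -/
lemma logDensity_eq_integral (hε : 0 < ε) (hR : ε ≤ R) {t : ℝ} (ht : 0 < t) :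
    logDensity ε R t = ∫ r in ε..R, 2 / r * (eta (t / r ^ 2) / r ^ 2) := by
  have h0 (r : ℝ) (hr : r ∈ uIcc ε R) : 0 < r := by
    rw [uIcc_of_le hR] at hr; exact hε.trans_le hr.1
  have hd (r : ℝ) (hr : r ∈ uIcc ε R) : HasDerivAt (fun r => -(etaInt (t / r ^ 2) / t))
      (2 / r * (eta (t / r ^ 2) / r ^ 2)) r := by
    have hr := h0 r hr
    have h1 : HasDerivAt (fun r : ℝ => t / r ^ 2) (-(t * (2 * r)) / (r ^ 2) ^ 2) r := by
      have := (hasDerivAt_const r t).div (hasDerivAt_pow 2 r) (by positivity)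
      refine this.congr_deriv ?_
      simp
    have h2 := (((hasDerivAt_etaInt (t / r ^ 2)).comp r h1).div_const t).neg
    refine h2.congr_deriv ?_
    field_simp
  have hc : ContinuousOn (fun r => 2 / r * (eta (t / r ^ 2) / r ^ 2)) (uIcc ε R) := by
    have hη := contDiff_eta.continuous
    refine (continuousOn_const.div continuousOn_id fun r hr => (h0 r hr).ne').mul
      ((hη.comp_continuousOn (continuousOn_const.div (continuousOn_id.pow 2) fun r hr => ?_)).div
        (continuousOn_id.pow 2) fun r hr => ?_)
    · exact pow_ne_zero 2 (h0 r hr).ne'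
    · exact pow_ne_zero 2 (h0 r hr).ne'
  rw [intervalIntegral.integral_eq_sub_of_hasDerivAt hd hc.intervalIntegrable, logDensity]
  ring

lemma continuousOn_kernel_scale (x y : Plane) (hε : 0 < ε) :
    ContinuousOn (fun r => A.kernel r y x) (Ici ε) := by
  simp only [kernel_def]
  have h0 (r : ℝ) (hr : r ∈ Ici ε) : r ^ 2 ≠ 0 := by
    have : 0 < r := hε.trans_le hr
    positivity
  exact (contDiff_eta.continuous.comp_continuousOn (continuousOn_const.div (continuousOn_id.pow 2)
    h0)).div (continuousOn_id.pow 2) h0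

lemma dist_mul_kernel_le (hε : 0 < ε) (x y : Plane) :
    ‖x - y‖ * A.kernel ε y x ≤ A.ell * (ε * A.kernel ε y x) := by
  rcases lt_or_ge (A.ell * ε) ‖x - y‖ with h | h
  · rw [kernel_eq_zero hε h]; simp
  · rw [← mul_assoc]
    exact mul_le_mul_of_nonneg_right h (kernel_nonneg _ _)

lemma dist_mul_logDensity_le (hε : 0 < ε) (hR : ε ≤ R) {x y : Plane} (hxy : x ≠ y) :
    ‖x - y‖ * logDensity ε R (A.rho y x) ≤ 2 * A.ell * ∫ r in ε..R, A.kernel r y x := by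
  rw [logDensity_eq_integral hε hR (A.rho_pos hxy), ← intervalIntegral.integral_const_mul,
    ← intervalIntegral.integral_const_mul]
  have hk := (continuousOn_kernel_scale (A := A) x y hε).mono
    (show Icc ε R ⊆ Ici ε from Icc_subset_Ici_self)
  refine intervalIntegral.integral_mono_on hR ?_ ?_ fun r hr => ?_
  · refine ContinuousOn.intervalIntegrable ?_
    rw [uIcc_of_le hR]
    simp only [← kernel_def]
    exact continuousOn_const.mul ((continuousOn_const.div continuousOn_id
      fun r hr => (hε.trans_le hr.1).ne').mul hk)
  · refine ContinuousOn.intervalIntegrable ?_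
    rw [uIcc_of_le hR]
    exact continuousOn_const.mul hk
  · have hr0 := hε.trans_le hr.1
    rw [← kernel_def]
    have := dist_mul_kernel_le (A := A) hr0 x y
    calc _ = 2 / r * (‖x - y‖ * A.kernel r y x) := by ring
      _ ≤ 2 / r * (A.ell * (r * A.kernel r y x)) := by gcongr
      _ = _ := by field_simp

/-- The truncated Green function solves the equation up to an error that is an average of the
kernels at all scales between `ε` and `R`. -/
lemma exists_op_green_le (A : Coeff) : ∃ C : ℝ, 0 ≤ C ∧ ∀ ε R : ℝ, 0 < ε → ε ≤ R → A.ell * R ≤ 1 →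
    ∀ x y, |A.op (A.green ε R y) x + 4 * A.kernel ε y x - 4 * A.kernel R y x|
      ≤ C * (ε * A.kernel ε y x + R * A.kernel R y x + ∫ r in ε..R, A.kernel r y x) := by
  obtain ⟨C₁, hC₁, h₁⟩ := A.ord_energy_rho
  obtain ⟨C₂, hC₂, h₂⟩ := A.ord_op_rho
  have hT := A.ell_pos
  refine ⟨(C₁ * A.ell + C₂) * (2 * A.ell), by positivity, fun ε R hε hR hR1 x y => ?_⟩
  have hR0 := hε.trans_le hR
  have hkε := A.kernel_nonneg (ε := ε) x y
  have hkR := A.kernel_nonneg (ε := R) x y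
  have hint : 0 ≤ ∫ r in ε..R, A.kernel r y x :=
    intervalIntegral.integral_nonneg hR fun r _ => A.kernel_nonneg x y
  rcases lt_or_ge (A.ell * R) ‖x - y‖ with h | h
  · rw [op_green_eq_zero hε hR h, kernel_eq_zero hε (lt_of_le_of_lt (by gcongr) h),
      kernel_eq_zero hR0 h]
    simp only [mul_zero, add_zero, zero_add, sub_zero, abs_zero]
    positivity
  have hd := logDensity_add_mul_deriv hε hR (A.rho y x)
  rw [← kernel_def, ← kernel_def] at hd
  have e : A.op (A.green ε R y) x + 4 * A.kernel ε y x - 4 * A.kernel R y x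
      = -(deriv (logDensity ε R) (A.rho y x) * (A.energy (A.rho y) x - 4 * A.rho y x)
        + logDensity ε R (A.rho y x) * (A.op (A.rho y) x - 4)) := by
    rw [op_green hε hR]
    linear_combination -4 * hd
  rw [e, abs_neg]
  rcases eq_or_ne x y with rfl | hxy
  · have hz := h₁ x x (by simp)
    have hz' := h₂ x x (by simp)
    simp only [sub_self, norm_zero, ne_eq, OfNat.ofNat_ne_zero, not_false_eq_true, zero_pow,
      one_ne_zero, mul_zero, abs_nonpos_iff] at hz hz'
    rw [hz, hz']
    simp only [mul_zero, add_zero, abs_zero]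
    positivity
  have hρ := A.rho_pos hxy
  set d := ‖x - y‖ with hdd
  set ld := logDensity ε R (A.rho y x)
  set ld' := deriv (logDensity ε R) (A.rho y x)
  have hld : 0 ≤ ld := logDensity_nonneg hε hR _
  have hd1 : d ≤ 1 := h.trans hR1
  have hd0 : 0 ≤ d := norm_nonneg _
  have b1 : |ld'| * A.rho y x ≤ A.kernel ε y x + A.kernel R y x + ld := by
    rw [show |ld'| * A.rho y x = |ld' * A.rho y x| by rw [abs_mul, abs_of_pos hρ], abs_le]
    constructor <;> linarith
  have b2 : |ld'| * d ^ 3 ≤ A.ell * (d * (A.kernel ε y x + A.kernel R y x + ld)) := by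
    calc |ld'| * d ^ 3 = |ld'| * d ^ 2 * d := by ring
      _ ≤ |ld'| * (A.ell * A.rho y x) * d := by
          gcongr
          exact A.norm_sq_le x y
      _ = A.ell * (d * (|ld'| * A.rho y x)) := by ring
      _ ≤ _ := by gcongr
  have b3 := dist_mul_kernel_le (A := A) hε x y
  have b4 := dist_mul_kernel_le (A := A) hR0 x y
  have b5 := dist_mul_logDensity_le (A := A) hε hR hxy
  have b6 : d * (A.kernel ε y x + A.kernel R y x + ld)
      ≤ 2 * A.ell * (ε * A.kernel ε y x + R * A.kernel R y x + ∫ r in ε..R, A.kernel r y x) := by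
    have : 0 ≤ A.ell * (ε * A.kernel ε y x) := by positivity
    have : 0 ≤ A.ell * (R * A.kernel R y x) := by positivity
    linarith
  have b7 : d * ld ≤ d * (A.kernel ε y x + A.kernel R y x + ld) := by
    gcongr; linarith
  calc _ ≤ |ld'| * |A.energy (A.rho y) x - 4 * A.rho y x| + ld * |A.op (A.rho y) x - 4| := by
        refine (abs_add_le _ _).trans (le_of_eq ?_)
        rw [abs_mul, abs_mul, abs_of_nonneg hld]
    _ ≤ |ld'| * (C₁ * d ^ 3) + ld * (C₂ * d ^ 1) := by
        gcongr
        · exact h₁ x y hd1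
        · exact h₂ x y hd1
    _ = C₁ * (|ld'| * d ^ 3) + C₂ * (d * ld) := by ring
    _ ≤ C₁ * (A.ell * (d * (A.kernel ε y x + A.kernel R y x + ld)))
        + C₂ * (d * (A.kernel ε y x + A.kernel R y x + ld)) := by gcongr
    _ = (C₁ * A.ell + C₂) * (d * (A.kernel ε y x + A.kernel R y x + ld)) := by ring
    _ ≤ (C₁ * A.ell + C₂) * (2 * A.ell
        * (ε * A.kernel ε y x + R * A.kernel R y x + ∫ r in ε..R, A.kernel r y x)) := by gcongr
    _ = _ := by ring

lemma measurable_kernel_scale (y : Plane) :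
    Measurable fun p : Plane × ℝ => A.kernel p.2 y p.1 := by
  simp only [kernel_def]
  have h1 : Measurable (A.rho y) := (A.contDiff_rho_right y).continuous.measurable
  have h2 : Measurable eta := contDiff_eta.continuous.measurable
  exact (h2.comp ((h1.comp measurable_fst).div (measurable_snd.pow_const 2))).div
    (measurable_snd.pow_const 2)

lemma integrable_mul_kernel_scale {w : Plane → ℝ} (hw : Integrable w) (hε : 0 < ε) (y : Plane) :
    Integrable (fun p : Plane × ℝ => w p.1 * A.kernel p.2 y p.1)
      (volume.prod (volume.restrict (Ioc ε R))) := by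
  obtain ⟨C, hC, h⟩ := exists_kernel_le A
  have h1 : Integrable (fun p : Plane × ℝ => w p.1 * (1 : ℝ))
      (volume.prod (volume.restrict (Ioc ε R))) :=
    hw.mul_prod (integrable_const (1 : ℝ))
  simp only [mul_one] at h1
  refine (h1.norm.mul_const (C / ε ^ 2)).mono'
    (h1.1.mul (measurable_kernel_scale y).aestronglyMeasurable) ?_
  have h2 : ∀ᵐ p : Plane × ℝ ∂(volume.prod (volume.restrict (Ioc ε R))), p.2 ∈ Ioc ε R :=
    Measure.quasiMeasurePreserving_snd.ae (ae_restrict_mem measurableSet_Ioc)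
  filter_upwards [h2] with p hp
  rw [norm_mul, Real.norm_eq_abs (A.kernel _ _ _), abs_of_nonneg (kernel_nonneg _ _)]
  gcongr
  refine (h p.2 p.1 y |>.trans_eq' (kernel_comm _ _)).trans ?_ |>.trans_eq' ?_
  · gcongr
    exact hp.1.le
  · exact kernel_comm _ _

lemma mollify_nonneg {w : Plane → ℝ} (hw : ∀ x, 0 ≤ w x) (y : Plane) : 0 ≤ A.mollify ε w y :=
  integral_nonneg fun x => mul_nonneg (hw x) (kernel_nonneg _ _)

/-- The mean value formula: for a nonnegative function, testing with the truncated Green function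
computes the difference of the means at scales `R` and `ε`, up to `R` times the largest of the means
at the scales in between. -/
lemma exists_integral_mul_op_green_le (A : Coeff) : ∃ C : ℝ, 0 ≤ C ∧ ∀ ε R : ℝ, 0 < ε → ε ≤ R →
    A.ell * R ≤ 1 → ∀ w : Plane → ℝ, Integrable w → (∀ x, 0 ≤ w x) → ∀ (y : Plane) (B : ℝ),
    (∀ r ∈ Icc ε R, A.mollify r w y ≤ B) →
      |(∫ x, w x * A.op (A.green ε R y) x) + 4 * A.mollify ε w y - 4 * A.mollify R w y|
        ≤ C * R * B := by
  obtain ⟨C, hC, h⟩ := exists_op_green_le A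
  refine ⟨C * 3, by positivity, fun ε R hε hR hR1 w hw hw0 y B hB => ?_⟩
  have hR0 := hε.trans_le hR
  have iε := integrable_mul_kernel (A := A) (ε := ε) hw y
  have iR := integrable_mul_kernel (A := A) (ε := R) hw y
  have iL : Integrable fun x => w x * A.op (A.green ε R y) x := by
    have hc := hasCompactSupport_op (A := A) (hasCompactSupport_green (A := A) hε hR y)
    have hs := (contDiff_op (A := A) (contDiff_green (A := A) hε hR y)).continuous
    obtain ⟨K, hK⟩ := hc.exists_bound_of_continuous hs
    exact hw.mul_bdd (c := K) hs.aestronglyMeasurable (Filter.Eventually.of_forall hK)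
  have iS : Integrable fun x => w x * ∫ r in ε..R, A.kernel r y x := by
    have := (integrable_mul_kernel_scale (A := A) (R := R) hw hε y).integral_prod_left
    refine this.congr (Filter.Eventually.of_forall fun x => ?_)
    simp only
    rw [integral_const_mul, intervalIntegral.integral_of_le hR]
  have eS : ∫ x, w x * ∫ r in ε..R, A.kernel r y x = ∫ r in ε..R, A.mollify r w y := by
    have := integral_integral_swap (f := fun x r => w x * A.kernel r y x)
      (integrable_mul_kernel_scale (A := A) (R := R) hw hε y)
    rw [intervalIntegral.integral_of_le hR]
    refine Eq.trans ?_ this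
    refine integral_congr_ae (Filter.Eventually.of_forall fun x => ?_)
    simp only
    rw [integral_const_mul, intervalIntegral.integral_of_le hR]
  have bS : ∫ r in ε..R, A.mollify r w y ≤ R * B := by
    have hB0 : 0 ≤ B := (mollify_nonneg hw0 y).trans (hB R ⟨hR, le_rfl⟩)
    have i1 : IntegrableOn (fun r => A.mollify r w y) (Ioc ε R) :=
      (integrable_mul_kernel_scale (A := A) (R := R) hw hε y).integral_prod_right
    have := intervalIntegral.integral_mono_on hR
      ((intervalIntegrable_iff_integrableOn_Ioc_of_le hR).2 i1)
      (intervalIntegrable_const (c := B)) fun r hr => hB r hr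
    refine this.trans ?_
    rw [intervalIntegral.integral_const, smul_eq_mul]
    gcongr
    linarith
  have iLε : Integrable fun x => w x * A.op (A.green ε R y) x + 4 * (w x * A.kernel ε y x) :=
    iL.add (iε.const_mul 4)
  have iεR (a b : ℝ) : Integrable fun x => a * (w x * A.kernel ε y x) + b * (w x * A.kernel R y x) :=
    (iε.const_mul a).add (iR.const_mul b)
  have e1 : (∫ x, w x * A.op (A.green ε R y) x) + 4 * A.mollify ε w y - 4 * A.mollify R w y
      = ∫ x, w x * (A.op (A.green ε R y) x + 4 * A.kernel ε y x - 4 * A.kernel R y x) := by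
    rw [mollify, mollify, ← integral_const_mul, ← integral_const_mul,
      ← integral_add iL (iε.const_mul 4), ← integral_sub iLε (iR.const_mul 4)]
    congr 1
    funext x
    ring
  have e2 : ∫ x, w x * (C * (ε * A.kernel ε y x + R * A.kernel R y x + ∫ r in ε..R, A.kernel r y x))
      = C * (ε * A.mollify ε w y + R * A.mollify R w y + ∫ r in ε..R, A.mollify r w y) := by
    rw [← eS, mollify, mollify, ← integral_const_mul, ← integral_const_mul,
      ← integral_add (iε.const_mul _) (iR.const_mul _),
      ← integral_add (iεR _ _) iS, ← integral_const_mul]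
    congr 1
    funext x
    ring
  rw [e1]
  calc _ ≤ ∫ x, w x * (C * (ε * A.kernel ε y x + R * A.kernel R y x
        + ∫ r in ε..R, A.kernel r y x)) := by
        rw [← Real.norm_eq_abs]
        refine norm_integral_le_of_norm_le ?_ (Filter.Eventually.of_forall fun x => ?_)
        · refine ((((iε.const_mul ε).add (iR.const_mul R)).add iS).const_mul C).congr
            (Filter.Eventually.of_forall fun x => ?_)
          simp only [Pi.add_apply]
          ring
        · rw [norm_mul, Real.norm_eq_abs, abs_of_nonneg (hw0 x), Real.norm_eq_abs]
          exact mul_le_mul_of_nonneg_left (h ε R hε hR hR1 x y) (hw0 x)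
    _ = _ := e2
    _ ≤ C * (R * B + R * B + R * B) := by
        have hB0 : 0 ≤ B := (mollify_nonneg hw0 y).trans (hB R ⟨hR, le_rfl⟩)
        refine mul_le_mul_of_nonneg_left (add_le_add (add_le_add ?_ ?_) bS) hC
        · exact mul_le_mul hR (hB ε ⟨le_rfl, hR⟩) (mollify_nonneg hw0 y) hR0.le
        · exact mul_le_mul_of_nonneg_left (hB R ⟨hR, le_rfl⟩) hR0.le
    _ = _ := by ring

end Coeff

end VortexSystem

namespace VortexSystem

/-! ### Local regularity -/

/-- The integral of `1 / |x - y|` over a disc about `y` is proportional to the radius. -/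
lemma integrable_inv_dist (y : Plane) {r : ℝ} (hr : 0 ≤ r) :
    Integrable (fun x => (Iic r).indicator (fun t : ℝ => t⁻¹) ‖x - y‖) ∧
    ∫ x, (Iic r).indicator (fun t : ℝ => t⁻¹) ‖x - y‖
      = 2 * volume.real (Metric.ball (0 : Plane) 1) * r := by
  have hE : ∀ t ∈ Ioi (0 : ℝ), t ^ (Module.finrank ℝ Plane - 1) •
      (Iic r).indicator (fun t : ℝ => t⁻¹) t = (Iic r).indicator (fun _ => (1 : ℝ)) t := by
    intro t ht
    have ht' : t ≠ 0 := (mem_Ioi.1 ht).ne'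
    by_cases h : t ∈ Iic r
    · simp [indicator_of_mem h, ht']
    · simp [indicator_of_notMem h]
  have hI : IntegrableOn (fun t => (Iic r).indicator (fun _ => (1 : ℝ)) t) (Ioi (0 : ℝ)) := by
    rw [IntegrableOn, integrable_indicator_iff measurableSet_Iic, IntegrableOn,
      Measure.restrict_restrict measurableSet_Iic, inter_comm, Ioi_inter_Iic]
    exact integrable_const _
  constructor
  · have := (integrable_fun_norm_addHaar (E := Plane) volume
      (f := (Iic r).indicator (fun t : ℝ => t⁻¹))).2
      (hI.congr_fun (fun t ht => (hE t ht).symm) measurableSet_Ioi)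
    exact this.comp_sub_right y
  · rw [integral_sub_right_eq_self (fun x : Plane => (Iic r).indicator (fun t : ℝ => t⁻¹) ‖x‖) y,
      integral_fun_norm_addHaar, setIntegral_congr_fun measurableSet_Ioi hE,
      setIntegral_indicator measurableSet_Iic, Ioi_inter_Iic]
    simp [hr]
    ring

namespace Coeff

variable {A : Coeff} {ε R : ℝ}

lemma logProfile_anti {r : ℝ} (hε : 0 < ε) (hr : ε ≤ r) (hR : r ≤ R) {s : ℝ} (hs : 0 ≤ s) :
    logProfile r R s ≤ logProfile ε R s := by
  have hr0 := hε.trans_le hr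
  rcases le_total (R ^ 2) s with h | h
  · rw [logProfile_eq_zero hr0 hR h, logProfile_eq_zero hε (hr.trans hR) h]
  · refine intervalIntegral.integral_mono_on h
      ((contDiff_logDensity hr0 hR).continuous.intervalIntegrable _ _)
      ((contDiff_logDensity hε (hr.trans hR)).continuous.intervalIntegrable _ _) fun t ht => ?_
    have ht0 : 0 ≤ t := hs.trans ht.1
    unfold logDensity
    gcongr
    exact monotone_etaInt (by gcongr)

lemma green_anti {r : ℝ} (hε : 0 < ε) (hr : ε ≤ r) (hR : r ≤ R) (x y : Plane) :
    A.green r R y x ≤ A.green ε R y x := logProfile_anti hε hr hR (A.rho_nonneg _ _)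

/-- A crude bound of the logarithm by the inverse distance, enough for integrals of `green`. -/
lemma green_le (hε : 0 < ε) (hR : ε ≤ R) {x y : Plane} (hxy : x ≠ y) :
    A.green ε R y x ≤ 2 * etaInt 1 * R * A.ell * (Iic (A.ell * R)).indicator
      (fun t : ℝ => t⁻¹) ‖x - y‖ := by
  have hΘ := etaInt_one_pos
  have hT := A.one_le_ell
  have hR0 := hε.trans_le hR
  have hd : 0 < ‖x - y‖ := norm_pos_iff.2 (sub_ne_zero.2 hxy)
  have hnn : 0 ≤ 2 * etaInt 1 * R * A.ell * ‖x - y‖⁻¹ := by positivity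
  by_cases hx : ‖x - y‖ ∈ Iic (A.ell * R)
  · rw [indicator_of_mem hx]
    have hρ := A.rho_pos hxy
    rcases le_total (R ^ 2) (A.rho y x) with h | h
    · rw [green, logProfile_eq_zero hε hR h]
      exact hnn
    refine (logProfile_le hε hR hρ h).trans ?_
    have h1 : Real.log (R ^ 2 / A.rho y x) ≤ 2 * (R / Real.sqrt (A.rho y x)) := by
      have hs := Real.sqrt_pos.2 hρ
      have : R ^ 2 / A.rho y x = (R / Real.sqrt (A.rho y x)) ^ 2 := by
        rw [div_pow, Real.sq_sqrt hρ.le]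
      rw [this, Real.log_pow]
      have := Real.log_le_sub_one_of_pos (div_pos hR0 hs)
      push_cast
      linarith
    have h2 : R / Real.sqrt (A.rho y x) ≤ R * (A.ell * ‖x - y‖⁻¹) := by
      rw [div_eq_mul_inv]
      gcongr
      rw [← div_eq_mul_inv, inv_le_comm₀ (Real.sqrt_pos.2 hρ) (by positivity), inv_div]
      refine Real.le_sqrt_of_sq_le ?_
      rw [div_pow, div_le_iff₀ (by positivity)]
      calc _ ≤ A.ell * A.rho y x := A.norm_sq_le x y
        _ ≤ A.ell ^ 2 * A.rho y x := by
          gcongr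
          nlinarith
        _ = _ := by ring
    calc _ ≤ etaInt 1 * (2 * (R * (A.ell * ‖x - y‖⁻¹))) := by gcongr; linarith
      _ = _ := by ring
  · rw [green_eq_zero hε hR (not_le.1 hx), indicator_of_notMem hx, mul_zero]

lemma integrable_green (hε : 0 < ε) (hR : ε ≤ R) (y : Plane) : Integrable (A.green ε R y) :=
  (contDiff_green hε hR y).continuous.integrable_of_hasCompactSupport
    (hasCompactSupport_green hε hR y)

lemma exists_integral_green_le (A : Coeff) : ∃ C : ℝ, 0 ≤ C ∧ ∀ ε R : ℝ, 0 < ε → ε ≤ R →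
    A.ell * R ≤ 1 → ∀ y, ∫ x, A.green ε R y x ≤ C * R := by
  have hΘ := etaInt_one_pos
  have hT := A.ell_pos
  refine ⟨2 * etaInt 1 * A.ell * (2 * volume.real (Metric.ball (0 : Plane) 1)), by positivity,
    fun ε R hε hR hR1 y => ?_⟩
  have hR0 := hε.trans_le hR
  obtain ⟨h1, h2⟩ := integrable_inv_dist y (r := A.ell * R) (by positivity)
  calc ∫ x, A.green ε R y x ≤ ∫ x, 2 * etaInt 1 * R * A.ell * (Iic (A.ell * R)).indicator
        (fun t : ℝ => t⁻¹) ‖x - y‖ := by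
        refine integral_mono_ae (integrable_green hε hR y) (h1.const_mul _) ?_
        have : ∀ᵐ x : Plane, x ≠ y := by simp [ae_iff]
        filter_upwards [this] with x hx using green_le hε hR hx
    _ = (2 * etaInt 1 * A.ell * (2 * volume.real (Metric.ball (0 : Plane) 1)) * R)
          * (A.ell * R) := by
        rw [integral_const_mul, h2]; ring
    _ ≤ (2 * etaInt 1 * A.ell * (2 * volume.real (Metric.ball (0 : Plane) 1)) * R) * 1 := by
        gcongr
    _ = _ := by ring

lemma integrable_kernel (hε : 0 < ε) (y : Plane) : Integrable (A.kernel ε y) :=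
  (contDiff_kernel_right y).continuous.integrable_of_hasCompactSupport
    (hasCompactSupport_kernel hε y)

lemma exists_integral_kernel_le (A : Coeff) : ∃ C : ℝ, 0 ≤ C ∧ ∀ ε : ℝ, 0 < ε → ∀ y,
    ∫ x, A.kernel ε y x ≤ C := by
  obtain ⟨C, hC, h⟩ := exists_kernel_le A
  have hT := A.ell_pos
  refine ⟨C * A.ell ^ 2 * volume.real (Metric.ball (0 : Plane) 1), by positivity, fun ε hε y => ?_⟩
  have hi : Integrable ((Metric.closedBall y (A.ell * ε)).indicator fun _ => C / ε ^ 2) := by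
    rw [integrable_indicator_iff Metric.isClosed_closedBall.measurableSet]
    exact integrableOn_const (isCompact_closedBall _ _).measure_lt_top.ne
  calc _ ≤ ∫ x, (Metric.closedBall y (A.ell * ε)).indicator (fun _ => C / ε ^ 2) x := by
        refine integral_mono (integrable_kernel hε y) hi fun x => ?_
        by_cases hx : x ∈ Metric.closedBall y (A.ell * ε)
        · rw [indicator_of_mem hx]; exact h ε x y
        · rw [indicator_of_notMem hx]
          rw [Metric.mem_closedBall, not_le, dist_eq_norm] at hx
          exact (kernel_eq_zero hε hx).le
    _ = _ := by
        rw [integral_indicator Metric.isClosed_closedBall.measurableSet, setIntegral_const,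
          smul_eq_mul, Measure.real, volume_closedBall_eq y (by positivity), ENNReal.toReal_mul,
          ENNReal.toReal_ofReal (by positivity), ← Measure.real]
        field_simp

lemma exists_mollify_le (A : Coeff) : ∃ C : ℝ, 0 ≤ C ∧ ∀ ε : ℝ, 0 < ε → ∀ w : Plane → ℝ,
    Integrable w → (∀ x, 0 ≤ w x) → ∀ y, A.mollify ε w y ≤ C / ε ^ 2 * ∫ x, w x := by
  obtain ⟨C, hC, h⟩ := exists_kernel_le A
  refine ⟨C, hC, fun ε hε w hw hw0 y => ?_⟩
  rw [← integral_const_mul, mollify]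
  refine integral_mono (integrable_mul_kernel hw y) (hw.const_mul _) fun x => ?_
  simp only
  rw [mul_comm]
  exact mul_le_mul_of_nonneg_right (h ε x y) (hw0 x)

/-- The mean at a small scale is controlled by the mean at the scale `R`. The mean value formula
bounds the largest mean `S` over the scales in `[ε, R]` by the mean at scale `R` plus `C R S / 4`,
and the last term is absorbed since `C R ≤ 1 / 2`. -/
lemma exists_mollify_le_mollify (A : Coeff) : ∃ C R₀ : ℝ, 0 ≤ C ∧ 0 < R₀ ∧ A.ell * R₀ ≤ 1 ∧
    C * R₀ ≤ 1 / 2 ∧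
    ∀ ε R : ℝ, 0 < ε → ε ≤ R → R ≤ R₀ → ∀ w : Plane → ℝ, Integrable w → (∀ x, 0 ≤ w x) →
    ∀ (y : Plane) (b : ℝ), (∀ r ∈ Icc ε R, -b ≤ ∫ x, w x * A.op (A.green r R y) x) →
      A.mollify ε w y ≤ 2 * A.mollify R w y + b / 2 ∧
      |(∫ x, w x * A.op (A.green ε R y) x) + 4 * A.mollify ε w y - 4 * A.mollify R w y|
        ≤ C * R * (2 * A.mollify R w y + b / 2) := by
  obtain ⟨C, hC, h⟩ := exists_integral_mul_op_green_le A
  obtain ⟨C', hC', h'⟩ := exists_mollify_le A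
  have hT := A.ell_pos
  refine ⟨C, min (1 / A.ell) (1 / (2 * (C + 1))), hC, by positivity, ?_, ?_, ?_⟩
  · calc _ ≤ A.ell * (1 / A.ell) := by gcongr; exact min_le_left _ _
      _ = 1 := by field_simp
  · calc _ ≤ C * (1 / (2 * (C + 1))) := by gcongr; exact min_le_right _ _
      _ ≤ 1 / 2 := by
        rw [mul_one_div, div_le_div_iff₀ (by positivity) (by norm_num)]
        linarith
  intro ε R hε hR hR1 w hw hw0 y b hb
  have hR0 := hε.trans_le hR
  have e1 : A.ell * R ≤ 1 := by
    calc _ ≤ A.ell * (1 / A.ell) := by gcongr; exact hR1.trans (min_le_left _ _)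
      _ = 1 := by field_simp
  have e2 : C * R ≤ 1 / 2 := by
    calc _ ≤ C * (1 / (2 * (C + 1))) := by gcongr; exact hR1.trans (min_le_right _ _)
      _ ≤ 1 / 2 := by
        rw [mul_one_div, div_le_div_iff₀ (by positivity) (by norm_num)]
        linarith
  set S := (fun r => A.mollify r w y) '' Icc ε R
  have hSne : S.Nonempty := ⟨_, mem_image_of_mem _ ⟨le_rfl, hR⟩⟩
  have hI : 0 ≤ ∫ x, w x := integral_nonneg hw0
  have hSb : BddAbove S := by
    refine ⟨C' / ε ^ 2 * ∫ x, w x, ?_⟩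
    rintro _ ⟨r, hr, rfl⟩
    refine (h' r (hε.trans_le hr.1) w hw hw0 y).trans ?_
    gcongr
    exact hr.1
  have hle (r : ℝ) (hr : r ∈ Icc ε R) : A.mollify r w y ≤ sSup S :=
    le_csSup hSb (mem_image_of_mem _ hr)
  have hS0 : 0 ≤ sSup S := (mollify_nonneg hw0 y).trans (hle ε ⟨le_rfl, hR⟩)
  have key : sSup S ≤ 2 * A.mollify R w y + b / 2 := by
    have : sSup S ≤ A.mollify R w y + b / 4 + sSup S / 8 := by
      refine csSup_le hSne ?_
      rintro _ ⟨r, hr, rfl⟩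
      have h1 := h r R (hε.trans_le hr.1) hr.2 e1 w hw hw0 y (sSup S)
        fun r' hr' => hle r' ⟨hr.1.trans hr'.1, hr'.2⟩
      have h2 := hb r hr
      have h3 := (abs_le.1 h1).2
      have : C * R * sSup S ≤ 1 / 2 * sSup S := by gcongr
      simp only
      linarith
    have h0 := mollify_nonneg (A := A) (ε := R) hw0 y
    linarith
  exact ⟨(hle ε ⟨le_rfl, hR⟩).trans key, h ε R hε hR e1 w hw hw0 y _
    fun r hr => (hle r hr).trans key⟩

/-- Nonnegative functions with `L w ≥ -H` are locally bounded. -/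
theorem WeakGE.exists_ae_le {Ω : Set Plane} {w : Plane → ℝ} {H : ℝ} (hH : 0 ≤ H)
    (hw : Integrable w) (hw0 : ∀ x, 0 ≤ w x) (hL : A.WeakGE Ω w fun _ => -H) {y₀ : Plane} {δ : ℝ}
    (hδ : 0 < δ) (hδΩ : Metric.closedBall y₀ δ ⊆ Ω) :
    ∃ C : ℝ, ∀ᵐ y, y ∈ Metric.ball y₀ (δ / 2) → w y ≤ C := by
  obtain ⟨C, R₀, hC, hR₀, hR1, -, h⟩ := exists_mollify_le_mollify A
  obtain ⟨C', hC', h'⟩ := exists_mollify_le A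
  obtain ⟨C'', hC'', hg⟩ := exists_integral_green_le A
  obtain ⟨e, he0, he, hae⟩ := exists_seq_tendsto_mollify A hw
  have hT := A.ell_pos
  set R := min R₀ (δ / (2 * A.ell)) with hR
  have hR0 : 0 < R := by positivity
  have hRe : A.ell * R ≤ 1 := (mul_le_mul_of_nonneg_left (min_le_left _ _) hT.le).trans hR1
  have hRδ : A.ell * R ≤ δ / 2 := by
    calc _ ≤ A.ell * (δ / (2 * A.ell)) := by gcongr; exact min_le_right _ _
      _ = _ := by field_simp
  refine ⟨2 * (C' / R ^ 2 * ∫ x, w x) + H * (C'' * R) / 2, ?_⟩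
  filter_upwards [hae] with y hy hyB
  refine le_of_tendsto hy ?_
  have he' := (tendsto_nhdsWithin_iff.1 he).1
  filter_upwards [he'.eventually (Iio_mem_nhds hR0)] with n hn
  have hsub : Metric.closedBall y (A.ell * R) ⊆ Ω := by
    refine Subset.trans (Metric.closedBall_subset_closedBall' ?_) hδΩ
    have := Metric.mem_ball.1 hyB
    linarith
  refine ((h (e n) R (he0 n) (le_of_lt hn) (min_le_left _ _) w hw hw0 y (H * (C'' * R))
    fun r hr => ?_).1).trans ?_
  · have hr0 := (he0 n).trans_le hr.1
    refine le_trans ?_ (hL _ (contDiff_green hr0 hr.2 y) (hasCompactSupport_green hr0 hr.2 y)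
      ((tsupport_green hr0 hr.2 y).trans hsub) fun x => green_nonneg hr0 hr.2 x y)
    rw [integral_const_mul]
    have := mul_le_mul_of_nonneg_left (hg r R hr0 hr.2 hRe y) hH
    linarith
  · have := h' R hR0 w hw hw0 y
    linarith

end Coeff

end VortexSystem

namespace VortexSystem

namespace Coeff

variable {A : Coeff} {ε R : ℝ}

lemma integrable_mul_op {w : Plane → ℝ} (hw : Integrable w) {φ : Plane → ℝ} (hφ : ContDiff ℝ ∞ φ)
    (hφc : HasCompactSupport φ) : Integrable fun x => w x * A.op φ x := by
  have hs := (contDiff_op (A := A) hφ).continuous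
  obtain ⟨K, hK⟩ := (hasCompactSupport_op (A := A) hφc).exists_bound_of_continuous hs
  exact hw.mul_bdd (c := K) hs.aestronglyMeasurable (Filter.Eventually.of_forall hK)

/-- For bounded functions the means at two scales `ε ≤ R` differ by `O(R)`. -/
lemma exists_mollify_sub_le (A : Coeff) : ∃ C : ℝ, 0 ≤ C ∧ ∀ ε R : ℝ, 0 < ε → ε ≤ R →
    A.ell * R ≤ 1 → ∀ (w : Plane → ℝ) (B : ℝ), Integrable w → (∀ᵐ x, |w x| ≤ B) → ∀ y,
      |(∫ x, w x * A.op (A.green ε R y) x) + 4 * A.mollify ε w y - 4 * A.mollify R w y|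
        ≤ C * R * B := by
  obtain ⟨C, hC, h⟩ := exists_integral_mul_op_green_le A
  obtain ⟨K, hK, hk⟩ := exists_integral_kernel_le A
  refine ⟨C * K + C * K, by positivity, fun ε R hε hR hR1 w B hw hB y => ?_⟩
  have hR0 := hε.trans_le hR
  have hB0 : 0 ≤ B := by
    obtain ⟨x, hx⟩ := hB.exists
    exact (abs_nonneg _).trans hx
  have hbd (v : Plane → ℝ) (hv : Integrable v) (hvB : ∀ᵐ x, v x ≤ B) (r : ℝ) (hr : 0 < r) :
      A.mollify r v y ≤ B * K := by
    calc A.mollify r v y ≤ ∫ x, B * A.kernel r y x := by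
          refine integral_mono_ae (integrable_mul_kernel hv y) ((integrable_kernel hr y).const_mul _)
            ?_
          filter_upwards [hvB] with x hx
          exact mul_le_mul_of_nonneg_right hx (kernel_nonneg _ _)
      _ ≤ B * K := by
          rw [integral_const_mul]
          exact mul_le_mul_of_nonneg_left (hk r hr y) hB0
  have i1 : Integrable fun x => max (w x) 0 := hw.pos_part
  have i2 : Integrable fun x => max (-w x) 0 := hw.neg_part
  have h1 := h ε R hε hR hR1 _ i1 (fun x => le_max_right _ _) y (B * K) fun r hr =>
    hbd _ i1 (by filter_upwards [hB] with x hx using max_le ((le_abs_self _).trans hx) hB0) r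
      (hε.trans_le hr.1)
  have h2 := h ε R hε hR hR1 _ i2 (fun x => le_max_right _ _) y (B * K) fun r hr =>
    hbd _ i2 (by filter_upwards [hB] with x hx using max_le ((neg_le_abs _).trans hx) hB0) r
      (hε.trans_le hr.1)
  have e0 : w = fun x => max (w x) 0 - max (-w x) 0 := by
    funext x
    rcases le_total (w x) 0 with h | h
    · rw [max_eq_right h, max_eq_left (neg_nonneg.2 h)]; ring
    · rw [max_eq_left h, max_eq_right (neg_nonpos.2 h)]; ring
  have e1 : ∫ x, w x * A.op (A.green ε R y) x
      = (∫ x, max (w x) 0 * A.op (A.green ε R y) x)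
        - ∫ x, max (-w x) 0 * A.op (A.green ε R y) x := by
    rw [← integral_sub (integrable_mul_op i1 (contDiff_green hε hR y)
      (hasCompactSupport_green hε hR y)) (integrable_mul_op i2 (contDiff_green hε hR y)
      (hasCompactSupport_green hε hR y))]
    congr 1
    funext x
    rw [← sub_mul]
    congr 1
    exact congrFun e0 x
  have e2 (r : ℝ) : A.mollify r w y
      = A.mollify r (fun x => max (w x) 0) y - A.mollify r (fun x => max (-w x) 0) y := by
    rw [← mollify_sub i1 i2, ← e0]
  rw [e1, e2, e2]
  have a1 := abs_le.1 h1
  have a2 := abs_le.1 h2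
  rw [abs_le]
  constructor <;> linarith [a1.1, a1.2, a2.1, a2.2]

/-- Bounded functions with bounded `L w` are continuous: by the mean value formula the
mollifications converge uniformly. -/
theorem WeakGE.exists_continuousOn {Ω : Set Plane} {w : Plane → ℝ} {H B : ℝ} (hH : 0 ≤ H)
    (hw : Integrable w) (hB : ∀ᵐ x, |w x| ≤ B) (hL : A.WeakGE Ω w fun _ => -H)
    (hL' : A.WeakGE Ω (fun x => -w x) fun _ => -H) {y₀ : Plane} {δ : ℝ}
    (hδ : 0 < δ) (hδΩ : Metric.closedBall y₀ δ ⊆ Ω) :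
    ∃ V : Plane → ℝ, ContinuousOn V (Metric.ball y₀ (δ / 2)) ∧
      ∀ᵐ y, y ∈ Metric.ball y₀ (δ / 2) → w y = V y := by
  obtain ⟨C, hC, h⟩ := exists_mollify_sub_le A
  obtain ⟨C', hC', hg⟩ := exists_integral_green_le A
  obtain ⟨e, he0, he, hae⟩ := exists_seq_tendsto_mollify A hw
  have hT := A.ell_pos
  have hB0 : 0 ≤ B := by
    obtain ⟨x, hx⟩ := hB.exists
    exact (abs_nonneg _).trans hx
  set R₀ := min (1 / A.ell) (δ / (2 * A.ell)) with hR
  have hR0 : 0 < R₀ := by positivity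
  have he' := (tendsto_nhdsWithin_iff.1 he).1
  -- uniform comparison of two scales
  have key (ε R : ℝ) (hε : 0 < ε) (hεR : ε ≤ R) (hRR : R ≤ R₀) (y : Plane)
      (hy : y ∈ Metric.ball y₀ (δ / 2)) :
      |A.mollify ε w y - A.mollify R w y| ≤ (C * B + H * C') * R := by
    have hRe : A.ell * R ≤ 1 := by
      calc _ ≤ A.ell * (1 / A.ell) := by gcongr; exact hRR.trans (min_le_left _ _)
        _ = _ := by field_simp
    have hRδ : A.ell * R ≤ δ / 2 := by
      calc _ ≤ A.ell * (δ / (2 * A.ell)) := by gcongr; exact hRR.trans (min_le_right _ _)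
        _ = _ := by field_simp
    have hsub : Metric.closedBall y (A.ell * R) ⊆ Ω := by
      refine Subset.trans (Metric.closedBall_subset_closedBall' ?_) hδΩ
      have := Metric.mem_ball.1 hy
      linarith
    have h0 := abs_le.1 (h ε R hε hεR hRe w B hw hB y)
    have h1 := hL _ (contDiff_green hε hεR y) (hasCompactSupport_green hε hεR y)
      ((tsupport_green hε hεR y).trans hsub) fun x => green_nonneg hε hεR x y
    have h2 := hL' _ (contDiff_green hε hεR y) (hasCompactSupport_green hε hεR y)
      ((tsupport_green hε hεR y).trans hsub) fun x => green_nonneg hε hεR x y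
    simp only [neg_mul, integral_neg] at h1 h2
    rw [integral_const_mul] at h1 h2
    have h3 := mul_le_mul_of_nonneg_left (hg ε R hε hεR hRe y) hH
    have hR0 := hε.trans_le hεR
    have h4 : 0 ≤ C * R * B := by positivity
    have h5 : 0 ≤ H * (C' * R) := by positivity
    rw [abs_le]
    constructor <;> linarith [h0.1, h0.2]
  have hcauchy : UniformCauchySeqOn (fun n y => A.mollify (e n) w y) Filter.atTop
      (Metric.ball y₀ (δ / 2)) := by
    rw [Metric.uniformCauchySeqOn_iff]
    intro κ hκ
    have hlim : Filter.Tendsto (fun n => (C * B + H * C') * e n) Filter.atTop (nhds 0) := by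
      simpa using he'.const_mul (C * B + H * C')
    obtain ⟨N, hN⟩ := Filter.eventually_atTop.1
      ((hlim.eventually (Iio_mem_nhds hκ)).and (he'.eventually (Iio_mem_nhds hR0)))
    refine ⟨N, fun m hm n hn y hy => ?_⟩
    rw [Real.dist_eq]
    rcases le_total (e m) (e n) with hmn | hmn
    · exact (key _ _ (he0 m) hmn (le_of_lt (hN n hn).2) y hy).trans_lt (hN n hn).1
    · rw [abs_sub_comm]
      exact (key _ _ (he0 n) hmn (le_of_lt (hN m hm).2) y hy).trans_lt (hN m hm).1
  have hlim (y : Plane) : ∃ l, y ∈ Metric.ball y₀ (δ / 2) →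
      Filter.Tendsto (fun n => A.mollify (e n) w y) Filter.atTop (nhds l) := by
    by_cases hy : y ∈ Metric.ball y₀ (δ / 2)
    · obtain ⟨l, hl⟩ := cauchySeq_tendsto_of_complete (hcauchy.cauchySeq hy)
      exact ⟨l, fun _ => hl⟩
    · exact ⟨0, fun h => absurd h hy⟩
  choose V hpt using hlim
  refine ⟨V, (hcauchy.tendstoUniformlyOn_of_tendsto hpt).continuousOn (Filter.Frequently.of_forall
    fun n => (contDiff_mollify (he0 n) hw).continuous.continuousOn), ?_⟩
  filter_upwards [hae] with y hy hyB
  exact tendsto_nhds_unique hy (hpt y hyB)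

/-! ### Point masses and the maximum principle -/

/-- A nonnegative function whose `L w` has a negative point mass is unbounded near that point. -/
theorem exists_ae_ge_of_dirac {Ω : Set Plane} {w : Plane → ℝ} {H c : ℝ} (hH : 0 ≤ H) (hc : 0 < c)
    (hw : Integrable w) (hw0 : ∀ x, 0 ≤ w x) {y₀ : Plane}
    (hL : ∀ φ : Plane → ℝ, ContDiff ℝ ∞ φ → HasCompactSupport φ → tsupport φ ⊆ Ω → (∀ y, 0 ≤ φ y) →
      |(∫ y, w y * A.op φ y) + c * φ y₀| ≤ H * ∫ y, φ y)
    {δ : ℝ} (hδ : 0 < δ) (hδΩ : Metric.closedBall y₀ δ ⊆ Ω) (K : ℝ) :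
    ∃ r : ℝ, 0 < r ∧ ∀ᵐ y, y ∈ Metric.ball y₀ r → K ≤ w y := by
  obtain ⟨C, R₀, hC, hR₀, hR1, hCR, h⟩ := exists_mollify_le_mollify A
  obtain ⟨C'', hC'', hg⟩ := exists_integral_green_le A
  obtain ⟨e, he0, he, hae⟩ := exists_seq_tendsto_mollify A hw
  have hT := A.ell_pos
  have hΘ := etaInt_one_pos
  set R := min R₀ (δ / (2 * A.ell)) with hR
  have hR0 : 0 < R := by positivity
  have hCR' : C * R ≤ 1 / 2 := (mul_le_mul_of_nonneg_left (min_le_left _ _) hC).trans hCR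
  have hRe : A.ell * R ≤ 1 := (mul_le_mul_of_nonneg_left (min_le_left _ _) hT.le).trans hR1
  have hRδ : A.ell * R ≤ δ / 2 := by
    calc _ ≤ A.ell * (δ / (2 * A.ell)) := by gcongr; exact min_le_right _ _
      _ = _ := by field_simp
  have he' := (tendsto_nhdsWithin_iff.1 he).1
  have key (ε : ℝ) (hε : 0 < ε) (hεR : ε ≤ R) (y : Plane) (hy : y ∈ Metric.ball y₀ (δ / 2)) :
      c / 8 * A.green ε R y y₀ - H * (C'' * R) ≤ A.mollify ε w y := by
    have hsub : Metric.closedBall y (A.ell * R) ⊆ Ω := by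
      refine Subset.trans (Metric.closedBall_subset_closedBall' ?_) hδΩ
      have := Metric.mem_ball.1 hy
      linarith
    have hgr (r : ℝ) (hr : r ∈ Icc ε R) :
        |(∫ x, w x * A.op (A.green r R y) x) + c * A.green r R y y₀| ≤ H * (C'' * R) := by
      have hr0 := hε.trans_le hr.1
      exact (hL _ (contDiff_green hr0 hr.2 y) (hasCompactSupport_green hr0 hr.2 y)
        ((tsupport_green hr0 hr.2 y).trans hsub) fun x => green_nonneg hr0 hr.2 x y).trans
        (mul_le_mul_of_nonneg_left (hg r R hr0 hr.2 hRe y) hH)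
    have h1 := (h ε R hε hεR (min_le_left _ _) w hw hw0 y
      (H * (C'' * R) + c * A.green ε R y y₀) fun r hr => by
        have := (abs_le.1 (hgr r hr)).1
        have := mul_le_mul_of_nonneg_left (green_anti (A := A) hε hr.1 hr.2 y₀ y) hc.le
        linarith).2
    have h2 := (abs_le.1 (hgr ε ⟨le_rfl, hεR⟩)).2
    have h3 := mollify_nonneg (A := A) (ε := R) hw0 y
    have h4 : 0 ≤ c * A.green ε R y y₀ := mul_nonneg hc.le (green_nonneg hε hεR _ _)
    have h6 : 0 ≤ H * (C'' * R) := by positivity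
    have h5 : C * R * (2 * A.mollify R w y + (H * (C'' * R) + c * A.green ε R y y₀) / 2)
        ≤ 1 / 2 * (2 * A.mollify R w y + (H * (C'' * R) + c * A.green ε R y y₀) / 2) :=
      mul_le_mul_of_nonneg_right hCR' (by linarith)
    have := (abs_le.1 h1).1
    linarith
  -- where the logarithm is so large that the lower bound exceeds `K`
  set Q : ℝ := (K + H * (C'' * R)) / (c / 8 * etaInt 1)
  set r := min (δ / 2) (Real.sqrt (R ^ 2 / 2 / A.ell / Real.exp (max Q 0)))
  refine ⟨r, by positivity, ?_⟩
  have hne : ∀ᵐ y : Plane, y ≠ y₀ := by simp [ae_iff]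
  filter_upwards [hae, hne] with y hy hyy hyB
  have hyδ : y ∈ Metric.ball y₀ (δ / 2) := Metric.ball_subset_ball (min_le_left _ _) hyB
  have hρ := A.rho_pos hyy
  have hρ2 : A.rho y₀ y ≤ R ^ 2 / 2 / Real.exp (max Q 0) := by
    have h1 : ‖y - y₀‖ ≤ Real.sqrt (R ^ 2 / 2 / A.ell / Real.exp (max Q 0)) := by
      rw [← dist_eq_norm]
      exact (le_of_lt hyB).trans (min_le_right _ _)
    calc A.rho y₀ y ≤ A.ell * ‖y - y₀‖ ^ 2 := A.rho_le _ _
      _ ≤ A.ell * (R ^ 2 / 2 / A.ell / Real.exp (max Q 0)) := by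
        gcongr
        calc _ ≤ Real.sqrt (R ^ 2 / 2 / A.ell / Real.exp (max Q 0)) ^ 2 := by gcongr
          _ = _ := Real.sq_sqrt (by positivity)
      _ = _ := by field_simp
  have hlog : Q ≤ Real.log (R ^ 2 / 2 / A.rho y₀ y) := by
    refine (le_max_left Q 0).trans ?_
    rw [Real.le_log_iff_exp_le (by positivity), le_div_iff₀ hρ]
    rw [le_div_iff₀ (Real.exp_pos _)] at hρ2
    linarith
  refine ge_of_tendsto hy ?_
  filter_upwards [he'.eventually (Iio_mem_nhds hR0),
    he'.eventually (Iio_mem_nhds (Real.sqrt_pos.2 hρ))] with n hn hn'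
  refine le_trans ?_ (key (e n) (he0 n) (le_of_lt hn) y hyδ)
  have hg1 : etaInt 1 * Real.log (R ^ 2 / 2 / A.rho y₀ y) ≤ A.green (e n) R y y₀ := by
    rw [green_comm]
    refine le_logProfile (he0 n) (le_of_lt hn) ?_ ?_
    · rw [← Real.sq_sqrt hρ.le]
      have := he0 n
      have := le_of_lt hn'
      gcongr
    · refine hρ2.trans (div_le_self (by positivity) (Real.one_le_exp (le_max_right _ _)))
  have hQ : Q * (c / 8 * etaInt 1) = K + H * (C'' * R) :=
    div_mul_cancel₀ _ (by positivity)
  have h1 : c / 8 * (etaInt 1 * Q) ≤ c / 8 * A.green (e n) R y y₀ := by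
    gcongr
    exact (mul_le_mul_of_nonneg_left hlog hΘ.le).trans hg1
  linarith

lemma integral_green_pos (hR : 0 < R) (y : Plane) : 0 < ∫ x, A.green (R / 2) R y x := by
  have hT := A.ell_pos
  have hε : 0 < R / 2 := by positivity
  have hεR : R / 2 ≤ R := by linarith
  have hc := (contDiff_green (A := A) hε hεR y).continuous
  refine integral_pos_of_integrable_nonneg_nonzero (x := y) hc (integrable_green hε hεR y)
    (fun x => green_nonneg hε hεR x y) (ne_of_gt ?_)
  have hanti : Antitone (logProfile (R / 2) R) := by
    refine antitone_of_deriv_nonpos ((contDiff_logProfile hε hεR).differentiable (by simp))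
      fun s => ?_
    rw [deriv_logProfile hε hεR]
    exact neg_nonpos.2 (logDensity_nonneg hε hεR s)
  have h0 : A.rho y y ≤ R ^ 2 / 4 := (A.rho_le y y).trans (by simp; positivity)
  refine lt_of_lt_of_le ?_ (hanti h0)
  refine lt_of_lt_of_le ?_ (le_logProfile hε hεR (by linarith) (by linarith [pow_pos hR 2]))
  refine mul_pos etaInt_one_pos (Real.log_pos ?_)
  rw [lt_div_iff₀ (by positivity)]
  linarith [pow_pos hR 2]

lemma mollify_le_of_le {K κ : ℝ} (hK : ∀ ε : ℝ, 0 < ε → ∀ y, ∫ x, A.kernel ε y x ≤ K)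
    (hε : 0 < ε) (hκ : 0 ≤ κ) {w : Plane → ℝ} (hw : Integrable w) {y : Plane}
    (h : ∀ x ∈ Metric.closedBall y (A.ell * ε), w x ≤ κ) : A.mollify ε w y ≤ κ * K := by
  calc A.mollify ε w y ≤ ∫ x, κ * A.kernel ε y x := by
        refine integral_mono (integrable_mul_kernel hw y) ((integrable_kernel hε y).const_mul _)
          fun x => ?_
        by_cases hx : x ∈ Metric.closedBall y (A.ell * ε)
        · exact mul_le_mul_of_nonneg_right (h x hx) (kernel_nonneg _ _)
        · rw [Metric.mem_closedBall, not_le, dist_eq_norm] at hx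
          simp [kernel_eq_zero hε hx]
    _ ≤ κ * K := by
        rw [integral_const_mul]
        exact mul_le_mul_of_nonneg_left (hK ε hε y) hκ

/-- A strict maximum principle: a nonnegative function with `L z ≤ -δ < 0` does not vanish at a point
where it is continuous. By the mean value formula, all means of `z` about such a point would vanish,
which leaves nothing to compensate for the positive integral of the Green function against `δ`. -/
theorem not_weakGE_of_eq_zero {Ω : Set Plane} {z : Plane → ℝ} {δ : ℝ} (hδ : 0 < δ)
    (hz : Integrable z) (hz0 : ∀ x, 0 ≤ z x) {y₀ : Plane} (hΩ : Ω ∈ nhds y₀)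
    (hc : ContinuousAt z y₀) (hy₀ : z y₀ = 0) (hL : A.WeakGE Ω (fun x => -z x) fun _ => δ) :
    False := by
  obtain ⟨C, hC, h⟩ := exists_integral_mul_op_green_le A
  obtain ⟨K, hK0, hK⟩ := exists_integral_kernel_le A
  have hT := A.ell_pos
  -- `z` has small means at small scales
  have hsmall (κ : ℝ) (hκ : 0 < κ) : ∃ r : ℝ, 0 < r ∧ ∀ ε, 0 < ε → ε ≤ r →
      A.mollify ε z y₀ ≤ κ * K := by
    obtain ⟨r, hr, hr'⟩ := Metric.eventually_nhds_iff_ball.1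
      (hc.eventually (Iio_mem_nhds (hy₀ ▸ hκ : z y₀ < κ)))
    refine ⟨r / (2 * A.ell), by positivity, fun ε hε hεr => mollify_le_of_le hK hε hκ.le hz
      fun x hx => le_of_lt (hr' x ?_)⟩
    have h1 : A.ell * ε ≤ r / 2 := by
      calc _ ≤ A.ell * (r / (2 * A.ell)) := by gcongr
        _ = _ := by field_simp
    have := Metric.mem_closedBall.1 hx
    rw [Metric.mem_ball]
    linarith
  obtain ⟨r₁, hr₁, hr₁'⟩ := hsmall 1 one_pos
  obtain ⟨r₂, hr₂, hr₂'⟩ := Metric.mem_nhds_iff.1 hΩ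
  set R := min (min r₁ (1 / A.ell)) (min (r₂ / (2 * A.ell)) (1 / (C + 1)))
  have hR : 0 < R := by positivity
  have hR1 : R ≤ r₁ := (min_le_left _ _).trans (min_le_left _ _)
  have hRe : A.ell * R ≤ 1 := by
    calc _ ≤ A.ell * (1 / A.ell) := by gcongr; exact (min_le_left _ _).trans (min_le_right _ _)
      _ = _ := by field_simp
  have hRr : A.ell * R ≤ r₂ / 2 := by
    calc _ ≤ A.ell * (r₂ / (2 * A.ell)) := by
          gcongr; exact (min_le_right _ _).trans (min_le_left _ _)
      _ = _ := by field_simp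
  have hCR : C * R ≤ 1 := by
    calc _ ≤ C * (1 / (C + 1)) := by gcongr; exact (min_le_right _ _).trans (min_le_right _ _)
      _ ≤ 1 := by rw [mul_one_div, div_le_one (by positivity)]; linarith
  set S := (fun r => A.mollify r z y₀) '' Ioc 0 R
  have hSb : BddAbove S := by
    refine ⟨1 * K, ?_⟩
    rintro _ ⟨r, hr, rfl⟩
    exact hr₁' r hr.1 (hr.2.trans hR1)
  have hle (r : ℝ) (hr : r ∈ Ioc 0 R) : A.mollify r z y₀ ≤ sSup S :=
    le_csSup hSb (mem_image_of_mem _ hr)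
  have hS0 : 0 ≤ sSup S := (mollify_nonneg hz0 y₀).trans (hle R ⟨hR, le_rfl⟩)
  have key (ε r : ℝ) (hε : 0 < ε) (hεr : ε ≤ r) (hr : r ≤ R) :
      4 * A.mollify r z y₀ + δ * ∫ x, A.green ε r y₀ x ≤ 4 * A.mollify ε z y₀ + sSup S := by
    have hre : A.ell * r ≤ A.ell * R := by gcongr
    have h1 := (abs_le.1 (h ε r hε hεr (hre.trans hRe) z hz hz0 y₀ (sSup S)
      fun r' hr' => hle r' ⟨hε.trans_le hr'.1, hr'.2.trans hr⟩)).1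
    have hsub : Metric.closedBall y₀ (A.ell * r) ⊆ Ω := fun x hx => by
      refine hr₂' ?_
      have := Metric.mem_closedBall.1 hx
      rw [Metric.mem_ball]
      linarith
    have h2 := hL _ (contDiff_green hε hεr y₀) (hasCompactSupport_green hε hεr y₀)
      ((tsupport_green hε hεr y₀).trans hsub) fun x => green_nonneg hε hεr x y₀
    simp only [neg_mul, integral_neg] at h2
    rw [integral_const_mul] at h2
    have h3 : C * r * sSup S ≤ 1 * sSup S := by
      gcongr
      exact (mul_le_mul_of_nonneg_left hr hC).trans hCR
    linarith
  have hS : sSup S ≤ 0 := by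
    have : sSup S ≤ sSup S / 4 := by
      refine csSup_le ⟨_, mem_image_of_mem _ ⟨hR, le_rfl⟩⟩ ?_
      rintro _ ⟨r, hr, rfl⟩
      refine le_of_forall_pos_le_add fun κ hκ => ?_
      obtain ⟨ε₁, hε₁, hε₁'⟩ := hsmall (κ / (K + 1)) (by positivity)
      have hε : 0 < min ε₁ r := lt_min hε₁ hr.1
      have h1 := key (min ε₁ r) r hε (min_le_right _ _) hr.2
      have h2 := hε₁' _ hε (min_le_left _ _)
      have h3 : 0 ≤ δ * ∫ x, A.green (min ε₁ r) r y₀ x :=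
        mul_nonneg hδ.le (integral_nonneg fun x => green_nonneg hε (min_le_right _ _) x y₀)
      have h4 : κ / (K + 1) * K ≤ κ := by
        rw [div_mul_eq_mul_div, div_le_iff₀ (by positivity)]
        nlinarith
      simp only
      linarith
    linarith
  have h1 := key (R / 2) R (by positivity) (by linarith) le_rfl
  have h2 := hle (R / 2) ⟨by positivity, by linarith⟩
  have h3 := mul_pos hδ (integral_green_pos (A := A) hR y₀)
  have h4 := mollify_nonneg (A := A) (ε := R) hz0 y₀
  linarith

end Coeff

end VortexSystem

namespace VortexSystem

/-! ### The Laplace-Beltrami operator in a chart -/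

/-- Locally, coefficients of determinant one extend to the whole plane: `a` and `b` are interpolated
with those of the identity matrix, and `c = (1 + b²) / a` is then determined. -/
lemma exists_coeff_extension {Ω : Set Plane} (hΩ : IsOpen Ω) {a b c : Plane → ℝ}
    (ha : ContDiffOn ℝ ∞ a Ω) (hb : ContDiffOn ℝ ∞ b Ω) (ha0 : ∀ y ∈ Ω, 0 < a y)
    (hdet : ∀ y ∈ Ω, a y * c y - b y ^ 2 = 1) {y₀ : Plane} (hy₀ : y₀ ∈ Ω) :
    ∃ (A : Coeff) (δ : ℝ), 0 < δ ∧ Metric.closedBall y₀ δ ⊆ Ω ∧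
      ∀ y ∈ Metric.closedBall y₀ δ, A.a y = a y ∧ A.b y = b y ∧ A.c y = c y := by
  obtain ⟨r, hr, hrΩ⟩ := Metric.isOpen_iff.1 hΩ y₀ hy₀
  let χ : ContDiffBump y₀ := ⟨r / 4, r / 2, by positivity, by linarith⟩
  have hχs : tsupport χ ⊆ Ω := by
    rw [χ.tsupport_eq]
    exact (Metric.closedBall_subset_ball (show r / 2 < r by linarith)).trans hrΩ
  have hχ : ContDiff ℝ ∞ χ := χ.contDiff
  have hχ0 {y : Plane} (hy : y ∉ Ω) : χ y = 0 := image_eq_zero_of_notMem_tsupport fun h => hy (hχs h)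
  have hext {f : Plane → ℝ} (hf : ContDiffOn ℝ ∞ f Ω) : ContDiff ℝ ∞ fun y => χ y * f y := by
    rw [contDiff_iff_contDiffAt]
    intro y
    by_cases hy : y ∈ Ω
    · exact hχ.contDiffAt.mul (hf.contDiffAt (hΩ.mem_nhds hy))
    · have hy' : (tsupport χ)ᶜ ∈ nhds y :=
        (isClosed_tsupport _).isOpen_compl.mem_nhds fun h => hy (hχs h)
      refine (contDiffAt_const (c := (0 : ℝ))).congr_of_eventuallyEq ?_
      filter_upwards [hy'] with z hz
      rw [image_eq_zero_of_notMem_tsupport hz, zero_mul]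
  have hcs {f : Plane → ℝ} : HasCompactSupport fun y => χ y * f y := χ.hasCompactSupport.mul_right
  have ha' : ContDiff ℝ ∞ fun y => χ y * (a y - 1) + 1 := (hext (ha.sub contDiffOn_const)).add
    contDiff_const
  have ha0' (y : Plane) : 0 < χ y * (a y - 1) + 1 := by
    by_cases hy : y ∈ Ω
    · have h0 := χ.nonneg (x := y)
      have h1 := χ.le_one (x := y)
      have h2 := ha0 y hy
      rcases h0.eq_or_lt with h | h
      · rw [← h]; norm_num
      · nlinarith [mul_pos h h2]
    · rw [hχ0 hy]; norm_num
  refine ⟨{ a := fun y => χ y * (a y - 1) + 1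
            b := fun y => χ y * b y
            c := fun y => (1 + (χ y * b y) ^ 2) / (χ y * (a y - 1) + 1)
            smooth_a := ha'
            smooth_b := hext hb
            smooth_c := (contDiff_const.add ((hext hb).pow 2)).div ha' fun y => (ha0' y).ne'
            pos_a := ha0'
            det_eq_one := fun y => by rw [mul_div_cancel₀ _ (ha0' y).ne']; ring
            compact_a := by simpa using hcs
            compact_b := hcs
            compact_c := ?_ }, r / 4, by positivity,
    (Metric.closedBall_subset_ball (by linarith)).trans hrΩ, fun y hy => ?_⟩
  · refine HasCompactSupport.intro χ.hasCompactSupport fun y hy => ?_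
    rw [image_eq_zero_of_notMem_tsupport hy]
    norm_num
  · have h1 : χ y = 1 := χ.one_of_mem_closedBall hy
    have hy' : y ∈ Ω := hrΩ (Metric.closedBall_subset_ball (by linarith) hy)
    have h0 := ha0 y hy'
    refine ⟨?_, ?_, ?_⟩
    · simp [h1]
    · simp [h1]
    · simp only [h1]
      rw [div_eq_iff (by linarith)]
      linarith [hdet y hy']

section Chart

variable {M : Type*} [TopologicalSpace M] [ChartedSpace Plane M] [IsManifold (𝓡 2) ∞ M]
  {e : OpenPartialHomeomorph M Plane}

lemma contMDiffOn_coordVector (he : e ∈ atlas Plane M) (i : Fin 2) :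
    ContMDiffOn 𝓘(ℝ, Plane) ((𝓡 2).prod 𝓘(ℝ, Plane)) ∞
      (fun y => (TotalSpace.mk' Plane (e.symm y) (coordVector e i y) :
        TangentBundle (𝓡 2) M)) e.target := by
  have he' : e ∈ IsManifold.maximalAtlas (𝓡 2) ∞ M := IsManifold.subset_maximalAtlas he
  have h1 : ContMDiffOn 𝓘(ℝ, Plane) (𝓡 2) ∞ e.symm e.target :=
    contMDiffOn_symm_of_mem_maximalAtlas he'
  have h2 := h1.contMDiffOn_tangentMapWithin (m := ∞) (by simp) e.open_target.uniqueMDiffOn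
  have h3 : ContMDiffOn 𝓘(ℝ, Plane) (𝓘(ℝ, Plane).prod 𝓘(ℝ, Plane)) ∞
      (fun y : Plane => (TotalSpace.mk' Plane y (EuclideanSpace.single i (1 : ℝ) : Plane) :
        TangentBundle 𝓘(ℝ, Plane) Plane)) e.target := by
    intro y hy
    exact contMDiffWithinAt_vectorSpace_iff_contDiffWithinAt.2 contDiffWithinAt_const
  refine (h2.comp h3 fun y hy => hy).congr fun y hy => ?_
  simp only [Function.comp, tangentMapWithin, coordVector]
  rw [mfderivWithin_eq_mfderiv (e.open_target.uniqueMDiffOn y hy)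
    (h1.contMDiffAt (e.open_target.mem_nhds hy) |>.mdifferentiableAt (by simp))]

lemma contDiffOn_metricMatrix (g : SurfaceMetric M) (he : e ∈ atlas Plane M) (i j : Fin 2) :
    ContDiffOn ℝ ∞ (fun y => metricMatrix g e y i j) e.target := by
  have he' : e ∈ IsManifold.maximalAtlas (𝓡 2) ∞ M := IsManifold.subset_maximalAtlas he
  have h1 : ContMDiffOn 𝓘(ℝ, Plane) (𝓡 2) ∞ e.symm e.target :=
    contMDiffOn_symm_of_mem_maximalAtlas he'
  rw [← contMDiffOn_iff_contDiffOn]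
  intro y hy
  have h2 : ContMDiffWithinAt 𝓘(ℝ, Plane) ((𝓡 2).prod 𝓘(ℝ)) ∞
      (fun y ↦ TotalSpace.mk' ℝ (E := Bundle.Trivial M ℝ) (e.symm y)
        (g.inner (e.symm y) (coordVector e i y) (coordVector e j y))) e.target y := by
    apply ContMDiffWithinAt.clm_bundle_apply₂ (F₁ := Plane) (F₂ := Plane)
      (E₁ := fun x : M => TangentSpace (𝓡 2) x) (E₂ := fun x : M => TangentSpace (𝓡 2) x)
    · exact ContMDiffAt.comp_contMDiffWithinAt y g.contMDiff.contMDiffAt (h1 y hy)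
    · exact contMDiffOn_coordVector he i y hy
    · exact contMDiffOn_coordVector he j y hy
  rw [contMDiffWithinAt_totalSpace] at h2
  exact h2.2

lemma coordVector_combination_ne_zero (he : e ∈ atlas Plane M) {y : Plane} (hy : y ∈ e.target)
    {a b : ℝ} (hab : a ≠ 0 ∨ b ≠ 0) : a • coordVector e 0 y + b • coordVector e 1 y ≠ 0 := by
  have h := (mdifferentiable_of_mem_atlas (I := 𝓡 2) he).symm.mfderiv_bijective hy
  have hl (D : Plane →L[ℝ] Plane) :
      a • D (EuclideanSpace.single 0 (1 : ℝ)) + b • D (EuclideanSpace.single 1 (1 : ℝ))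
        = D (a • EuclideanSpace.single 0 (1 : ℝ) + b • EuclideanSpace.single 1 (1 : ℝ)) := by simp
  have h0 : a • coordVector e 0 y + b • coordVector e 1 y
      = mfderiv 𝓘(ℝ, Plane) (𝓡 2) e.symm y
        (a • EuclideanSpace.single 0 (1 : ℝ) + b • EuclideanSpace.single 1 (1 : ℝ) : Plane) :=
    hl (mfderiv 𝓘(ℝ, Plane) (𝓡 2) e.symm y)
  rw [h0]
  intro hz
  have := h.1 (hz.trans (map_zero _).symm)
  have e0 := congrArg (fun v : Plane => v 0) this
  have e1 := congrArg (fun v : Plane => v 1) this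
  simp at e0 e1
  rcases hab with h | h
  · exact h e0
  · exact h e1

lemma metricMatrix_symm (g : SurfaceMetric M) (y : Plane) :
    metricMatrix g e y 1 0 = metricMatrix g e y 0 1 := g.symm _ _ _

lemma metricMatrix_form (g : SurfaceMetric M) (y : Plane) (a b : ℝ) :
    a ^ 2 * metricMatrix g e y 0 0 + 2 * a * b * metricMatrix g e y 0 1
        + b ^ 2 * metricMatrix g e y 1 1
      = g.inner (e.symm y) (a • coordVector e 0 y + b • coordVector e 1 y)
          (a • coordVector e 0 y + b • coordVector e 1 y) := by
  have hs := metricMatrix_symm (e := e) g y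
  simp only [metricMatrix, Matrix.of_apply] at hs ⊢
  have hl (B : Plane →L[ℝ] Plane →L[ℝ] ℝ) (v w : Plane) (h : B w v = B v w) :
      a ^ 2 * B v v + 2 * a * b * B v w + b ^ 2 * B w w = B (a • v + b • w) (a • v + b • w) := by
    simp only [map_add, map_smul, add_apply, smul_apply,
      smul_eq_mul, h]
    ring
  exact hl (g.inner (e.symm y)) (coordVector e 0 y) (coordVector e 1 y) hs

lemma metricMatrix_pos (g : SurfaceMetric M) (he : e ∈ atlas Plane M) {y : Plane}
    (hy : y ∈ e.target) : 0 < metricMatrix g e y 0 0 ∧ 0 < metricMatrix g e y 1 1 ∧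
      0 < (metricMatrix g e y).det := by
  have h (a b : ℝ) (hab : a ≠ 0 ∨ b ≠ 0) := metricMatrix_form (e := e) g y a b ▸
    g.pos (e.symm y) _ (coordVector_combination_ne_zero he hy hab)
  have h0 := h 1 0 (by simp)
  have h1 := h 0 1 (by simp)
  simp only [one_pow, one_mul, mul_zero, zero_mul, add_zero, ne_eq, OfNat.ofNat_ne_zero,
    not_false_eq_true, zero_pow, zero_add] at h0 h1
  -- the vector `(g₀₁, -g₀₀)`, on which the form is `g₀₀ det g`
  have h2 := h (metricMatrix g e y 0 1) (-metricMatrix g e y 0 0) (Or.inr (neg_ne_zero.2 h0.ne'))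
  refine ⟨h0, h1, ?_⟩
  rw [Matrix.det_fin_two, metricMatrix_symm]
  refine pos_of_mul_pos_right (a := metricMatrix g e y 0 0) ?_ h0.le
  refine h2.trans_eq ?_
  ring

lemma contDiffOn_det (g : SurfaceMetric M) (he : e ∈ atlas Plane M) :
    ContDiffOn ℝ ∞ (fun y => (metricMatrix g e y).det) e.target := by
  simp only [Matrix.det_fin_two]
  exact ((contDiffOn_metricMatrix g he 0 0).mul (contDiffOn_metricMatrix g he 1 1)).sub
    ((contDiffOn_metricMatrix g he 0 1).mul (contDiffOn_metricMatrix g he 1 0))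

lemma contDiffOn_areaDensity (g : SurfaceMetric M) (he : e ∈ atlas Plane M) :
    ContDiffOn ℝ ∞ (areaDensity g e) e.target :=
  (contDiffOn_det g he).sqrt fun _ hy => (metricMatrix_pos g he hy).2.2.ne'

lemma areaDensity_pos (g : SurfaceMetric M) (he : e ∈ atlas Plane M) {y : Plane}
    (hy : y ∈ e.target) : 0 < areaDensity g e y := Real.sqrt_pos.2 (metricMatrix_pos g he hy).2.2

/-- Near each point of a chart, the Laplace-Beltrami operator multiplied by the area density is a
divergence-form operator with coefficients of determinant one on the whole plane. -/
lemma exists_coeff_of_chart (g : SurfaceMetric M) (he : e ∈ atlas Plane M) {y₀ : Plane}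
    (hy₀ : y₀ ∈ e.target) : ∃ (A : Coeff) (δ : ℝ), 0 < δ ∧ Metric.closedBall y₀ δ ⊆ e.target ∧
      ∀ φ : Plane → ℝ, tsupport φ ⊆ Metric.ball y₀ δ → ∀ y ∈ e.target,
        laplaceBeltrami g e φ y * areaDensity g e y = A.op φ y := by
  have hσ := contDiffOn_areaDensity g he
  have hσ0 (y : Plane) (hy : y ∈ e.target) := areaDensity_pos g he hy
  have hm := fun i j => contDiffOn_metricMatrix g he i j
  obtain ⟨A, δ, hδ, hδe, hA⟩ := exists_coeff_extension e.open_target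
    (a := fun y => metricMatrix g e y 1 1 / areaDensity g e y)
    (b := fun y => -metricMatrix g e y 0 1 / areaDensity g e y)
    (c := fun y => metricMatrix g e y 0 0 / areaDensity g e y)
    ((hm 1 1).div hσ fun y hy => (hσ0 y hy).ne') ((hm 0 1).neg.div hσ fun y hy => (hσ0 y hy).ne')
    (fun y hy => div_pos (metricMatrix_pos g he hy).2.1 (hσ0 y hy)) (fun y hy => by
      have h1 : areaDensity g e y ^ 2 = (metricMatrix g e y).det :=
        Real.sq_sqrt (metricMatrix_pos g he hy).2.2.le
      have h2 := (hσ0 y hy).ne'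
      rw [Matrix.det_fin_two, metricMatrix_symm] at h1
      field_simp
      linarith) hy₀
  refine ⟨A, δ, hδ, hδe, fun φ hφ y hy => ?_⟩
  have hflux (z : Plane) (hz : z ∈ Metric.closedBall y₀ δ) (i : Fin 2) :
      areaDensity g e z * ∑ j : Fin 2, (metricMatrix g e z)⁻¹ i j * partialDeriv j φ z
        = if i = 0 then A.flux₀ φ z else A.flux₁ φ z := by
    obtain ⟨ha, hb, hc⟩ := hA z hz
    have h1 : areaDensity g e z ^ 2 = (metricMatrix g e z).det :=
      Real.sq_sqrt (metricMatrix_pos g he (hδe hz)).2.2.le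
    have h2 := (hσ0 z (hδe hz)).ne'
    rw [Matrix.inv_def, Ring.inverse_eq_inv', ← h1, Matrix.adjugate_fin_two]
    fin_cases i
    · simp [Fin.sum_univ_two, Coeff.flux₀, ha, hb]
      field_simp
    · simp [Fin.sum_univ_two, Coeff.flux₁, hb, hc, metricMatrix_symm]
      field_simp
  by_cases hyφ : y ∈ tsupport φ
  · have hyB := hφ hyφ
    have hnear := Metric.isOpen_ball.mem_nhds hyB
    have h1 : (fun z => areaDensity g e z * ∑ j : Fin 2, (metricMatrix g e z)⁻¹ 0 j
        * partialDeriv j φ z) =ᶠ[nhds y] A.flux₀ φ := by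
      filter_upwards [hnear] with z hz
      rw [hflux z (Metric.ball_subset_closedBall hz), if_pos rfl]
    have h2 : (fun z => areaDensity g e z * ∑ j : Fin 2, (metricMatrix g e z)⁻¹ 1 j
        * partialDeriv j φ z) =ᶠ[nhds y] A.flux₁ φ := by
      filter_upwards [hnear] with z hz
      rw [hflux z (Metric.ball_subset_closedBall hz), if_neg (by decide)]
    rw [laplaceBeltrami, Fin.sum_univ_two, partialDeriv_congr h1, partialDeriv_congr h2,
      mul_comm, mul_inv_cancel_left₀ (hσ0 y hy).ne']
    rfl
  · rw [Coeff.op_eq_zero_of_notMem hyφ]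
    have h0 : φ =ᶠ[nhds y] fun _ => 0 := notMem_tsupport_iff_eventuallyEq.1 hyφ
    have h1 (i : Fin 2) : (fun z => areaDensity g e z * ∑ j : Fin 2, (metricMatrix g e z)⁻¹ i j
        * partialDeriv j φ z) =ᶠ[nhds y] fun _ => 0 := by
      filter_upwards [eventuallyEq_partialDeriv (i := 0) h0,
        eventuallyEq_partialDeriv (i := 1) h0] with z h1 h2
      rw [Fin.sum_univ_two, h1, h2, partialDeriv_const, partialDeriv_const]
      simp
    rw [laplaceBeltrami, Fin.sum_univ_two, partialDeriv_congr (h1 0), partialDeriv_congr (h1 1),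
      partialDeriv_const, partialDeriv_const]
    simp

end Chart

end VortexSystem

namespace VortexSystem

/-! ### Essential neighbourhoods and local charts -/

section Essential

variable {M : Type*} [TopologicalSpace M] [ChartedSpace Plane M]

variable (M) in
/-- The filter of the sets with null complement. -/
def almostAll : Filter M where
  sets := {S | AlmostEverywhere fun x => x ∈ S}
  univ_sets := fun _ _ => by simp
  sets_of_superset := fun hS h e he => (hS e he).mono fun _ hy => h hy
  inter_sets := fun hS hT e he => ((hS e he).and (hT e he)).mono fun _ hy => hy

/-- The neighbourhoods of `x` up to null sets: a property holds eventually along this filter if it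
holds almost everywhere in a neighbourhood of `x`. -/
def essNhds (x : M) : Filter M := nhds x ⊓ almostAll M

lemma eventually_essNhds {x : M} {P : M → Prop} : (∀ᶠ z in essNhds x, P z) ↔
    ∃ N ∈ nhds x, AlmostEverywhere fun z => z ∈ N → P z := by
  constructor
  · intro h
    obtain ⟨N, hN, S, hS, hNS⟩ := Filter.mem_inf_iff_superset.1 h
    exact ⟨N, hN, fun e he => (hS e he).mono fun y hy hyN => hNS ⟨hyN, hy⟩⟩
  · rintro ⟨N, hN, h⟩
    exact Filter.mem_inf_iff_superset.2 ⟨N, hN, {z | z ∈ N → P z}, h, fun z hz => hz.2 hz.1⟩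

lemma AlmostEverywhere.essNhds {P : M → Prop} (h : AlmostEverywhere P) (x : M) :
    ∀ᶠ z in essNhds x, P z := Filter.mem_inf_of_right (show {z | P z} ∈ almostAll M from h)

lemma essNhds_le (x : M) : essNhds x ≤ nhds x := inf_le_left

lemma eventually_eventually_essNhds {x : M} {P : M → Prop} (h : ∀ᶠ z in essNhds x, P z) :
    ∀ᶠ z in nhds x, ∀ᶠ z' in essNhds z, P z' := by
  obtain ⟨N, hN, h⟩ := eventually_essNhds.1 h
  filter_upwards [eventually_mem_nhds_iff.2 hN] with z hz using eventually_essNhds.2 ⟨N, hz, h⟩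

variable [IsManifold (𝓡 2) ∞ M]

/-- Null sets are carried to null sets by changes of charts. -/
lemma ae_chart_of_ae_chart {e e' : OpenPartialHomeomorph M Plane} (he : e ∈ atlas Plane M)
    (he' : e' ∈ atlas Plane M) {N : Set M} (hN : N ⊆ e.source) {P : M → Prop}
    (h : ∀ᵐ y, y ∈ e.target → e.symm y ∈ N → P (e.symm y)) :
    ∀ᵐ y ∂(volume.restrict e'.target), e'.symm y ∈ N → P (e'.symm y) := by
  rw [ae_restrict_iff' e'.open_target.measurableSet]
  set B : Set Plane := {y | ¬(y ∈ e.target → e.symm y ∈ N → P (e.symm y))} with hB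
  have hB0 : volume B = 0 := h
  set B₁ := B ∩ (e.target ∩ e.symm ⁻¹' e'.source)
  have hd : DifferentiableOn ℝ (fun y => e' (e.symm y)) B₁ := by
    have h1 : ContMDiffOn 𝓘(ℝ, Plane) (𝓡 2) ∞ e.symm e.target :=
      contMDiffOn_symm_of_mem_maximalAtlas (IsManifold.subset_maximalAtlas he)
    have h2 : ContMDiffOn (𝓡 2) 𝓘(ℝ, Plane) ∞ e' e'.source :=
      contMDiffOn_of_mem_maximalAtlas (IsManifold.subset_maximalAtlas he')
    have h3 := h2.comp (h1.mono (inter_subset_left (t := e.symm ⁻¹' e'.source)))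
      fun y hy => hy.2
    exact ((contMDiffOn_iff_contDiffOn.1 h3).differentiableOn (by simp)).mono inter_subset_right
  have h0 := addHaar_image_eq_zero_of_differentiableOn_of_addHaar_eq_zero volume hd
    (measure_mono_null inter_subset_left hB0)
  refine measure_mono_null (fun y hy => ?_) h0
  simp only [mem_compl_iff, mem_ofPred_eq, Classical.not_imp] at hy
  obtain ⟨hy', hyN, hyP⟩ := hy
  have hs := hN hyN
  refine ⟨e (e'.symm y), ⟨?_, e.map_source hs, ?_⟩, ?_⟩
  · simp only [hB, mem_ofPred_eq, Classical.not_imp, e.left_inv hs]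
    exact ⟨e.map_source hs, hyN, hyP⟩
  · rw [mem_preimage, e.left_inv hs]
    exact e'.map_target hy'
  · simp only [e.left_inv hs, e'.right_inv hy']

lemma eventually_essNhds_chart {e : OpenPartialHomeomorph M Plane} (he : e ∈ atlas Plane M) {x : M}
    (hx : x ∈ e.source) {P : M → Prop} : (∀ᶠ z in essNhds x, P z) ↔
      ∃ r : ℝ, 0 < r ∧ ∀ᵐ y, y ∈ Metric.ball (e x) r → P (e.symm y) := by
  rw [eventually_essNhds]
  constructor
  · rintro ⟨N, hN, h⟩
    have h1 : e.symm ⁻¹' N ∈ nhds (e x) :=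
      (e.continuousAt_symm (e.map_source hx)).preimage_mem_nhds (by rwa [e.left_inv hx])
    obtain ⟨r, hr, hrN⟩ := Metric.mem_nhds_iff.1
      (Filter.inter_mem h1 (e.open_target.mem_nhds (e.map_source hx)))
    refine ⟨r, hr, ?_⟩
    filter_upwards [(ae_restrict_iff' e.open_target.measurableSet).1 (h e he)] with y hy hyr
    exact hy (hrN hyr).2 (hrN hyr).1
  · rintro ⟨r, hr, h⟩
    refine ⟨e.source ∩ e ⁻¹' Metric.ball (e x) r, Filter.inter_mem (e.open_source.mem_nhds hx)
      ((e.continuousAt hx).preimage_mem_nhds (Metric.ball_mem_nhds _ hr)), fun e' he' => ?_⟩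
    refine ae_chart_of_ae_chart he he' inter_subset_left ?_
    filter_upwards [h] with y hy hyt hyN
    refine hy ?_
    have := hyN.2
    rwa [mem_preimage, e.right_inv hyt] at this

instance essNhds_neBot (x : M) : (essNhds x).NeBot := by
  refine ⟨fun h => ?_⟩
  have h1 : ∀ᶠ _ in essNhds x, False := by rw [h]; exact Filter.eventually_bot
  obtain ⟨r, hr, h2⟩ := (eventually_essNhds_chart (chart_mem_atlas Plane x)
    (mem_chart_source Plane x)).1 h1
  refine (Metric.measure_ball_pos volume (chartAt Plane x x) hr).ne' ?_
  refine measure_mono_null (fun y hy => ?_) h2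
  simpa using hy

lemma almostEverywhere_of_essNhds {P : M → Prop} (h : ∀ x, ∀ᶠ z in essNhds x, P z) :
    AlmostEverywhere P := by
  intro e he
  rw [ae_restrict_iff' e.open_target.measurableSet]
  refine measure_null_of_locally_null _ fun y hy => ?_
  simp only [mem_compl_iff, mem_ofPred_eq, Classical.not_imp] at hy
  obtain ⟨r, hr, h2⟩ := (eventually_essNhds_chart he (e.map_target hy.1)).1 (h (e.symm y))
  rw [e.right_inv hy.1] at h2
  refine ⟨_, Filter.inter_mem self_mem_nhdsWithin
    (mem_nhdsWithin_of_mem_nhds (Metric.ball_mem_nhds y hr)), measure_mono_null (fun z hz => ?_) h2⟩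
  simp only [mem_compl_iff, mem_ofPred_eq, Classical.not_imp]
  have := hz.1
  simp only [mem_compl_iff, mem_ofPred_eq, Classical.not_imp] at this
  exact ⟨hz.2, this.2⟩

/-- Local continuous versions of a function glue to a global one. -/
lemma exists_continuous_of_essNhds {v : M → ℝ} (h : ∀ x, ∃ W : M → ℝ,
    (∀ᶠ z in nhds x, ContinuousAt W z) ∧ ∀ᶠ z in essNhds x, v z = W z) :
    ∃ V : M → ℝ, Continuous V ∧ AlmostEverywhere fun x => v x = V x := by
  have hlim (x : M) : ∃ l, Filter.Tendsto v (essNhds x) (nhds l) := by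
    obtain ⟨W, h1, h2⟩ := h x
    exact ⟨W x, (h1.self_of_nhds.tendsto.mono_left (essNhds_le x)).congr' (h2.mono fun _ h => h.symm)⟩
  choose V hV using hlim
  have key (x : M) : ∃ W : M → ℝ, ContinuousAt W x ∧ (∀ᶠ z in nhds x, V z = W z) ∧
      ∀ᶠ z in essNhds x, v z = W z := by
    obtain ⟨W, h1, h2⟩ := h x
    refine ⟨W, h1.self_of_nhds, ?_, h2⟩
    filter_upwards [h1, eventually_eventually_essNhds h2] with z hz hz'
    exact tendsto_nhds_unique (hV z)
      ((hz.tendsto.mono_left (essNhds_le z)).congr' (hz'.mono fun _ h => h.symm))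
  refine ⟨V, continuous_iff_continuousAt.2 fun x => ?_, almostEverywhere_of_essNhds fun x => ?_⟩
  · obtain ⟨W, h1, h2, -⟩ := key x
    exact h1.congr (h2.mono fun _ h => h.symm)
  · obtain ⟨W, -, h2, h3⟩ := key x
    filter_upwards [h3, h2.filter_mono (essNhds_le x)] with z h3 h2
    rw [h3, h2]

end Essential

section Multiplicity

variable {M : Type*}

open Classical in
/-- The number of the points `pⱼ` that are equal to `x`. -/
def multiplicity {n : ℕ} (p : Fin n → M) (x : M) : ℝ := ∑ j : Fin n, if p j = x then 1 else 0

lemma multiplicity_nonneg {n : ℕ} (p : Fin n → M) (x : M) : 0 ≤ multiplicity p x :=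
  Finset.sum_nonneg fun j _ => by split_ifs <;> norm_num

lemma multiplicity_pos {n : ℕ} (p : Fin n → M) (j : Fin n) : 0 < multiplicity p (p j) :=
  Finset.sum_pos' (fun j _ => by split_ifs <;> norm_num) ⟨j, Finset.mem_univ j, by simp⟩

lemma multiplicity_fin_zero (p : Fin 0 → M) (x : M) : multiplicity p x = 0 := by
  simp [multiplicity]

end Multiplicity

section Poisson

variable {M : Type*} [TopologicalSpace M] [ChartedSpace Plane M] [IsManifold (𝓡 2) ∞ M]

/-- `Δ w = h + c ∑ⱼ δ_{pⱼ}` in the sense of distributions. -/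
structure IsPoissonSolution (g : SurfaceMetric M) (w h : M → ℝ) (c : ℝ) {n : ℕ} (p : Fin n → M) :
    Prop where
  integrable : LocIntegrable w
  integrable_rhs : LocIntegrable h
  eq : ∀ e ∈ atlas Plane M, ∀ φ : Plane → ℝ, IsTestFunction e φ →
    laplacianPairing g w e φ = funPairing g h e φ + c * ∑ j : Fin n, diracPairing (p j) e φ

lemma IsPoissonSolution.neg {g : SurfaceMetric M} {w h : M → ℝ} {c : ℝ} {n : ℕ} {p : Fin n → M}
    (H : IsPoissonSolution g w h c p) :
    IsPoissonSolution g (fun x => -w x) (fun x => -h x) (-c) p where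
  integrable := fun e he => (H.integrable e he).neg
  integrable_rhs := fun e he => (H.integrable_rhs e he).neg
  eq := fun e he φ hφ => by
    have := H.eq e he φ hφ
    simp only [laplacianPairing, funPairing, chartIntegral, neg_mul, integral_neg] at this ⊢
    rw [this]
    ring

/-- The restriction of `w` to a closed disc about `x` in the chart at `x`, extended by zero. -/
def chartFun (x : M) (δ : ℝ) (w : M → ℝ) : Plane → ℝ :=
  (Metric.closedBall (chartAt Plane x x) δ).indicator fun y => w ((chartAt Plane x).symm y)

/-- The density, with respect to the area of the chart at `x`, of the restriction of `h` to a
closed disc about `x`. -/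
def chartDensity (g : SurfaceMetric M) (x : M) (δ : ℝ) (h : M → ℝ) : Plane → ℝ :=
  (Metric.closedBall (chartAt Plane x x) δ).indicator fun y =>
    h ((chartAt Plane x).symm y) * areaDensity g (chartAt Plane x) y

/-- The data by which the distributional Poisson equation near `x` is reduced to an equation
`L w = h` on a disc of the plane. -/
structure LocalChart (g : SurfaceMetric M) {n : ℕ} (p : Fin n → M) (x : M) where
  /-- the coefficients of the operator -/
  A : Coeff
  /-- the radius of the disc -/
  radius : ℝ
  radius_pos : 0 < radius
  subset_target : Metric.closedBall (chartAt Plane x x) radius ⊆ (chartAt Plane x).target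
  /-- a lower bound of the area density -/
  lower : ℝ
  lower_pos : 0 < lower
  /-- an upper bound of the area density -/
  upper : ℝ
  density_bounds : ∀ y ∈ Metric.closedBall (chartAt Plane x x) radius,
    lower ≤ areaDensity g (chartAt Plane x) y ∧ areaDensity g (chartAt Plane x) y ≤ upper
  integral_eq : ∀ δ : ℝ, δ ≤ radius → ∀ (w h : M → ℝ) (c : ℝ),
    IsPoissonSolution g w h c p → ∀ φ : Plane → ℝ, ContDiff ℝ ∞ φ → HasCompactSupport φ →
      tsupport φ ⊆ Metric.ball (chartAt Plane x x) δ →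
        ∫ y, chartFun x δ w y * A.op φ y
          = (∫ y, chartDensity g x δ h y * φ y) + c * (multiplicity p x * φ (chartAt Plane x x))

lemma nonempty_localChart (g : SurfaceMetric M) {n : ℕ} (p : Fin n → M) (x : M) :
    Nonempty (LocalChart g p x) := by
  set e := chartAt Plane x
  have he : e ∈ atlas Plane M := chart_mem_atlas Plane x
  have hx : x ∈ e.source := mem_chart_source Plane x
  have hy : e x ∈ e.target := e.map_source hx
  obtain ⟨A, δ₁, hδ₁, hδe, hA⟩ := exists_coeff_of_chart g he hy
  -- a disc that contains no other point `pⱼ`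
  have hp : ∀ᶠ y in nhds (e x), ∀ j, p j ∈ e.source → p j ≠ x → y ≠ e (p j) := by
    rw [Filter.eventually_all]
    intro j
    by_cases h : p j ∈ e.source ∧ p j ≠ x
    · have : e x ≠ e (p j) := fun h' => h.2 (e.injOn h.1 hx h'.symm)
      filter_upwards [isOpen_ne.mem_nhds this] with y hy _ _ using hy
    · exact Filter.Eventually.of_forall fun y h1 h2 => absurd ⟨h1, h2⟩ h
  obtain ⟨δ₂, hδ₂, hp⟩ := Metric.eventually_nhds_iff_ball.1 hp
  set δ₀ := min δ₁ δ₂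
  have hδ₀ : 0 < δ₀ := lt_min hδ₁ hδ₂
  have hsub : Metric.closedBall (e x) δ₀ ⊆ e.target :=
    (Metric.closedBall_subset_closedBall (min_le_left _ _)).trans hδe
  have hσc := ((contDiffOn_areaDensity g he).continuousOn).mono hsub
  have hcpt : IsCompact (Metric.closedBall (e x) δ₀) := isCompact_closedBall _ _
  have hne : (Metric.closedBall (e x) δ₀).Nonempty := ⟨e x, Metric.mem_closedBall_self hδ₀.le⟩
  obtain ⟨y₁, hy₁, hmin⟩ := hcpt.exists_isMinOn hne hσc
  obtain ⟨y₂, hy₂, hmax⟩ := hcpt.exists_isMaxOn hne hσc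
  refine ⟨⟨A, δ₀, hδ₀, hsub, areaDensity g e y₁, areaDensity_pos g he (hsub hy₁),
    areaDensity g e y₂, fun y hy => ⟨hmin hy, hmax hy⟩, ?_⟩⟩
  intro δ hδ w h c H φ hφ hφc hφs
  have hφδ₁ : tsupport φ ⊆ Metric.ball (e x) δ₁ :=
    hφs.trans (Metric.ball_subset_ball (hδ.trans (min_le_left _ _)))
  have hφe : tsupport φ ⊆ e.target := hφδ₁.trans (Metric.ball_subset_closedBall.trans hδe)
  have hφδ {y : Plane} (hy : y ∉ Metric.closedBall (e x) δ) : y ∉ tsupport φ :=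
    fun h => hy (Metric.ball_subset_closedBall (hφs h))
  have h0 := H.eq e he φ ⟨hφ, hφc, hφe⟩
  have e1 : laplacianPairing g w e φ = ∫ y, chartFun x δ w y * A.op φ y := by
    rw [laplacianPairing, chartIntegral, ← integral_indicator e.open_target.measurableSet]
    congr 1
    funext y
    by_cases hyt : y ∈ e.target
    · rw [indicator_of_mem hyt, mul_assoc, hA φ hφδ₁ y hyt]
      by_cases hyδ : y ∈ Metric.closedBall (e x) δ
      · rw [chartFun, indicator_of_mem hyδ]
      · rw [Coeff.op_eq_zero_of_notMem (hφδ hyδ)]; simp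
    · rw [indicator_of_notMem hyt, Coeff.op_eq_zero_of_notMem fun h => hyt (hφe h), mul_zero]
  have e2 : funPairing g h e φ = ∫ y, chartDensity g x δ h y * φ y := by
    rw [funPairing, chartIntegral, ← integral_indicator e.open_target.measurableSet]
    congr 1
    funext y
    by_cases hyt : y ∈ e.target
    · rw [indicator_of_mem hyt]
      by_cases hyδ : y ∈ Metric.closedBall (e x) δ
      · rw [chartDensity, indicator_of_mem hyδ]; ring
      · rw [image_eq_zero_of_notMem_tsupport (hφδ hyδ)]; simp
    · rw [indicator_of_notMem hyt, image_eq_zero_of_notMem_tsupport fun h => hyt (hφe h), mul_zero]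
  have e3 : ∑ j : Fin n, diracPairing (p j) e φ = multiplicity p x * φ (e x) := by
    rw [multiplicity, Finset.sum_mul]
    refine Finset.sum_congr rfl fun j _ => ?_
    by_cases hj : p j = x
    · rw [if_pos hj, hj, diracPairing, if_pos hx, one_mul]
    · rw [if_neg hj, zero_mul, diracPairing]
      split_ifs with hs
      · refine image_eq_zero_of_notMem_tsupport fun h => ?_
        exact hp _ (Metric.ball_subset_ball (hδ.trans (min_le_right _ _)) (hφs h)) j hs hj rfl
      · rfl
  rw [← e1, ← e2, ← e3, h0]

end Poisson

end VortexSystem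

namespace VortexSystem

/-! ### The Poisson equation on a surface -/

namespace Coeff

variable {A : Coeff} {Ω : Set Plane} {w w' h h' : Plane → ℝ}

lemma measurable_upperSign : Measurable upperSign :=
  ((measurable_const.add (measurable_id.div measurable_id.abs)).div_const 2)

lemma integrable_upperSign_mul (hw : Integrable w) (hh : Integrable h) :
    Integrable fun y => upperSign (w y) * h y :=
  hh.bdd_mul (c := 1) (measurable_upperSign.comp_aemeasurable hw.1.aemeasurable).aestronglyMeasurable
    (Filter.Eventually.of_forall fun y => by
      rw [Real.norm_eq_abs, abs_of_nonneg (upperSign_nonneg _)]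
      exact upperSign_le_one _)

lemma WeakGE.mono (H : A.WeakGE Ω w h) (hh : LocallyIntegrable h) (hh' : LocallyIntegrable h')
    (hle : ∀ᵐ y, y ∈ Ω → h' y ≤ h y) : A.WeakGE Ω w h' := by
  intro φ hφ hφc hφΩ hφ0
  refine le_trans (integral_mono_ae
    (hh'.integrable_smul_right_of_hasCompactSupport hφ.continuous hφc)
    (hh.integrable_smul_right_of_hasCompactSupport hφ.continuous hφc) ?_) (H φ hφ hφc hφΩ hφ0)
  filter_upwards [hle] with y hy
  by_cases hyΩ : y ∈ Ω
  · exact mul_le_mul_of_nonneg_right (hy hyΩ) (hφ0 y)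
  · have : φ y = 0 := image_eq_zero_of_notMem_tsupport fun h => hyΩ (hφΩ h)
    simp [this]

lemma WeakGE.congr (H : A.WeakGE Ω w h) (hw : ∀ᵐ y, y ∈ Ω → w y = w' y) : A.WeakGE Ω w' h := by
  intro φ hφ hφc hφΩ hφ0
  refine (H φ hφ hφc hφΩ hφ0).trans_eq (integral_congr_ae ?_)
  filter_upwards [hw] with y hy
  by_cases hyΩ : y ∈ Ω
  · simp only [hy hyΩ]
  · have : A.op φ y = 0 := op_eq_zero_of_notMem fun h => hyΩ (hφΩ h)
    simp [this]

lemma WeakGE.mul_add_mul {a a' : ℝ} (ha : 0 ≤ a) (ha' : 0 ≤ a') (H : A.WeakGE Ω w h)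
    (H' : A.WeakGE Ω w' h') (hw : Integrable w) (hw' : Integrable w') (hh : LocallyIntegrable h)
    (hh' : LocallyIntegrable h') :
    A.WeakGE Ω (fun y => a * w y + a' * w' y) fun y => a * h y + a' * h' y := by
  intro φ hφ hφc hφΩ hφ0
  have h1 := H φ hφ hφc hφΩ hφ0
  have h2 := H' φ hφ hφc hφΩ hφ0
  have e1 : ∫ y, (a * h y + a' * h' y) * φ y = a * (∫ y, h y * φ y) + a' * ∫ y, h' y * φ y := by
    have i1 : Integrable fun y => h y * φ y :=
      hh.integrable_smul_right_of_hasCompactSupport hφ.continuous hφc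
    have i2 : Integrable fun y => h' y * φ y :=
      hh'.integrable_smul_right_of_hasCompactSupport hφ.continuous hφc
    rw [← integral_const_mul, ← integral_const_mul,
      ← integral_add (i1.const_mul a) (i2.const_mul a')]
    congr 1
    funext y
    ring
  have e2 : ∫ y, (a * w y + a' * w' y) * A.op φ y
      = a * (∫ y, w y * A.op φ y) + a' * ∫ y, w' y * A.op φ y := by
    rw [← integral_const_mul, ← integral_const_mul, ← integral_add
      ((integrable_mul_op hw hφ hφc).const_mul a) ((integrable_mul_op hw' hφ hφc).const_mul a')]
    congr 1
    funext y
    ring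
  rw [e1, e2]
  gcongr

lemma integral_op_eq_zero {φ : Plane → ℝ} (hφ : ContDiff ℝ ∞ φ) (hφc : HasCompactSupport φ) :
    ∫ y, A.op φ y = 0 := by
  have := integral_mul_op (A := A) (φ := fun _ => 1) contDiff_const hφ hφc
  simpa [op_const] using this

end Coeff

/-- Continuity of a function near a point, from its expression in the chart. -/
lemma eventually_continuousAt_comp_chart {M : Type*} [TopologicalSpace M] [ChartedSpace Plane M]
    {x : M} {V : Plane → ℝ} {r : ℝ} (hr : 0 < r)
    (hV : ContinuousOn V (Metric.ball (chartAt Plane x x) r)) :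
    ∀ᶠ z in nhds x, ContinuousAt (fun z => V (chartAt Plane x z)) z := by
  set e := chartAt Plane x
  have hx : x ∈ e.source := mem_chart_source Plane x
  filter_upwards [e.open_source.mem_nhds hx,
    (e.continuousAt hx).preimage_mem_nhds (Metric.ball_mem_nhds (e x) hr)] with z hz hz'
  exact (hV.continuousAt (Metric.isOpen_ball.mem_nhds hz')).comp (e.continuousAt hz)

section Poisson

variable {M : Type*} [TopologicalSpace M] [ChartedSpace Plane M] [IsManifold (𝓡 2) ∞ M]
  {g : SurfaceMetric M} {n : ℕ} {p : Fin n → M} {x : M} {w h : M → ℝ} {c : ℝ}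

lemma eventually_essNhds_iff {P : M → Prop} : (∀ᶠ z in essNhds x, P z) ↔
    ∃ r : ℝ, 0 < r ∧ ∀ᵐ y, y ∈ Metric.ball (chartAt Plane x x) r → P ((chartAt Plane x).symm y) :=
  eventually_essNhds_chart (chart_mem_atlas Plane x) (mem_chart_source Plane x)

namespace LocalChart

variable {δ : ℝ}

lemma integrable_chartFun (X : LocalChart g p x) (hδ : δ ≤ X.radius) (hw : LocIntegrable w) :
    Integrable (chartFun x δ w) := by
  rw [chartFun, integrable_indicator_iff Metric.isClosed_closedBall.measurableSet]
  exact (hw _ (chart_mem_atlas Plane x)).integrableOn_compact_subset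
    ((Metric.closedBall_subset_closedBall hδ).trans X.subset_target) (isCompact_closedBall _ _)

lemma integrable_chartDensity (X : LocalChart g p x) (hδ : δ ≤ X.radius) (hh : LocIntegrable h) :
    Integrable (chartDensity g x δ h) := by
  have hsub := (Metric.closedBall_subset_closedBall hδ).trans X.subset_target
  rw [chartDensity, integrable_indicator_iff Metric.isClosed_closedBall.measurableSet]
  exact ((hh _ (chart_mem_atlas Plane x)).integrableOn_compact_subset hsub
    (isCompact_closedBall _ _)).mul_continuousOn
    ((contDiffOn_areaDensity g (chart_mem_atlas Plane x)).continuousOn.mono hsub)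
    (isCompact_closedBall _ _)

lemma integral_sub_const_eq (X : LocalChart g p x) (hδ : δ ≤ X.radius)
    (H : IsPoissonSolution g w h c p) (k : ℝ)
    {φ : Plane → ℝ} (hφ : ContDiff ℝ ∞ φ) (hφc : HasCompactSupport φ)
    (hφs : tsupport φ ⊆ Metric.ball (chartAt Plane x x) δ) :
    ∫ y, chartFun x δ (fun z => w z - k) y * X.A.op φ y
      = (∫ y, chartDensity g x δ h y * φ y) + c * (multiplicity p x * φ (chartAt Plane x x)) := by
  rw [← X.integral_eq δ hδ w h c H φ hφ hφc hφs]
  have h1 : ∀ y, chartFun x δ (fun z => w z - k) y * X.A.op φ y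
      = chartFun x δ w y * X.A.op φ y - k * X.A.op φ y := by
    intro y
    by_cases hy : y ∈ Metric.closedBall (chartAt Plane x x) δ
    · simp only [chartFun, indicator_of_mem hy]; ring
    · rw [Coeff.op_eq_zero_of_notMem fun h => hy (Metric.ball_subset_closedBall (hφs h))]; simp
  have hi : Integrable fun y => k * X.A.op φ y :=
    ((Coeff.contDiff_op hφ).continuous.integrable_of_hasCompactSupport
      (Coeff.hasCompactSupport_op hφc)).const_mul k
  simp only [h1]
  rw [integral_sub (Coeff.integrable_mul_op (X.integrable_chartFun hδ H.integrable) hφ hφc) hi,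
    integral_const_mul, Coeff.integral_op_eq_zero hφ hφc, mul_zero, sub_zero]

lemma weakGE_sub_const (X : LocalChart g p x) (hδ : δ ≤ X.radius) (H : IsPoissonSolution g w h c p)
    (hc : 0 ≤ c * multiplicity p x) (k : ℝ) :
    X.A.WeakGE (Metric.ball (chartAt Plane x x) δ) (chartFun x δ fun z => w z - k)
      (chartDensity g x δ h) := by
  intro φ hφ hφc hφs hφ0
  rw [X.integral_sub_const_eq hδ H k hφ hφc hφs, ← mul_assoc]
  linarith [mul_nonneg hc (hφ0 (chartAt Plane x x))]

lemma integrable_chartFun_sub_const (X : LocalChart g p x) (hδ : δ ≤ X.radius)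
    (hw : LocIntegrable w) (k : ℝ) :
    Integrable (chartFun x δ fun z => w z - k) :=
  X.integrable_chartFun hδ fun e he => (hw e he).sub
    ((locallyIntegrable_const k).locallyIntegrableOn _)

end LocalChart

/-- **Kato's inequality on the surface**: two functions satisfying Poisson equations, cut off from
below and combined with nonnegative weights, are locally bounded above as soon as the combination is
subharmonic up to a constant. -/
theorem exists_essNhds_le_of_kato {w₁ h₁ w₂ h₂ : M → ℝ} {c₁ c₂ a₁ a₂ H : ℝ}
    (H₁ : IsPoissonSolution g w₁ h₁ c₁ p) (H₂ : IsPoissonSolution g w₂ h₂ c₂ p)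
    (hc₁ : 0 ≤ c₁ * multiplicity p x) (hc₂ : 0 ≤ c₂ * multiplicity p x) (ha₁ : 0 ≤ a₁)
    (ha₂ : 0 ≤ a₂) (hH : 0 ≤ H) (k₁ k₂ : ℝ)
    (hsum : ∀ᶠ z in essNhds x, -H ≤ a₁ * (Coeff.upperSign (w₁ z - k₁) * h₁ z)
      + a₂ * (Coeff.upperSign (w₂ z - k₂) * h₂ z)) :
    ∃ C : ℝ, ∀ᶠ z in essNhds x, a₁ * max (w₁ z - k₁) 0 + a₂ * max (w₂ z - k₂) 0 ≤ C := by
  obtain ⟨X⟩ := nonempty_localChart g p x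
  obtain ⟨r, hr, hsum⟩ := eventually_essNhds_iff.1 hsum
  set e := chartAt Plane x
  set δ := min X.radius r
  have hδ : 0 < δ := lt_min X.radius_pos hr
  have hδX : δ ≤ X.radius := min_le_left _ _
  set B := Metric.ball (e x) δ
  have i₁ := X.integrable_chartFun_sub_const hδX H₁.integrable k₁
  have i₂ := X.integrable_chartFun_sub_const hδX H₂.integrable k₂
  have j₁ := X.integrable_chartDensity hδX H₁.integrable_rhs
  have j₂ := X.integrable_chartDensity hδX H₂.integrable_rhs
  have K₁ := (X.weakGE_sub_const hδX H₁ hc₁ k₁).pos_part Metric.isOpen_ball i₁ j₁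
  have K₂ := (X.weakGE_sub_const hδX H₂ hc₂ k₂).pos_part Metric.isOpen_ball i₂ j₂
  have l₁ := (Coeff.integrable_upperSign_mul i₁ j₁).locallyIntegrable
  have l₂ := (Coeff.integrable_upperSign_mul i₂ j₂).locallyIntegrable
  have hU : 0 ≤ X.upper :=
    (X.lower_pos.le.trans (X.density_bounds _ (Metric.mem_closedBall_self X.radius_pos.le)).1).trans
      (X.density_bounds _ (Metric.mem_closedBall_self X.radius_pos.le)).2
  have K : X.A.WeakGE B (fun y => a₁ * max (chartFun x δ (fun z => w₁ z - k₁) y) 0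
      + a₂ * max (chartFun x δ (fun z => w₂ z - k₂) y) 0) fun _ => -(H * X.upper) := by
    refine (K₁.mul_add_mul ha₁ ha₂ K₂ i₁.pos_part i₂.pos_part l₁ l₂).mono
      ((l₁.smul a₁).add (l₂.smul a₂)) (locallyIntegrable_const _) ?_
    filter_upwards [hsum] with y hy hyB
    have hyc : y ∈ Metric.closedBall (e x) δ := Metric.ball_subset_closedBall hyB
    have h1 := hy (Metric.ball_subset_ball (min_le_right _ _) hyB)
    have h2 := X.density_bounds y (Metric.closedBall_subset_closedBall hδX hyc)
    have h3 : 0 ≤ areaDensity g e y := X.lower_pos.le.trans h2.1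
    have f₁ : chartFun x δ (fun z => w₁ z - k₁) y = w₁ (e.symm y) - k₁ := indicator_of_mem hyc _
    have f₂ : chartFun x δ (fun z => w₂ z - k₂) y = w₂ (e.symm y) - k₂ := indicator_of_mem hyc _
    have f₃ : chartDensity g x δ h₁ y = h₁ (e.symm y) * areaDensity g e y := indicator_of_mem hyc _
    have f₄ : chartDensity g x δ h₂ y = h₂ (e.symm y) * areaDensity g e y := indicator_of_mem hyc _
    simp only [f₁, f₂, f₃, f₄]
    have h4 := mul_le_mul_of_nonneg_right h1 h3
    have h5 : H * areaDensity g e y ≤ H * X.upper := mul_le_mul_of_nonneg_left h2.2 hH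
    refine le_trans ?_ (h4.trans_eq ?_)
    · linarith
    · ring
  obtain ⟨C, hC⟩ := K.exists_ae_le (mul_nonneg hH hU)
    ((i₁.pos_part.const_mul a₁).add (i₂.pos_part.const_mul a₂))
    (fun y => add_nonneg (mul_nonneg ha₁ (le_max_right _ _)) (mul_nonneg ha₂ (le_max_right _ _)))
    (half_pos hδ) (Metric.closedBall_subset_ball (half_lt_self hδ))
  refine ⟨C, eventually_essNhds_iff.2 ⟨δ / 2 / 2, by positivity, ?_⟩⟩
  filter_upwards [hC] with y hy hyB
  have hyc : y ∈ Metric.closedBall (e x) δ :=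
    Metric.closedBall_subset_closedBall (by linarith) (Metric.ball_subset_closedBall hyB)
  have f₁ : chartFun x δ (fun z => w₁ z - k₁) y = w₁ (e.symm y) - k₁ := indicator_of_mem hyc _
  have f₂ : chartFun x δ (fun z => w₂ z - k₂) y = w₂ (e.symm y) - k₂ := indicator_of_mem hyc _
  rw [← f₁, ← f₂]
  exact hy hyB

/-- Away from the points `pⱼ`, a solution with bounded right-hand side is locally bounded. -/
theorem exists_essNhds_abs_le (H : IsPoissonSolution g w h c p) (hc : c * multiplicity p x = 0)
    {B : ℝ} (hh : ∀ᶠ z in essNhds x, |h z| ≤ B) : ∃ C : ℝ, ∀ᶠ z in essNhds x, |w z| ≤ C := by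
  have hB : 0 ≤ B := by
    obtain ⟨z, hz⟩ := hh.exists
    exact (abs_nonneg _).trans hz
  have key (t b : ℝ) (hb : |b| ≤ B) : -B ≤ Coeff.upperSign t * b := by
    have h1 := Coeff.upperSign_nonneg t
    have h2 := Coeff.upperSign_le_one t
    have h3 := (abs_le.1 hb).1
    rcases le_total 0 b with h | h
    · linarith [mul_nonneg h1 h]
    · nlinarith
  obtain ⟨C₁, h₁⟩ := exists_essNhds_le_of_kato (a₁ := 1) (a₂ := 0) H H hc.ge hc.ge zero_le_one
    le_rfl hB 0 0 (hh.mono fun z hz => by linarith [key (w z - 0) (h z) hz])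
  have hc' : -c * multiplicity p x = 0 := by rw [neg_mul, hc, neg_zero]
  obtain ⟨C₂, h₂⟩ := exists_essNhds_le_of_kato (a₁ := 1) (a₂ := 0) H.neg H.neg hc'.ge hc'.ge
    zero_le_one le_rfl hB 0 0 (hh.mono fun z hz => by
      linarith [key (-w z - 0) (-h z) (by rwa [abs_neg])])
  refine ⟨max C₁ C₂, ?_⟩
  filter_upwards [h₁, h₂] with z h₁ h₂
  have e1 := le_max_left (w z - 0) 0
  have e2 := le_max_left (-w z - 0) 0
  rw [abs_le]
  constructor
  · linarith [le_max_right C₁ C₂]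
  · linarith [le_max_left C₁ C₂]

lemma LocalChart.ae_abs_chartDensity_le (X : LocalChart g p x) {δ r B : ℝ} (hδX : δ ≤ X.radius)
    (hδr : δ < r) (hB : ∀ᵐ y, y ∈ Metric.ball (chartAt Plane x x) r →
      |h ((chartAt Plane x).symm y)| ≤ B) :
    ∀ᵐ y, y ∈ Metric.ball (chartAt Plane x x) δ → |chartDensity g x δ h y| ≤ B * X.upper := by
  filter_upwards [hB] with y hy hyδ
  have hyc := Metric.ball_subset_closedBall hyδ
  have h1 := hy (Metric.ball_subset_ball hδr.le hyδ)
  have h2 := X.density_bounds y (Metric.closedBall_subset_closedBall hδX hyc)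
  have h3 : 0 ≤ areaDensity g (chartAt Plane x) y := X.lower_pos.le.trans h2.1
  rw [chartDensity, indicator_of_mem hyc, abs_mul, abs_of_nonneg h3]
  exact mul_le_mul h1 h2.2 h3 ((abs_nonneg _).trans h1)

lemma LocalChart.upper_pos (X : LocalChart g p x) : 0 < X.upper :=
  (X.lower_pos.trans_le (X.density_bounds _ (Metric.mem_closedBall_self X.radius_pos.le)).1).trans_le
      (X.density_bounds _ (Metric.mem_closedBall_self X.radius_pos.le)).2

/-- Bounded solutions with bounded right-hand side have a continuous version near `x`. -/
theorem exists_continuousAt_of_bounded (H : IsPoissonSolution g w h c p)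
    (hc : c * multiplicity p x = 0) {B : ℝ} (hw : ∀ᶠ z in essNhds x, |w z| ≤ B)
    (hh : ∀ᶠ z in essNhds x, |h z| ≤ B) : ∃ W : M → ℝ,
      (∀ᶠ z in nhds x, ContinuousAt W z) ∧ ∀ᶠ z in essNhds x, w z = W z := by
  have hB : 0 ≤ B := by
    obtain ⟨z, hz⟩ := hh.exists
    exact (abs_nonneg _).trans hz
  obtain ⟨X⟩ := nonempty_localChart g p x
  obtain ⟨r, hr, hb⟩ := eventually_essNhds_iff.1 (hw.and hh)
  set e := chartAt Plane x
  set δ := min X.radius (r / 2)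
  have hδ : 0 < δ := lt_min X.radius_pos (half_pos hr)
  have hδX : δ ≤ X.radius := min_le_left _ _
  have hδr : δ < r := (min_le_right _ _).trans_lt (half_lt_self hr)
  have i₁ := X.integrable_chartFun_sub_const hδX H.integrable 0
  have j₁ := X.integrable_chartDensity hδX H.integrable_rhs
  have i₂ := X.integrable_chartFun_sub_const hδX H.neg.integrable 0
  have j₂ := X.integrable_chartDensity hδX H.neg.integrable_rhs
  have hc' : -c * multiplicity p x = 0 := by rw [neg_mul, hc, neg_zero]
  have hd := X.ae_abs_chartDensity_le hδX hδr (h := h) (hb.mono fun y hy hyr => (hy hyr).2)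
  have hd' := X.ae_abs_chartDensity_le hδX hδr (h := fun z => -h z)
    (hb.mono fun y hy hyr => by rw [abs_neg]; exact (hy hyr).2)
  have G₁ := (X.weakGE_sub_const hδX H hc.ge 0).mono j₁.locallyIntegrable
    (locallyIntegrable_const (-(B * X.upper))) (hd.mono fun y hy hyB => (abs_le.1 (hy hyB)).1)
  have G₂ := (X.weakGE_sub_const hδX H.neg hc'.ge 0).mono j₂.locallyIntegrable
    (locallyIntegrable_const (-(B * X.upper))) (hd'.mono fun y hy hyB => (abs_le.1 (hy hyB)).1)
  have G₂' := G₂.congr (w' := fun y => -chartFun x δ (fun z => w z - 0) y)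
    (Filter.Eventually.of_forall fun y hy => by
      simp only [chartFun, indicator_of_mem (Metric.ball_subset_closedBall hy)]
      ring)
  have hbd : ∀ᵐ y, |chartFun x δ (fun z => w z - 0) y| ≤ B := by
    filter_upwards [hb] with y hy
    by_cases hyδ : y ∈ Metric.closedBall (e x) δ
    · rw [chartFun, indicator_of_mem hyδ, sub_zero]
      exact (hy (Metric.closedBall_subset_ball hδr hyδ)).1
    · rw [chartFun, indicator_of_notMem hyδ, abs_zero]
      exact hB
  obtain ⟨V, hV, hVw⟩ := G₁.exists_continuousOn (mul_nonneg hB X.upper_pos.le) i₁ hbd G₂'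
    (half_pos hδ) (Metric.closedBall_subset_ball (half_lt_self hδ))
  refine ⟨fun z => V (e z), eventually_continuousAt_comp_chart (by positivity) hV,
    eventually_essNhds_iff.2 ⟨δ / 2 / 2, by positivity, ?_⟩⟩
  filter_upwards [hVw] with y hy hyB
  have hyc : y ∈ Metric.closedBall (e x) δ :=
    Metric.closedBall_subset_closedBall (by linarith) (Metric.ball_subset_closedBall hyB)
  have h1 := hy hyB
  rw [chartFun, indicator_of_mem hyc, sub_zero] at h1
  rw [h1, e.right_inv (X.subset_target (Metric.closedBall_subset_closedBall hδX hyc))]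

/-- A solution that is bounded above tends to `-∞` at the points `pⱼ`. -/
theorem tendsto_atBot_of_dirac (H : IsPoissonSolution g w h c p) (hc : 0 < c * multiplicity p x)
    {B : ℝ} (hw : ∀ᶠ z in essNhds x, w z ≤ B) (hh : ∀ᶠ z in essNhds x, |h z| ≤ B) :
    Filter.Tendsto w (essNhds x) Filter.atBot := by
  have hB : 0 ≤ B := by
    obtain ⟨z, hz⟩ := hh.exists
    exact (abs_nonneg _).trans hz
  obtain ⟨X⟩ := nonempty_localChart g p x
  obtain ⟨r, hr, hb⟩ := eventually_essNhds_iff.1 (hw.and hh)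
  set e := chartAt Plane x
  set δ := min X.radius (r / 2)
  have hδ : 0 < δ := lt_min X.radius_pos (half_pos hr)
  have hδX : δ ≤ X.radius := min_le_left _ _
  have hδr : δ < r := (min_le_right _ _).trans_lt (half_lt_self hr)
  have i := X.integrable_chartFun_sub_const hδX H.integrable B
  have j := X.integrable_chartDensity hδX H.integrable_rhs
  have hd := X.ae_abs_chartDensity_le hδX hδr (h := h) (hb.mono fun y hy hyr => (hy hyr).2)
  have hH : 0 ≤ B * X.upper := mul_nonneg hB X.upper_pos.le
  set f : Plane → ℝ := fun y => max (-chartFun x δ (fun z => w z - B) y) 0 with hf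
  have hfe : ∀ᵐ y, f y = -chartFun x δ (fun z => w z - B) y := by
    filter_upwards [hb] with y hy
    refine max_eq_left ?_
    by_cases hyδ : y ∈ Metric.closedBall (e x) δ
    · rw [chartFun, indicator_of_mem hyδ]
      have := (hy (Metric.closedBall_subset_ball hδr hyδ)).1
      linarith
    · rw [chartFun, indicator_of_notMem hyδ, neg_zero]
  have hL : ∀ φ : Plane → ℝ, ContDiff ℝ ∞ φ → HasCompactSupport φ →
      tsupport φ ⊆ Metric.ball (e x) δ → (∀ y, 0 ≤ φ y) →
      |(∫ y, f y * X.A.op φ y) + c * multiplicity p x * φ (e x)|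
        ≤ B * X.upper * ∫ y, φ y := by
    intro φ hφ hφc hφs hφ0
    have e1 : ∫ y, f y * X.A.op φ y
        = -∫ y, chartFun x δ (fun z => w z - B) y * X.A.op φ y := by
      rw [← integral_neg]
      refine integral_congr_ae ?_
      filter_upwards [hfe] with y hy
      rw [hy, neg_mul]
    rw [e1, X.integral_sub_const_eq hδX H B hφ hφc hφs]
    have e2 : -((∫ y, chartDensity g x δ h y * φ y) + c * (multiplicity p x * φ (e x)))
        + c * multiplicity p x * φ (e x) = -∫ y, chartDensity g x δ h y * φ y := by ring
    rw [e2, abs_neg, ← integral_const_mul, ← Real.norm_eq_abs]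
    refine norm_integral_le_of_norm_le
      ((hφ.continuous.integrable_of_hasCompactSupport hφc).const_mul _) ?_
    filter_upwards [hd] with y hy
    by_cases hyδ : y ∈ Metric.ball (e x) δ
    · rw [norm_mul, Real.norm_eq_abs, Real.norm_eq_abs, abs_of_nonneg (hφ0 y)]
      exact mul_le_mul_of_nonneg_right (hy hyδ) (hφ0 y)
    · rw [image_eq_zero_of_notMem_tsupport fun h => hyδ (hφs h)]
      simp
  rw [Filter.tendsto_atBot]
  intro K
  obtain ⟨ρ, hρ, hK⟩ := Coeff.exists_ae_ge_of_dirac hH hc i.neg_part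
    (fun y => le_max_right _ _) hL (half_pos hδ)
    (Metric.closedBall_subset_ball (half_lt_self hδ)) (B - K)
  refine eventually_essNhds_iff.2 ⟨min ρ δ, lt_min hρ hδ, ?_⟩
  filter_upwards [hK, hfe] with y hy hye hyB
  have h1 := hy (Metric.ball_subset_ball (min_le_left _ _) hyB)
  have hyc : y ∈ Metric.closedBall (e x) δ :=
    Metric.ball_subset_closedBall (Metric.ball_subset_ball (min_le_right _ _) hyB)
  have h2 : B - K ≤ f y := h1
  rw [hye, chartFun, indicator_of_mem hyc] at h2
  linarith

/-- **Maximum principle**: the continuous version of a strictly subharmonic function has no local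
maximum. -/
theorem not_isLocalMax_of_subharmonic (H : IsPoissonSolution g w h c p)
    (hc : 0 ≤ c * multiplicity p x) {W : M → ℝ} (hW : ContinuousAt W x)
    (hwW : ∀ᶠ z in essNhds x, w z = W z) (hmax : IsLocalMax W x) {κ : ℝ} (hκ : 0 < κ)
    (hh : ∀ᶠ z in essNhds x, κ ≤ h z) : False := by
  obtain ⟨X⟩ := nonempty_localChart g p x
  obtain ⟨r, hr, hb⟩ := eventually_essNhds_iff.1 (hwW.and hh)
  set e := chartAt Plane x
  have hx : x ∈ e.source := mem_chart_source Plane x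
  have hy : e x ∈ e.target := e.map_source hx
  have hes : Filter.Tendsto e.symm (nhds (e x)) (nhds x) := by
    have := e.continuousAt_symm hy
    rwa [ContinuousAt, e.left_inv hx] at this
  obtain ⟨r', hr', hmax'⟩ := Metric.eventually_nhds_iff_ball.1 (hes.eventually hmax)
  set δ := min X.radius (min r r' / 2)
  have hrr : 0 < min r r' := lt_min hr hr'
  have hδ : 0 < δ := lt_min X.radius_pos (half_pos hrr)
  have hδX : δ ≤ X.radius := min_le_left _ _
  have hδr : δ < min r r' := (min_le_right _ _).trans_lt (half_lt_self hrr)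
  have i := X.integrable_chartFun_sub_const hδX H.integrable (W x)
  have j := X.integrable_chartDensity hδX H.integrable_rhs
  set z := chartFun x δ fun y => W x - W y with hz
  have hzw : ∀ᵐ y, -chartFun x δ (fun z => w z - W x) y = z y := by
    filter_upwards [hb] with y hy
    by_cases hyδ : y ∈ Metric.closedBall (e x) δ
    · rw [hz, chartFun, chartFun, indicator_of_mem hyδ, indicator_of_mem hyδ,
        (hy (Metric.closedBall_subset_ball (hδr.trans_le (min_le_left _ _)) hyδ)).1]
      ring
    · rw [hz, chartFun, chartFun, indicator_of_notMem hyδ, indicator_of_notMem hyδ, neg_zero]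
  have hz0 (y : Plane) : 0 ≤ z y := by
    by_cases hyδ : y ∈ Metric.closedBall (e x) δ
    · rw [hz, chartFun, indicator_of_mem hyδ]
      exact sub_nonneg.2 (hmax' y (Metric.closedBall_subset_ball
        (hδr.trans_le (min_le_right _ _)) hyδ))
    · rw [hz, chartFun, indicator_of_notMem hyδ]
  have hzx : z (e x) = 0 := by
    rw [hz, chartFun, indicator_of_mem (Metric.mem_closedBall_self hδ.le), e.left_inv hx, sub_self]
  have hzc : ContinuousAt z (e x) := by
    have h1 : ContinuousAt (fun y => W x - W (e.symm y)) (e x) := by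
      refine continuousAt_const.sub (ContinuousAt.comp (g := W) ?_ (e.continuousAt_symm hy))
      rwa [e.left_inv hx]
    refine h1.congr ?_
    filter_upwards [Metric.closedBall_mem_nhds (e x) hδ] with y hy
    rw [hz, chartFun, indicator_of_mem hy]
  have G := ((X.weakGE_sub_const hδX H hc (W x)).mono j.locallyIntegrable
    (locallyIntegrable_const (κ * X.lower)) (by
      filter_upwards [hb] with y hy hyB
      have hyc := Metric.ball_subset_closedBall hyB
      have h1 := (hy (Metric.closedBall_subset_ball (hδr.trans_le (min_le_left _ _)) hyc)).2
      have h2 := X.density_bounds y (Metric.closedBall_subset_closedBall hδX hyc)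
      rw [chartDensity, indicator_of_mem hyc]
      exact mul_le_mul h1 h2.1 X.lower_pos.le (hκ.le.trans h1))).congr (w' := fun y => -z y) (by
      filter_upwards [hzw] with y hy _
      rw [← hy, neg_neg])
  exact Coeff.not_weakGE_of_eq_zero (mul_pos hκ X.lower_pos) (i.neg.congr hzw) hz0
    (Metric.ball_mem_nhds _ hδ) hzc hzx G

/-- If a constant solves the Poisson equation, then the right-hand side vanishes. -/
theorem eventually_eq_zero_of_const (H : IsPoissonSolution g w h c p)
    (hc : c * multiplicity p x = 0) {k : ℝ} (hw : ∀ᶠ z in essNhds x, w z = k) :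
    ∀ᶠ z in essNhds x, h z = 0 := by
  obtain ⟨X⟩ := nonempty_localChart g p x
  obtain ⟨r, hr, hb⟩ := eventually_essNhds_iff.1 hw
  set e := chartAt Plane x
  set δ := min X.radius (r / 2)
  have hδ : 0 < δ := lt_min X.radius_pos (half_pos hr)
  have hδX : δ ≤ X.radius := min_le_left _ _
  have hδr : δ < r := (min_le_right _ _).trans_lt (half_lt_self hr)
  have j := X.integrable_chartDensity hδX H.integrable_rhs
  have h0 : ∀ᵐ y, chartFun x δ (fun z => w z - k) y = 0 := by
    filter_upwards [hb] with y hy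
    by_cases hyδ : y ∈ Metric.closedBall (e x) δ
    · rw [chartFun, indicator_of_mem hyδ, hy (Metric.closedBall_subset_ball hδr hyδ), sub_self]
    · rw [chartFun, indicator_of_notMem hyδ]
  have h1 := Metric.isOpen_ball.ae_eq_zero_of_integral_contDiff_smul_eq_zero
    (U := Metric.ball (e x) δ) (f := chartDensity g x δ h) (μ := volume)
    (j.locallyIntegrable.locallyIntegrableOn _) fun φ hφ hφc hφs => by
      have h2 := X.integral_sub_const_eq hδX H k hφ hφc hφs
      rw [← mul_assoc, hc, zero_mul, add_zero] at h2
      simp only [smul_eq_mul, mul_comm (φ _)]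
      rw [← h2]
      refine integral_eq_zero_of_ae ?_
      filter_upwards [h0] with y hy
      simp [hy]
  refine eventually_essNhds_iff.2 ⟨δ, hδ, ?_⟩
  filter_upwards [h1] with y hy hyB
  have hyc := Metric.ball_subset_closedBall hyB
  have h2 := X.density_bounds y (Metric.closedBall_subset_closedBall hδX hyc)
  have h3 := hy hyB
  rw [chartDensity, indicator_of_mem hyc] at h3
  exact (mul_eq_zero.1 h3).resolve_right (X.lower_pos.trans_le h2.1).ne'

end Poisson

end VortexSystem

namespace VortexSystem

/-! ### The system -/

/-- The assumptions on the nonlinearity: `f` is smooth and strictly increasing on `[0, ∞)`, and `s`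
lies strictly between `f 0` and the supremum of `f`. -/
structure IsAdmissible (f : ℝ → ℝ) (s : ℝ) : Prop where
  smooth : ContDiffOn ℝ ∞ f (Ici 0)
  mono : StrictMonoOn f (Ici 0)
  lower : f 0 < s
  upper : ∃ t : ℝ, 0 < t ∧ s < f t

namespace IsAdmissible

variable {f : ℝ → ℝ} {s : ℝ}

lemma halfLineDeriv_nonneg (hf : IsAdmissible f s) (t : ℝ) : 0 ≤ halfLineDeriv f t :=
  hf.mono.monotoneOn.derivWithin_nonneg

lemma continuousOn_halfLineDeriv (hf : IsAdmissible f s) :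
    ContinuousOn (halfLineDeriv f) (Ici 0) :=
  hf.smooth.continuousOn_derivWithin (uniqueDiffOn_Ici 0) (by simp)

lemma apply_zero_lt (hf : IsAdmissible f s) (t : ℝ) : f 0 < f (Real.exp t) :=
  hf.mono self_mem_Ici (Real.exp_pos t).le (Real.exp_pos t)

lemma exists_apply_eq (hf : IsAdmissible f s) : ∃ t : ℝ, 0 < t ∧ f t = s := by
  obtain ⟨t₁, ht₁, hst₁⟩ := hf.upper
  obtain ⟨t, ht, hts⟩ := intermediate_value_Icc ht₁.le
    (hf.smooth.continuousOn.mono Icc_subset_Ici_self) ⟨hf.lower.le, hst₁.le⟩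
  refine ⟨t, lt_of_le_of_ne ht.1 fun h => ?_, hts⟩
  rw [← h] at hts
  exact hf.lower.ne hts

end IsAdmissible

section LocIntegrable

variable {M : Type*} [TopologicalSpace M] [ChartedSpace Plane M]

lemma LocIntegrable.const_mul {w : M → ℝ} (hw : LocIntegrable w) (k : ℝ) :
    LocIntegrable fun x => k * w x := fun e he => (hw e he).smul k

lemma LocIntegrable.sub {w w' : M → ℝ} (hw : LocIntegrable w) (hw' : LocIntegrable w') :
    LocIntegrable fun x => w x - w' x := fun e he => (hw e he).sub (hw' e he)

lemma LocIntegrable.neg {w : M → ℝ} (hw : LocIntegrable w) : LocIntegrable fun x => -w x :=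
  fun e he => (hw e he).neg

end LocIntegrable

section System

variable {M : Type*} [TopologicalSpace M] [ChartedSpace Plane M] [IsManifold (𝓡 2) ∞ M]
  {g : SurfaceMetric M} {f : ℝ → ℝ} {s q : ℝ} {n : ℕ} {p : Fin n → M} {u v : M → ℝ}

/-- The regular part of `Δ u` for a solution `(u, v)` of the system. -/
def rhsU (f : ℝ → ℝ) (q : ℝ) (u v : M → ℝ) (x : M) : ℝ := -(q * (v x - f (Real.exp (u x))))

/-- The function `Δ v` for a solution `(u, v)` of the system. -/
def rhsV (f : ℝ → ℝ) (s q : ℝ) (u v : M → ℝ) (x : M) : ℝ :=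
  -(q * (halfLineDeriv f (Real.exp (u x)) * Real.exp (u x) * (s - v x)
    - q * (v x - f (Real.exp (u x)))))

lemma funPairing_neg (h : M → ℝ) (e : OpenPartialHomeomorph M Plane) (φ : Plane → ℝ) :
    funPairing g (fun x => -h x) e φ = -funPairing g h e φ := by
  simp only [funPairing, chartIntegral, neg_mul, integral_neg]

namespace IsSolution

lemma poisson_u (huv : IsSolution g f s q p u v) :
    IsPoissonSolution g u (rhsU f q u v) (4 * Real.pi) p where
  integrable := huv.integrable_u
  integrable_rhs := ((huv.integrable_v.sub huv.integrable_f).const_mul q).neg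
  eq := fun e he φ hφ => by
    have := huv.eq_u e he φ hφ
    unfold rhsU
    rw [funPairing_neg]
    linarith

lemma poisson_v (huv : IsSolution g f s q p u v) :
    IsPoissonSolution g v (rhsV f s q u v) 0 p where
  integrable := huv.integrable_v
  integrable_rhs := ((huv.integrable_f'.sub ((huv.integrable_v.sub
    huv.integrable_f).const_mul q)).const_mul q).neg
  eq := fun e he φ hφ => by
    have := huv.eq_v e he φ hφ
    unfold rhsV
    rw [funPairing_neg]
    linarith

/-- `u` and `v` are locally bounded above: for `f t₁ > s` and `t₁ = exp U`, the function
`(v - f t₁)⁺ + q (u - U)⁺` is subharmonic. -/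
lemma exists_essNhds_le (huv : IsSolution g f s q p u v) (hf : IsAdmissible f s) (hq : 0 < q)
    (x : M) : ∃ C : ℝ, ∀ᶠ z in essNhds x, u z ≤ C ∧ v z ≤ C := by
  obtain ⟨t₁, ht₁, hst₁⟩ := hf.upper
  have hπ : 0 ≤ 4 * Real.pi * multiplicity p x :=
    mul_nonneg (by positivity) (multiplicity_nonneg p x)
  obtain ⟨C, hC⟩ := exists_essNhds_le_of_kato (x := x) (a₁ := 1) (a₂ := q) (H := 0) huv.poisson_v
    huv.poisson_u (by simp) hπ zero_le_one hq.le le_rfl (f t₁) (Real.log t₁)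
    (Filter.Eventually.of_forall fun z => by
      have hD := hf.halfLineDeriv_nonneg (Real.exp (u z))
      have he := Real.exp_pos (u z)
      have hDe : 0 ≤ halfLineDeriv f (Real.exp (u z)) * Real.exp (u z) := mul_nonneg hD he.le
      have hU1 (h : u z ≤ Real.log t₁) : f (Real.exp (u z)) ≤ f t₁ := by
        refine hf.mono.monotoneOn he.le ht₁.le ?_
        rw [← Real.exp_log ht₁]
        exact Real.exp_le_exp.2 h
      have hU2 (h : Real.log t₁ ≤ u z) : f t₁ ≤ f (Real.exp (u z)) := by
        refine hf.mono.monotoneOn ht₁.le he.le ?_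
        rw [← Real.exp_log ht₁]
        exact Real.exp_le_exp.2 h
      -- The combination of the right-hand sides is `q f'(eᵘ) eᵘ` times the first of these two products
      -- plus `q²` times the second.
      have key : 0 ≤ Coeff.upperSign (v z - f t₁) * (v z - s) ∧
          0 ≤ (Coeff.upperSign (v z - f t₁) - Coeff.upperSign (u z - Real.log t₁))
            * (v z - f (Real.exp (u z))) := by
        have n1 := Coeff.upperSign_nonneg (u z - Real.log t₁)
        have n2 := Coeff.upperSign_le_one (u z - Real.log t₁)
        rcases lt_trichotomy (v z - f t₁) 0 with hv | hv | hv
        · rw [Coeff.upperSign_of_neg hv]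
          refine ⟨by simp, ?_⟩
          rcases lt_or_ge (u z - Real.log t₁) 0 with hu | hu
          · rw [Coeff.upperSign_of_neg hu]; simp
          · have := hU2 (by linarith)
            exact mul_nonneg_of_nonpos_of_nonpos (by linarith) (by linarith)
        · rw [hv, Coeff.upperSign_zero]
          refine ⟨mul_nonneg (by norm_num) (by linarith), ?_⟩
          rcases lt_trichotomy (u z - Real.log t₁) 0 with hu | hu | hu
          · rw [Coeff.upperSign_of_neg hu]
            have := hU1 (by linarith)
            exact mul_nonneg (by norm_num) (by linarith)
          · rw [hu, Coeff.upperSign_zero]; simp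
          · rw [Coeff.upperSign_of_pos hu]
            have := hU2 (by linarith)
            exact mul_nonneg_of_nonpos_of_nonpos (by norm_num) (by linarith)
        · rw [Coeff.upperSign_of_pos hv]
          refine ⟨by linarith, ?_⟩
          rcases lt_or_ge 0 (u z - Real.log t₁) with hu | hu
          · rw [Coeff.upperSign_of_pos hu]; simp
          · have := hU1 (by linarith)
            exact mul_nonneg (by linarith) (by linarith)
      have h1 := mul_nonneg hq.le (mul_nonneg hDe key.1)
      have h2 := mul_nonneg (mul_nonneg hq.le hq.le) key.2
      simp only [rhsU, rhsV]
      linarith)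
  refine ⟨max (f t₁ + C) (Real.log t₁ + C / q), ?_⟩
  filter_upwards [hC] with z hz
  have h1 := le_max_left (v z - f t₁) 0
  have h2 := le_max_right (v z - f t₁) 0
  have h3 := le_max_left (u z - Real.log t₁) 0
  have h4 := le_max_right (u z - Real.log t₁) 0
  have h5 : q * (u z - Real.log t₁) ≤ C :=
    (mul_le_mul_of_nonneg_left h3 hq.le).trans (by linarith)
  have h6 := mul_nonneg hq.le h4
  refine ⟨le_trans ?_ (le_max_right _ _), le_trans ?_ (le_max_left _ _)⟩
  · rw [← sub_le_iff_le_add', le_div_iff₀ hq]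
    linarith
  · linarith

/-- `v` is locally bounded below: since `f 0 < s` and `f 0 < f (exp u)`, the function `(f 0 - v)⁺` is
subharmonic. -/
lemma exists_essNhds_ge (huv : IsSolution g f s q p u v) (hf : IsAdmissible f s) (hq : 0 < q)
    (x : M) : ∃ C : ℝ, ∀ᶠ z in essNhds x, C ≤ v z := by
  have hk (z : M) : 0 ≤ Coeff.upperSign (-v z - -f 0) * -rhsV f s q u v z := by
    have hD := hf.halfLineDeriv_nonneg (Real.exp (u z))
    have he := Real.exp_pos (u z)
    rcases lt_or_ge (-v z - -f 0) 0 with h | h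
    · rw [Coeff.upperSign_of_neg h, zero_mul]
    · refine mul_nonneg (Coeff.upperSign_nonneg _) ?_
      have h1 := hf.lower
      have h2 := hf.apply_zero_lt (u z)
      rw [rhsV, neg_neg]
      have h3 : 0 ≤ halfLineDeriv f (Real.exp (u z)) * Real.exp (u z) * (s - v z) :=
        mul_nonneg (mul_nonneg hD he.le) (by linarith)
      have h4 : 0 ≤ q * (f (Real.exp (u z)) - v z) := mul_nonneg hq.le (by linarith)
      exact mul_nonneg hq.le (by linarith)
  obtain ⟨C, hC⟩ := exists_essNhds_le_of_kato (x := x) (a₁ := 1) (a₂ := 0) (H := 0)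
    huv.poisson_v.neg huv.poisson_v.neg (by simp) (by simp) zero_le_one le_rfl le_rfl
    (-f 0) (-f 0) (Filter.Eventually.of_forall fun z => by linarith [hk z])
  refine ⟨f 0 - C, ?_⟩
  filter_upwards [hC] with z hz
  have h1 := le_max_left (-v z - -f 0) 0
  linarith

lemma exists_essNhds_bound (huv : IsSolution g f s q p u v) (hf : IsAdmissible f s) (hq : 0 < q)
    (x : M) : ∃ B : ℝ, ∀ᶠ z in essNhds x, u z ≤ B ∧ |v z| ≤ B ∧ |rhsU f q u v z| ≤ B ∧
      |rhsV f s q u v z| ≤ B := by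
  obtain ⟨C₁, h₁⟩ := huv.exists_essNhds_le hf hq x
  obtain ⟨C₂, h₂⟩ := huv.exists_essNhds_ge hf hq x
  have hK : IsCompact (Icc 0 (Real.exp C₁)) := isCompact_Icc
  obtain ⟨C₃, h₃⟩ := hK.exists_bound_of_continuousOn
    (hf.smooth.continuousOn.mono Icc_subset_Ici_self)
  obtain ⟨C₄, h₄⟩ := hK.exists_bound_of_continuousOn
    ((hf.continuousOn_halfLineDeriv.mul continuousOn_id).mono Icc_subset_Ici_self)
  set V := max |C₁| |C₂|
  refine ⟨max (max C₁ V) (max (q * (V + C₃)) (q * (C₄ * (|s| + V) + q * (V + C₃)))), ?_⟩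
  filter_upwards [h₁, h₂] with z h₁ h₂
  have ht : Real.exp (u z) ∈ Icc 0 (Real.exp C₁) :=
    ⟨(Real.exp_pos _).le, Real.exp_le_exp.2 h₁.1⟩
  have b1 : |v z| ≤ V := by
    rw [abs_le]
    constructor
    · linarith [neg_abs_le C₂, le_max_right |C₁| |C₂|]
    · linarith [le_abs_self C₁, le_max_left |C₁| |C₂|]
  have b2 : |f (Real.exp (u z))| ≤ C₃ := h₃ _ ht
  have b3 : |halfLineDeriv f (Real.exp (u z)) * Real.exp (u z)| ≤ C₄ := h₄ _ ht
  have b4 : |v z - f (Real.exp (u z))| ≤ V + C₃ := (abs_sub _ _).trans (add_le_add b1 b2)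
  have b5 : |s - v z| ≤ |s| + V := (abs_sub _ _).trans (add_le_add le_rfl b1)
  have b6 : |q * (v z - f (Real.exp (u z)))| ≤ q * (V + C₃) := by
    rw [abs_mul, abs_of_pos hq]
    exact mul_le_mul_of_nonneg_left b4 hq.le
  have b7 : |halfLineDeriv f (Real.exp (u z)) * Real.exp (u z) * (s - v z)| ≤ C₄ * (|s| + V) := by
    rw [abs_mul]
    exact mul_le_mul b3 b5 (abs_nonneg _) ((abs_nonneg _).trans b3)
  refine ⟨h₁.1.trans ((le_max_left _ _).trans (le_max_left _ _)),
    b1.trans ((le_max_right _ _).trans (le_max_left _ _)), ?_, ?_⟩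
  · rw [rhsU, abs_neg]
    exact b6.trans ((le_max_left _ _).trans (le_max_right _ _))
  · rw [rhsV, abs_neg, abs_mul, abs_of_pos hq]
    refine le_trans ?_ ((le_max_right _ _).trans (le_max_right _ _))
    exact mul_le_mul_of_nonneg_left ((abs_sub _ _).trans (add_le_add b7 b6)) hq.le

/-- `v` has a continuous version. -/
lemma exists_continuous (huv : IsSolution g f s q p u v) (hf : IsAdmissible f s) (hq : 0 < q) :
    ∃ V : M → ℝ, Continuous V ∧ AlmostEverywhere fun x => v x = V x :=
  exists_continuous_of_essNhds fun x => by
    obtain ⟨B, hB⟩ := huv.exists_essNhds_bound hf hq x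
    exact exists_continuousAt_of_bounded huv.poisson_v (by simp) (hB.mono fun z hz => hz.2.1)
      (hB.mono fun z hz => hz.2.2.2)

/-- The function `exp u` tends to zero at the vortices. -/
lemma tendsto_exp_vortex (huv : IsSolution g f s q p u v) (hf : IsAdmissible f s) (hq : 0 < q)
    (j : Fin n) :
    Filter.Tendsto (fun z => Real.exp (u z)) (essNhds (p j)) (nhdsWithin 0 (Ici 0)) := by
  obtain ⟨B, hB⟩ := huv.exists_essNhds_bound hf hq (p j)
  have h := tendsto_atBot_of_dirac huv.poisson_u
    (mul_pos (by positivity) (multiplicity_pos p j)) (hB.mono fun z hz => hz.1)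
    (hB.mono fun z hz => hz.2.2.1)
  exact tendsto_nhdsWithin_iff.2 ⟨Real.tendsto_exp_atBot.comp h,
    Filter.Eventually.of_forall fun z => (Real.exp_pos _).le⟩

/-- The limit of `Δ v` at a vortex: the term with `f'(eᵘ) eᵘ` tends to zero there. -/
lemma tendsto_rhsV_vortex (huv : IsSolution g f s q p u v) (hf : IsAdmissible f s) (hq : 0 < q)
    (j : Fin n) {l : ℝ} (hv : Filter.Tendsto v (essNhds (p j)) (nhds l)) :
    Filter.Tendsto (rhsV f s q u v) (essNhds (p j)) (nhds (q * (q * (l - f 0)))) := by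
  have h := huv.tendsto_exp_vortex hf hq j
  have h1 := (hf.smooth.continuousOn 0 self_mem_Ici).tendsto.comp h
  have h2 := ((hf.continuousOn_halfLineDeriv.mul continuousOn_id) 0 self_mem_Ici).tendsto.comp h
  have h3 := (((h2.mul (hv.const_sub s)).sub ((hv.sub h1).const_mul q)).const_mul q).neg
  have e : q * (q * (l - f 0)) =
      -(q * ((fun t => halfLineDeriv f t * id t) 0 * (s - l) - q * (l - f 0))) := by
    simp only [id, mul_zero]
    ring
  rw [e]
  exact h3.congr' (Filter.Eventually.of_forall fun z => rfl)

/-- If `v` is constant, there is no vortex: the limit of `Δ v = 0` at a vortex would give `v = f 0`,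
and then `Δ v < 0`. -/
lemma eq_zero_of_const (huv : IsSolution g f s q p u v) (hf : IsAdmissible f s) (hq : 0 < q) {c : ℝ}
    (hc : AlmostEverywhere fun x => v x = c) : n = 0 := by
  by_contra hn
  let j : Fin n := ⟨0, Nat.pos_of_ne_zero hn⟩
  have h0 := eventually_eq_zero_of_const (x := p j) huv.poisson_v (by simp) (hc.essNhds _)
  have hv : Filter.Tendsto v (essNhds (p j)) (nhds c) :=
    tendsto_const_nhds.congr' ((hc.essNhds _).mono fun z hz => hz.symm)
  have h1 := tendsto_nhds_unique (huv.tendsto_rhsV_vortex hf hq j hv)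
    (tendsto_const_nhds.congr' (h0.mono fun z hz => hz.symm))
  have hcf : c = f 0 := by
    have := (mul_eq_zero.1 ((mul_eq_zero.1 h1).resolve_left hq.ne')).resolve_left hq.ne'
    linarith
  obtain ⟨z, hz, hz'⟩ := (h0.and (hc.essNhds (p j))).exists
  have hD := hf.halfLineDeriv_nonneg (Real.exp (u z))
  have he := Real.exp_pos (u z)
  have h2 := hf.apply_zero_lt (u z)
  have h3 := hf.lower
  rw [rhsV, hz', hcf] at hz
  have h4 : 0 ≤ halfLineDeriv f (Real.exp (u z)) * Real.exp (u z) * (s - f 0) :=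
    mul_nonneg (mul_nonneg hD he.le) (by linarith)
  have h5 : 0 < q * (f (Real.exp (u z)) - f 0) := mul_pos hq (by linarith)
  have h6 := mul_pos hq (add_pos_of_nonneg_of_pos h4 h5)
  linarith

/-- Without vortices, a solution with `v` constant is trivial if `f' > 0`: otherwise `Δ u` would have
a strict sign, which is impossible on a compact surface. -/
lemma eq_of_const [CompactSpace M] {p : Fin 0 → M} (huv : IsSolution g f s q p u v)
    (hf : IsAdmissible f s) (hq : 0 < q) (hf' : ∀ t : ℝ, 0 < t → 0 < halfLineDeriv f t) {c : ℝ}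
    (hc : AlmostEverywhere fun x => v x = c) {t : ℝ} (ht : 0 < t) (hts : f t = s) :
    AlmostEverywhere fun x => Real.exp (u x) = t ∧ v x = s := by
  -- the second equation says that the two terms of its right-hand side cancel
  have hF (x : M) : ∀ᶠ z in essNhds x, v z = c ∧
      halfLineDeriv f (Real.exp (u z)) * Real.exp (u z) * (s - c)
        = q * (c - f (Real.exp (u z))) := by
    filter_upwards [eventually_eq_zero_of_const (x := x) huv.poisson_v (by simp) (hc.essNhds _),
      hc.essNhds x] with z hz hz'
    rw [rhsV, hz', neg_eq_zero, mul_eq_zero] at hz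
    exact ⟨hz', sub_eq_zero.1 (hz.resolve_left hq.ne')⟩
  refine almostEverywhere_of_essNhds fun x => ?_
  by_cases hcs : c = s
  · filter_upwards [hF x] with z hz
    obtain ⟨hz', hz⟩ := hz
    rw [hcs, sub_self, mul_zero] at hz
    have h1 : f (Real.exp (u z)) = f t := by
      have := (mul_eq_zero.1 hz.symm).resolve_left hq.ne'
      linarith
    exact ⟨hf.mono.injOn (Real.exp_pos _).le ht.le h1, hz'.trans hcs⟩
  exfalso
  have hm (x : M) (k : ℝ) : k * multiplicity p x = 0 := by rw [multiplicity_fin_zero, mul_zero]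
  obtain ⟨W, hW, hWu⟩ : ∃ W : M → ℝ, Continuous W ∧ AlmostEverywhere fun x => u x = W x := by
    refine exists_continuous_of_essNhds fun x => ?_
    obtain ⟨B, hB⟩ := huv.exists_essNhds_bound hf hq x
    obtain ⟨C, hC⟩ := exists_essNhds_abs_le huv.poisson_u (hm x _) (hB.mono fun z hz => hz.2.2.1)
    exact exists_continuousAt_of_bounded (B := max B C) huv.poisson_u (hm x _)
      (hC.mono fun z hz => hz.trans (le_max_right _ _))
      (hB.mono fun z hz => hz.2.2.1.trans (le_max_left _ _))
  have hlim (y : M) : Filter.Tendsto (rhsU f q u v) (essNhds y)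
      (nhds (-(halfLineDeriv f (Real.exp (W y)) * Real.exp (W y) * (s - c)))) := by
    have h1 : Filter.Tendsto (fun z => Real.exp (W z)) (nhds y)
        (nhdsWithin (Real.exp (W y)) (Ici 0)) :=
      tendsto_nhdsWithin_iff.2 ⟨(Real.continuous_exp.comp hW).tendsto y,
        Filter.Eventually.of_forall fun z => (Real.exp_pos _).le⟩
    have h2 := ((hf.continuousOn_halfLineDeriv.mul continuousOn_id) (Real.exp (W y))
      (Real.exp_pos _).le).tendsto.comp (h1.mono_left (essNhds_le y))
    refine ((h2.mul_const (s - c)).neg).congr' ?_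
    filter_upwards [hF y, hWu.essNhds y] with z hz hz'
    simp only [Function.comp, Pi.mul_apply, id]
    rw [← hz', hz.2, rhsU, hz.1]
  have hne : (univ : Set M).Nonempty := ⟨x, mem_univ x⟩
  rcases lt_or_gt_of_ne hcs with h | h
  · obtain ⟨y, -, hy⟩ := isCompact_univ.exists_isMinOn hne hW.continuousOn
    have hpos : 0 < halfLineDeriv f (Real.exp (W y)) * Real.exp (W y) * (s - c) :=
      mul_pos (mul_pos (hf' _ (Real.exp_pos _)) (Real.exp_pos _)) (by linarith)
    have hl := (hlim y).neg
    rw [neg_neg] at hl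
    refine not_isLocalMax_of_subharmonic huv.poisson_u.neg (hm y _).ge hW.neg.continuousAt
      ((hWu.essNhds y).mono fun z hz => by simp [hz])
      (Filter.Eventually.of_forall fun z => ?_) (half_pos hpos)
      ((hl.eventually (Ioi_mem_nhds (half_lt_self hpos))).mono fun z hz => le_of_lt hz)
    exact neg_le_neg (hy (mem_univ z))
  · obtain ⟨y, -, hy⟩ := isCompact_univ.exists_isMaxOn hne hW.continuousOn
    have hpos : 0 < -(halfLineDeriv f (Real.exp (W y)) * Real.exp (W y) * (s - c)) := by
      rw [← mul_neg]
      exact mul_pos (mul_pos (hf' _ (Real.exp_pos _)) (Real.exp_pos _)) (by linarith)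
    exact not_isLocalMax_of_subharmonic huv.poisson_u (hm y _).ge hW.continuousAt
      (hWu.essNhds y) (Filter.Eventually.of_forall fun z => hy (mem_univ z)) (half_pos hpos)
      (((hlim y).eventually (Ioi_mem_nhds (half_lt_self hpos))).mono fun z hz => le_of_lt hz)

/-- The continuous version of `v` does not attain its maximum at a vortex. If its value there
exceeds `f 0`, then `v` is strictly subharmonic near the vortex. Otherwise `v ≤ f 0` everywhere, and
`v` is strictly superharmonic near its minimum. -/
lemma ne_vortex_of_max [CompactSpace M] (huv : IsSolution g f s q p u v) (hf : IsAdmissible f s)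
    (hq : 0 < q) {V : M → ℝ} (hV : Continuous V) (hvV : AlmostEverywhere fun x => v x = V x) {x : M}
    (hx : ∀ y, V y ≤ V x) (j : Fin n) : x ≠ p j := by
  rintro rfl
  have hlim (y : M) : Filter.Tendsto v (essNhds y) (nhds (V y)) :=
    (hV.continuousAt.tendsto.mono_left (essNhds_le y)).congr'
      ((hvV.essNhds y).mono fun z hz => hz.symm)
  rcases lt_or_ge (f 0) (V (p j)) with h | h
  · have hpos : 0 < q * (q * (V (p j) - f 0)) := by
      have := sub_pos.2 h
      positivity
    exact not_isLocalMax_of_subharmonic huv.poisson_v (by simp) hV.continuousAt (hvV.essNhds _)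
      (Filter.Eventually.of_forall hx) (half_pos hpos)
      (((huv.tendsto_rhsV_vortex hf hq j (hlim _)).eventually
        (Ioi_mem_nhds (half_lt_self hpos))).mono fun z hz => le_of_lt hz)
  · obtain ⟨y, -, hy⟩ := isCompact_univ.exists_isMinOn ⟨p j, mem_univ _⟩ hV.continuousOn
    rcases lt_or_ge (V y) (f 0) with h' | h'
    · obtain ⟨κ, hκ1, hκ2⟩ := exists_between h'
      have hpos : 0 < q * (q * (f 0 - κ)) := by
        have := sub_pos.2 hκ2
        positivity
      refine not_isLocalMax_of_subharmonic huv.poisson_v.neg (by simp) hV.neg.continuousAt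
        ((hvV.essNhds y).mono fun z hz => by simp [hz])
        (Filter.Eventually.of_forall fun z => neg_le_neg (hy (mem_univ z))) hpos ?_
      filter_upwards [(hlim y).eventually (Iio_mem_nhds hκ1)] with z hz
      have hz : v z < κ := hz
      have hD := hf.halfLineDeriv_nonneg (Real.exp (u z))
      have he := Real.exp_pos (u z)
      have h2 := hf.apply_zero_lt (u z)
      have h3 := hf.lower
      have h4 : 0 ≤ halfLineDeriv f (Real.exp (u z)) * Real.exp (u z) * (s - v z) :=
        mul_nonneg (mul_nonneg hD he.le) (by linarith)
      have h5 : q * (f 0 - κ) ≤ q * (f (Real.exp (u z)) - v z) :=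
        mul_le_mul_of_nonneg_left (by linarith) hq.le
      rw [rhsV, neg_neg]
      exact mul_le_mul_of_nonneg_left (by linarith) hq.le
    · have hconst (z : M) : V z = f 0 :=
        le_antisymm ((hx z).trans h) (h'.trans (hy (mem_univ z)))
      have h0 := huv.eq_zero_of_const hf hq (c := f 0)
        (fun e he => (hvV e he).mono fun y hy => hy.trans (hconst _))
      exact absurd j.2 (by omega)

end IsSolution

end System

end VortexSystem

end

theorem mainTheorem5 {M : Type*} [TopologicalSpace M] [T2Space M] [CompactSpace M]
    [ChartedSpace VortexSystem.Plane M] [IsManifold (𝓡 2) ∞ M]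
    (g : VortexSystem.SurfaceMetric M)
    (f : ℝ → ℝ) (hf_smooth : ContDiffOn ℝ ∞ f (Set.Ici 0)) (hf_mono : StrictMonoOn f (Set.Ici 0))
    (s : ℝ) (hs_lower : f 0 < s) (hs_upper : ∃ t : ℝ, 0 < t ∧ s < f t)
    (q : ℝ) (hq : 0 < q) (n : ℕ) (p : Fin n → M) (u v : M → ℝ)
    (huv : VortexSystem.IsSolution g f s q p u v) :
    -- if `v` is constant, then `n = 0`, and the solution is the trivial one
    ((∃ c : ℝ, VortexSystem.AlmostEverywhere fun x => v x = c) →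
      n = 0 ∧
      ((∀ t : ℝ, 0 < t → 0 < VortexSystem.halfLineDeriv f t) →
        ∃ t : ℝ, 0 < t ∧ f t = s ∧
          VortexSystem.AlmostEverywhere fun x => Real.exp (u x) = t ∧ v x = s)) ∧
    -- if `n > 0`, then `v` is not constant
    (0 < n → ¬ ∃ c : ℝ, VortexSystem.AlmostEverywhere fun x => v x = c) ∧
    -- `v` is a continuous function, and if `n > 0` its maximum is attained, but at no vortex point
    (∃ V : M → ℝ, Continuous V ∧ (VortexSystem.AlmostEverywhere fun x => v x = V x) ∧
      (0 < n →
        (∃ x : M, (∀ y : M, V y ≤ V x) ∧ ∀ j : Fin n, x ≠ p j) ∧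
        (∀ x : M, (∀ y : M, V y ≤ V x) → ∀ j : Fin n, x ≠ p j))) := by
  have hf : VortexSystem.IsAdmissible f s := ⟨hf_smooth, hf_mono, hs_lower, hs_upper⟩
  refine ⟨?_, fun hn ⟨c, hc⟩ => hn.ne' (huv.eq_zero_of_const hf hq hc), ?_⟩
  · rintro ⟨c, hc⟩
    have hn := huv.eq_zero_of_const hf hq hc
    refine ⟨hn, fun hf' => ?_⟩
    subst hn
    obtain ⟨t, ht, hts⟩ := hf.exists_apply_eq
    exact ⟨t, ht, hts, huv.eq_of_const hf hq hf' hc ht hts⟩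
  · obtain ⟨V, hV, hvV⟩ := huv.exists_continuous hf hq
    refine ⟨V, hV, hvV, fun hn => ⟨?_, fun x hx j => huv.ne_vortex_of_max hf hq hV hvV hx j⟩⟩
    obtain ⟨x, -, hx⟩ := isCompact_univ.exists_isMaxOn ⟨p ⟨0, hn⟩, mem_univ _⟩ hV.continuousOn
    exact ⟨x, fun y => hx (mem_univ y),
      fun j => huv.ne_vortex_of_max hf hq hV hvV (fun y => hx (mem_univ y)) j⟩
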